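/- **Setting.** Let $(M,g)$ be a connected oriented smooth Riemannian four-manifold with a spin structure, and let $\mathbb S,\mathbb S'$ be its complex rank-two spin bundles, with parallel symplectic forms $\varepsilon_{AB},\varepsilon_{A'B'}$ ($\varepsilon_{01}=\varepsilon_{0'1'}=1$ in spin frames), $\mathbb C\otimes TM\cong\mathbb S\otimes\mathbb S'$ and $g=\varepsilon\otimes\varepsilon'$; the orientation is such that the two-forms $\phi_{AB}\varepsilon_{A'B'}$ with $\phi_{AB}=\phi_{BA}$ are the anti-self-dual ones. Let $\nabla$ be the Levi-Civita connection. Curvature conventions: $[\nabla_a,\nabla_b]V^d=R_{abc}{}^dV^c$, $R_{ab}=R_{acb}{}^c$, $R=R_a{}^a$, $\Lambda=R/24$ (so that $\Lambda<0$ on the round four-sphere). Let $A_a$ be a smooth real one-form whose Maxwell field $F_{ab}=\nabla_aA_b-\nabla_bA_a$ (that is, $F=2\,dA$ with $F=F_{ab}\,e^a\wedge e^b$) is anti-self-dual, $*F=-F$, and write $F_{ab}=\phi_{AB}\varepsilon_{A'B'}$. Suppose that for some complex constants $c_0,\dots,c_4$ there are smooth sections $\alpha_A$ of $\mathbb S$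 and $\beta_{A'}$ of $\mathbb S'$, neither of them identically zero, which satisfy the Killing spinor equations $$\nabla_{AA'}\alpha_B+c_0A_a\alpha_B+(c_1\phi_{AB}+c_2\varepsilon_{AB})\beta_{A'}=0,$$ $$\nabla_{AA'}\beta_{B'}+c_3A_a\beta_{B'}+c_4\varepsilon_{A'B'}\alpha_A=0 .$$ If $F$ vanishes identically, assume in addition that $c_0=c_3$. **Proposition 1.** Then $(M,g)$ is anti-self-dual (the self-dual part of its Weyl tensor vanishes) and Einstein (its trace-free Ricci tensor vanishes). Moreover $c_0=c_3$ and $c_2c_4=-\Lambda$; and if $F$ does not vanish identically, then $c_3=-c_1c_4$. -/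

import Mathlib

open scoped Manifold ContDiff

noncomputable section

namespace KillingSpinor

/-- The model space of a four-dimensional manifold. -/
abbrev E4 : Type := EuclideanSpace ℝ (Fin 4)

/-! ### Two-component spinor algebra -/

/-- The symplectic symbol `ε`, with `ε₀₁ = 1`. The components `ε_{AB}`, `ε^{AB}`, `ε_{A'B'}` and
`ε^{A'B'}` are all given by this matrix. -/
def eps : Matrix (Fin 2) (Fin 2) ℂ := !![0, 1; -1, 0]

/-- The unit quaternions `1, iτ₁, iτ₂, iτ₃` (`τⱼ` the Pauli matrices) as complex matrices. -/
def quat : Fin 4 → Matrix (Fin 2) (Fin 2) ℂ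
  | 0 => 1
  | 1 => !![0, Complex.I; Complex.I, 0]
  | 2 => !![0, 1; -1, 0]
  | 3 => !![Complex.I, 0; 0, -Complex.I]

/-- The soldering symbols `σ^a_{AA'}`: the covector (or vector) with components `V_a` in an
oriented orthonormal frame is the bispinor `V_{AA'} = Σ_a V_a σ^a_{AA'}`. They satisfy
`ε^{AB} ε^{A'B'} σ^a_{AA'} σ^b_{BB'} = δ^{ab}`, i.e. `g = ε ⊗ ε'`, and real vectors are the
bispinors fixed by the quaternionic conjugation `(p, q) ↦ (q̄, -p̄)` on both indices. -/
def solder (a : Fin 4) (A A' : Fin 2) : ℂ := ((1 / Real.sqrt 2 : ℝ) : ℂ) * quat a A A'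

/-- The relation `g = ε ⊗ ε'` between the metric and the symplectic forms. -/
theorem solder_metric (a b : Fin 4) :
    ∑ A, ∑ A', ∑ B, ∑ B', eps A B * eps A' B' * solder a A A' * solder b B B'
      = if a = b then 1 else 0 := by
  have h : (((Real.sqrt 2 : ℝ) : ℂ))⁻¹ * (((Real.sqrt 2 : ℝ) : ℂ))⁻¹ = 1 / 2 := by
    rw [← mul_inv, ← Complex.ofReal_mul, Real.mul_self_sqrt (by norm_num)]; norm_num
  fin_cases a <;> fin_cases b <;>
    simp [Fin.sum_univ_two, eps, solder, quat, Matrix.one_apply] <;>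
    ring_nf <;> simp [pow_two, h]

/-- The totally antisymmetric symbol in four indices with `ε₀₁₂₃ = 1` (the sign of a Vandermonde
product). -/
def levi (a b c d : Fin 4) : ℝ :=
  ((Int.sign (((b : ℤ) - a) * ((c : ℤ) - a) * ((d : ℤ) - a) * ((c : ℤ) - b) * ((d : ℤ) - b)
    * ((d : ℤ) - c)) : ℤ) : ℝ)

/-- Kronecker delta. -/
def kron (a b : Fin 4) : ℝ := if a = b then 1 else 0

/-- The Hodge dual `(*F)_{ab} = ½ ε_{abcd} F_{cd}` of a two-form, in the components with respect to
an oriented orthonormal frame. -/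
def hodge (F : Fin 4 → Fin 4 → ℝ) (a b : Fin 4) : ℝ :=
  (1 / 2) * ∑ c, ∑ d, levi a b c d * F c d

/-- The unprimed spinor `φ_{AB} = ½ F_{AA'BB'} ε^{A'B'}` of a real two-form; when `F` is
anti-self-dual, `F_{ab} = φ_{AB} ε_{A'B'}`. -/
def twoFormSpinor (F : Fin 4 → Fin 4 → ℝ) (A B : Fin 2) : ℂ :=
  (1 / 2) * ∑ A', ∑ B', eps A' B' * ∑ a, ∑ b, solder a A A' * solder b B B' * (F a b : ℂ)

section Geometry

variable {M : Type*} [TopologicalSpace M] [ChartedSpace E4 M]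

/-! ### Riemannian geometry in an orthonormal frame -/

/-- A (not necessarily continuous) vector field. -/
abbrev VField (M : Type*) [TopologicalSpace M] [ChartedSpace E4 M] : Type _ :=
  Π x : M, TangentSpace 𝓘(ℝ, E4) x

/-- Smooth Riemannian metrics. -/
abbrev Metric4 (M : Type*) [TopologicalSpace M] [ChartedSpace E4 M]
    [IsManifold 𝓘(ℝ, E4) ∞ M] : Type _ :=
  Bundle.ContMDiffRiemannianMetric 𝓘(ℝ, E4) ∞ E4 (fun x : M => TangentSpace 𝓘(ℝ, E4) x)

/-- The derivative `X f` of a real function. -/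
def dR (X : VField M) (f : M → ℝ) (x : M) : ℝ := mfderiv 𝓘(ℝ, E4) 𝓘(ℝ, ℝ) f x (X x)

/-- The derivative `X f` of a complex function. -/
def dC (X : VField M) (f : M → ℂ) (x : M) : ℂ := mfderiv 𝓘(ℝ, E4) 𝓘(ℝ, ℂ) f x (X x)

variable [IsManifold 𝓘(ℝ, E4) ∞ M]

/-- `e` is a smooth orthonormal frame on the set `U`. -/
def IsOrthonormalFrame (g : Metric4 M) (U : Set M) (e : Fin 4 → VField M) : Prop :=
  (∀ a, ContMDiffOn 𝓘(ℝ, E4) 𝓘(ℝ, E4).tangent ∞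
    (fun x => (⟨x, e a x⟩ : TangentBundle 𝓘(ℝ, E4) M)) U) ∧
  ∀ x ∈ U, ∀ a b, g.inner x (e a x) (e b x) = kron a b

/-- Structure functions `C_{abc} = g([e_a, e_b], e_c)`. -/
def structFun (g : Metric4 M) (e : Fin 4 → VField M) (a b c : Fin 4) (x : M) : ℝ :=
  g.inner x (VectorField.mlieBracket 𝓘(ℝ, E4) (e a) (e b) x) (e c x)

/-- Levi-Civita coefficients `ω_{abc} = g(∇_{e_a} e_b, e_c)` (the Koszul formula in an orthonormal
frame). -/
def leviCivita (g : Metric4 M) (e : Fin 4 → VField M) (a b c : Fin 4) (x : M) : ℝ :=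
  (1 / 2) * (structFun g e a b c x - structFun g e b c a x + structFun g e c a b x)

/-- The Riemann tensor `R_{abcd} = g(∇_{e_a}∇_{e_b} e_c - ∇_{e_b}∇_{e_a} e_c - ∇_{[e_a,e_b]} e_c, e_d)`,
so that `[∇_a, ∇_b] V^d = R_{abc}{}^d V^c`. -/
def riemann (g : Metric4 M) (e : Fin 4 → VField M) (a b c d : Fin 4) (x : M) : ℝ :=
  dR (e a) (leviCivita g e b c d) x - dR (e b) (leviCivita g e a c d) x
    + ∑ f, (leviCivita g e b c f x * leviCivita g e a f d x
        - leviCivita g e a c f x * leviCivita g e b f d x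
        - structFun g e a b f x * leviCivita g e f c d x)

/-- The Ricci tensor in the convention `R_{ab} = R_{acb}{}^c` (negative on round spheres). -/
def ricci (g : Metric4 M) (e : Fin 4 → VField M) (a b : Fin 4) (x : M) : ℝ :=
  ∑ c, riemann g e a c b c x

/-- The scalar curvature `R = R_a{}^a` in the same convention (negative on round spheres). -/
def scalar (g : Metric4 M) (e : Fin 4 → VField M) (x : M) : ℝ := ∑ a, ricci g e a a x

/-- The Weyl tensor, the trace-free part of the Riemann tensor. -/
def weyl (g : Metric4 M) (e : Fin 4 → VField M) (a b c d : Fin 4) (x : M) : ℝ :=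
  riemann g e a b c d x
    - (1 / 2) * (kron a c * ricci g e b d x - kron a d * ricci g e b c x
        - kron b c * ricci g e a d x + kron b d * ricci g e a c x)
    + (scalar g e x / 6) * (kron a c * kron b d - kron a d * kron b c)

/-! ### Spin structures and spinor fields -/

/-- A spin structure on an oriented Riemannian four-manifold, presented by local spin frames: smooth
orthonormal frames `e i` on the members `U i` of an open cover, and a smooth cocycle
`(h i j, h' i j)` with values in `SU(2) × SU(2) = Spin(4)` that lifts the changes of frame. The
orientation is the one for which the frames `e i` are positively oriented. The rank-two bundles `𝕊`
(unprimed) and `𝕊'` (primed) have the transition matrices `h` and `h'`, acting on lower-index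
components; they preserve `ε`, `ε'` and the quaternionic conjugations. -/
structure SpinStructure (g : Metric4 M) where
  /-- The index set of the cover. -/
  ι : Type*
  /-- The cover. -/
  U : ι → Set M
  isOpen_U : ∀ i, IsOpen (U i)
  covers : ∀ x, ∃ i, x ∈ U i
  /-- The orthonormal frames. -/
  e : ι → Fin 4 → VField M
  frame : ∀ i, IsOrthonormalFrame g (U i) (e i)
  /-- Transition matrices of `𝕊`. -/
  h : ι → ι → M → Matrix (Fin 2) (Fin 2) ℂ
  /-- Transition matrices of `𝕊'`. -/
  h' : ι → ι → M → Matrix (Fin 2) (Fin 2) ℂ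
  smooth_h : ∀ i j A B, ContMDiffOn 𝓘(ℝ, E4) 𝓘(ℝ, ℂ) ∞ (fun x => h i j x A B) (U i ∩ U j)
  smooth_h' : ∀ i j A B, ContMDiffOn 𝓘(ℝ, E4) 𝓘(ℝ, ℂ) ∞ (fun x => h' i j x A B) (U i ∩ U j)
  h_mem : ∀ i j, ∀ x ∈ U i ∩ U j, h i j x ∈ Matrix.specialUnitaryGroup (Fin 2) ℂ
  h'_mem : ∀ i j, ∀ x ∈ U i ∩ U j, h' i j x ∈ Matrix.specialUnitaryGroup (Fin 2) ℂ
  cocycle_h : ∀ i j k, ∀ x ∈ U i ∩ U j ∩ U k, h i j x * h j k x = h i k x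
  cocycle_h' : ∀ i j k, ∀ x ∈ U i ∩ U j ∩ U k, h' i j x * h' j k x = h' i k x
  lifts : ∀ i j, ∀ x ∈ U i ∩ U j, ∀ b,
    ∑ a, ((g.inner x (e i a x) (e j b x) : ℝ) : ℂ) • quat a
      = h i j x * quat b * (h' i j x).transpose

variable {g : Metric4 M}

/-- Smooth sections `α_A` of `𝕊` (lower index), through their components in the spin frames. -/
structure Spinor (S : SpinStructure g) where
  /-- The components. -/
  comp : S.ι → M → Fin 2 → ℂ
  smooth : ∀ i A, ContMDiffOn 𝓘(ℝ, E4) 𝓘(ℝ, ℂ) ∞ (fun x => comp i x A) (S.U i)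
  change : ∀ i j, ∀ x ∈ S.U i ∩ S.U j, comp i x = (S.h i j x).mulVec (comp j x)

/-- Smooth sections `β_{A'}` of `𝕊'` (lower index), through their components in the spin frames. -/
structure Spinor' (S : SpinStructure g) where
  /-- The components. -/
  comp : S.ι → M → Fin 2 → ℂ
  smooth : ∀ i A, ContMDiffOn 𝓘(ℝ, E4) 𝓘(ℝ, ℂ) ∞ (fun x => comp i x A) (S.U i)
  change : ∀ i j, ∀ x ∈ S.U i ∩ S.U j, comp i x = (S.h' i j x).mulVec (comp j x)

/-- The section does not vanish identically. -/
def Spinor.IsNonzero {S : SpinStructure g} (α : Spinor S) : Prop :=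
  ∃ i, ∃ x ∈ S.U i, α.comp i x ≠ 0

/-- The section does not vanish identically. -/
def Spinor'.IsNonzero {S : SpinStructure g} (β : Spinor' S) : Prop :=
  ∃ i, ∃ x ∈ S.U i, β.comp i x ≠ 0

/-- The `𝔰𝔲(2)` matrix `Γ_a = ¼ Σ ω_{abc} σ_c σ_b†` of the spin connection on `𝕊`. Together with
`spinConn'` it is the only pair of trace-free matrices for which the soldering form is parallel,
`Σ_c ω_{abc} σ_c = Γ_a σ_b + σ_b Γ'_aᵀ`. -/
def spinConn (g : Metric4 M) (e : Fin 4 → VField M) (a : Fin 4) (x : M) :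
    Matrix (Fin 2) (Fin 2) ℂ :=
  (1 / 4 : ℂ) • ∑ b, ∑ c, ((leviCivita g e a b c x : ℝ) : ℂ) •
    (quat c * (quat b).conjTranspose)

/-- The `𝔰𝔲(2)` matrix `Γ'_a = ¼ (Σ ω_{abc} σ_b† σ_c)ᵀ` of the spin connection on `𝕊'`. -/
def spinConn' (g : Metric4 M) (e : Fin 4 → VField M) (a : Fin 4) (x : M) :
    Matrix (Fin 2) (Fin 2) ℂ :=
  (1 / 4 : ℂ) • (∑ b, ∑ c, ((leviCivita g e a b c x : ℝ) : ℂ) •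
    ((quat b).conjTranspose * quat c)).transpose

namespace SpinStructure

variable (S : SpinStructure g)

/-- The components of `∇_{e_a} α_B`. -/
def nabla (α : Spinor S) (i : S.ι) (a : Fin 4) (B : Fin 2) (x : M) : ℂ :=
  dC (S.e i a) (fun y => α.comp i y B) x + (spinConn g (S.e i) a x).mulVec (α.comp i x) B

/-- The components of `∇_{e_a} β_{B'}`. -/
def nabla' (β : Spinor' S) (i : S.ι) (a : Fin 4) (B' : Fin 2) (x : M) : ℂ :=
  dC (S.e i a) (fun y => β.comp i y B') x + (spinConn' g (S.e i) a x).mulVec (β.comp i x) B'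

/-- `∇_{AA'} α_B`. -/
def nablaSpinor (α : Spinor S) (i : S.ι) (A A' B : Fin 2) (x : M) : ℂ :=
  ∑ a, solder a A A' * S.nabla α i a B x

/-- `∇_{AA'} β_{B'}`. -/
def nablaSpinor' (β : Spinor' S) (i : S.ι) (A A' B' : Fin 2) (x : M) : ℂ :=
  ∑ a, solder a A A' * S.nabla' β i a B' x

end SpinStructure

/-! ### The gauge potential, the Maxwell field and the Killing spinor equations -/

/-- Smoothness of a real one-form. -/
def IsSmoothOneForm (A : Π x : M, TangentSpace 𝓘(ℝ, E4) x →L[ℝ] ℝ) : Prop :=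
  ContMDiff 𝓘(ℝ, E4) (𝓘(ℝ, E4).prod 𝓘(ℝ, E4 →L[ℝ] ℝ)) ∞
    (fun x => Bundle.TotalSpace.mk' (E4 →L[ℝ] ℝ)
      (E := fun x : M => TangentSpace 𝓘(ℝ, E4) x →L[ℝ] ℝ) x (A x))

namespace SpinStructure

variable (S : SpinStructure g) (A : Π x : M, TangentSpace 𝓘(ℝ, E4) x →L[ℝ] ℝ)

/-- The components `A_a = A(e_a)`. -/
def pot (i : S.ι) (a : Fin 4) (x : M) : ℝ := A x (S.e i a x)

/-- `A_{AA'}`. -/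
def potSpinor (i : S.ι) (B B' : Fin 2) (x : M) : ℂ :=
  ∑ a, solder a B B' * ((S.pot A i a x : ℝ) : ℂ)

/-- The Maxwell field of the potential `A`, `F_{ab} = ∇_a A_b - ∇_b A_a = (dA)(e_a, e_b)`
(as a form `F = F_{ab} eᵃ ∧ eᵇ` this is `F = 2 dA`). It is closed. -/
def field (i : S.ι) (a b : Fin 4) (x : M) : ℝ :=
  dR (S.e i a) (S.pot A i b) x - dR (S.e i b) (S.pot A i a) x
    - ∑ c, structFun g (S.e i) a b c x * S.pot A i c x

/-- `*F = -F`. -/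
def IsFieldASD : Prop :=
  ∀ i, ∀ x ∈ S.U i, ∀ a b,
    hodge (fun c d => S.field A i c d x) a b = - S.field A i a b x

/-- `F = 0` everywhere. -/
def IsFieldZero : Prop := ∀ i, ∀ x ∈ S.U i, ∀ a b, S.field A i a b x = 0

/-- The spinor `φ_{AB}` of the Maxwell field. -/
def fieldSpinor (i : S.ι) (B C : Fin 2) (x : M) : ℂ :=
  twoFormSpinor (fun a b => S.field A i a b x) B C

/-- The Killing spinor equations
`∇_{AA'} α_B + c₀ A_a α_B + (c₁ φ_{AB} + c₂ ε_{AB}) β_{A'} = 0`,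
`∇_{AA'} β_{B'} + c₃ A_a β_{B'} + c₄ ε_{A'B'} α_A = 0`. -/
def KillingSpinorEquations (c₀ c₁ c₂ c₃ c₄ : ℂ) (α : Spinor S) (β : Spinor' S) : Prop :=
  ∀ i, ∀ x ∈ S.U i, ∀ B B' C : Fin 2,
    S.nablaSpinor α i B B' C x + c₀ * S.potSpinor A i B B' x * α.comp i x C
        + (c₁ * S.fieldSpinor A i B C x + c₂ * eps B C) * β.comp i x B' = 0 ∧
    S.nablaSpinor' β i B B' C x + c₃ * S.potSpinor A i B B' x * β.comp i x C
        + c₄ * eps B' C * α.comp i x B = 0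

/-- `(M, g)`, with the orientation of the spin structure, is anti-self-dual: `*W = -W`. As `W` is a
tensor, it is enough to say so in frames that cover `M`. -/
def IsAntiSelfDual : Prop :=
  ∀ i, ∀ x ∈ S.U i, ∀ a b c d,
    hodge (fun p q => weyl g (S.e i) p q c d x) a b = - weyl g (S.e i) a b c d x

/-- `(M, g)` is Einstein: the trace-free part of the Ricci tensor vanishes. -/
def IsEinstein : Prop :=
  ∀ i, ∀ x ∈ S.U i, ∀ a b, ricci g (S.e i) a b x = (scalar g (S.e i) x / 4) * kron a b

end SpinStructure

end Geometry

end KillingSpinor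

end

open scoped Quaternion
open Topology

noncomputable section

namespace KillingSpinor

section

/-! Both spin spaces are identified with the quaternions: a covector acts by left multiplication
through `qu`, complex constants act on the right, α becomes s, and β, contracted with ε, becomes t.
The Killing equations turn into the quaternionic system `IsKillingPair`. Commuting its derivatives
(`curvature_t`, `curvature_s`) expresses the action of the Riemann tensor on t and s through s, t,
A, the imaginary quaternion Φ of the field, and ∇Φ.

The curvature of 𝕊' sees only the self-dual part of the second index pair of Riemann, that of 𝕊 only
the anti-self-dual part. Contracting the first pair with self-dual and anti-self-dual two-forms
therefore isolates the blocks `pp` (self-dual Weyl plus scalar), `pm` (trace-free Ricci) and `mm`. A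
closed anti-self-dual F satisfies the Maxwell equation, which removes ∇Φ from the contractions that
are used. Four algebraic identities at a point remain, `IntegrabilityConditions`, in which the
potential itself enters only through the multiple D of c₀ - c₃.

If c₀ = c₃, then D = 0 and the identities can be read off: where t ≠ 0 the block `pp` is a multiple
S of the identity with c₂c₄ = -S; where s ≠ 0 the block `pm` vanishes; and then F(c₃ + c₁c₄) = 0. A
curvature tensor with such blocks is Einstein with anti-self-dual Weyl tensor and scalar curvature
24S (`IsIsotropic`).

The hard step is that c₀ = c₃ when F is not identically zero. Suppose not, and work where s, t and Φ
do not vanish. Put H = s̄at, with a the quaternion of A, and f = s̄Φs. The same matrix `pm` occurs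
in two of the identities, once transposed; comparing the two occurrences, and using the rest
(`sandwich`, `rigidity`), shows that H is a complex number and that f lies on the i-axis, with
explicit relations among the constants. That H is complex on an open set says that A annihilates two
vector fields built from s and t. Evaluating dA on this pair by differentiating the annihilation,
with the derivatives of s and t supplied by the Killing equations, gives one more relation; it
contradicts the previous ones (`IsKillingPair.c₀_eq_c₃`).

Zeros are handled by unique continuation: a solution of a homogeneous linear first-order system on a
connected manifold vanishes identically once it vanishes at a point. Hence t is nonzero on a dense
set. If s vanishes near a point where t and F do not, then c₁ = c₂ = 0, the equation for s is
homogeneous, and s vanishes identically, which is excluded. The pointwise results thus hold on dense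
sets, and since S = -Re(c₂c₄) does not depend on the point they extend by continuity. -/

theorem _root_.ContinuousLinearMap.inverse_apply_inverse_apply {E₁ E₂ : Type*}
    [NormedAddCommGroup E₁] [NormedSpace ℝ E₁] [NormedAddCommGroup E₂] [NormedSpace ℝ E₂]
    {D : E₁ →L[ℝ] E₂} {S : E₂ →L[ℝ] E₁} (h : D ∘L S = ContinuousLinearMap.id _ _)
    (h' : S ∘L D = ContinuousLinearMap.id _ _) (v : E₂) : S.inverse (D.inverse v) = v := by
  rw [ContinuousLinearMap.inverse_eq h h', ContinuousLinearMap.inverse_eq h' h]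
  exact DFunLike.congr_fun h v

/-! ### Calculus of derivatives along vector fields. -/

section DirectionalDerivative

variable {M : Type*} [TopologicalSpace M] [ChartedSpace E4 M]
variable {F G : Type*} [NormedAddCommGroup F] [NormedSpace ℝ F]
  [NormedAddCommGroup G] [NormedSpace ℝ G]

/-- The derivative of a vector valued function along a vector field. -/
def dir (X : VField M) (f : M → F) (x : M) : F := mfderiv 𝓘(ℝ, E4) 𝓘(ℝ, F) f x (X x)

theorem dir_congr {X : VField M} {f f' : M → F} {x : M} (h : f =ᶠ[𝓝 x] f') :
    dir X f x = dir X f' x := by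
  unfold dir
  rw [h.mfderiv_eq]; rfl

theorem dir_const (X : VField M) (c : F) (x : M) : dir X (fun _ => c) x = 0 := by
  unfold dir
  rw [mfderiv_const]; rfl

theorem dir_comp_clm (X : VField M) (L : F →L[ℝ] G) {f : M → F} {x : M}
    (hf : MDifferentiableAt 𝓘(ℝ, E4) 𝓘(ℝ, F) f x) :
    dir X (fun y => L (f y)) x = L (dir X f x) := by
  have h := (L.hasMFDerivAt (x := f x)).comp x hf.hasMFDerivAt
  have h2 := h.mfderiv
  unfold dir
  change (mfderiv 𝓘(ℝ, E4) 𝓘(ℝ, G) (L ∘ f) x) (X x) = _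
  rw [h2]; rfl

theorem dir_add (X : VField M) {f f' : M → F} {x : M}
    (hf : MDifferentiableAt 𝓘(ℝ, E4) 𝓘(ℝ, F) f x)
    (hf' : MDifferentiableAt 𝓘(ℝ, E4) 𝓘(ℝ, F) f' x) :
    dir X (fun y => f y + f' y) x = dir X f x + dir X f' x := by
  have h2 := (hf.hasMFDerivAt.add hf'.hasMFDerivAt).mfderiv
  unfold dir
  change (mfderiv 𝓘(ℝ, E4) 𝓘(ℝ, F) (f + f') x) (X x) = _
  rw [h2]; rfl

theorem dir_neg (X : VField M) (f : M → F) (x : M) :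
    dir X (fun y => - f y) x = - dir X f x := by
  unfold dir
  change (mfderiv 𝓘(ℝ, E4) 𝓘(ℝ, F) (-f) x) (X x) = _
  rw [mfderiv_neg]; rfl

theorem dir_sub (X : VField M) {f f' : M → F} {x : M}
    (hf : MDifferentiableAt 𝓘(ℝ, E4) 𝓘(ℝ, F) f x)
    (hf' : MDifferentiableAt 𝓘(ℝ, E4) 𝓘(ℝ, F) f' x) :
    dir X (fun y => f y - f' y) x = dir X f x - dir X f' x := by
  have h := dir_add X hf hf'.neg
  simp only [sub_eq_add_neg]
  rw [← dir_neg]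
  exact h

theorem mdifferentiableAt_sum {ι : Type*} (s : Finset ι) {f : ι → M → F} {x : M}
    (hf : ∀ i ∈ s, MDifferentiableAt 𝓘(ℝ, E4) 𝓘(ℝ, F) (f i) x) :
    MDifferentiableAt 𝓘(ℝ, E4) 𝓘(ℝ, F) (fun y => ∑ i ∈ s, f i y) x := by
  classical
  induction s using Finset.induction_on with
  | empty => simpa using mdifferentiableAt_const
  | insert i s hi ih =>
    simp only [Finset.sum_insert hi]
    exact (hf i (by simp)).add (ih fun j hj => hf j (by simp [hj]))

theorem dir_sum (X : VField M) {ι : Type*} (s : Finset ι) {f : ι → M → F} {x : M}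
    (hf : ∀ i ∈ s, MDifferentiableAt 𝓘(ℝ, E4) 𝓘(ℝ, F) (f i) x) :
    dir X (fun y => ∑ i ∈ s, f i y) x = ∑ i ∈ s, dir X (f i) x := by
  classical
  induction s using Finset.induction_on with
  | empty => simpa using dir_const X (0 : F) x
  | insert i s hi ih =>
    simp only [Finset.sum_insert hi]
    rw [dir_add X (hf i (by simp)) (mdifferentiableAt_sum s fun j hj => hf j (by simp [hj])),
      ih fun j hj => hf j (by simp [hj])]

theorem dir_mul {𝔸 : Type*} [NormedRing 𝔸] [NormedAlgebra ℝ 𝔸] (X : VField M) {f f' : M → 𝔸}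
    {x : M} (hf : MDifferentiableAt 𝓘(ℝ, E4) 𝓘(ℝ, 𝔸) f x)
    (hf' : MDifferentiableAt 𝓘(ℝ, E4) 𝓘(ℝ, 𝔸) f' x) :
    dir X (fun y => f y * f' y) x = dir X f x * f' x + f x * dir X f' x := by
  have h2 := (hf.hasMFDerivAt.mul' hf'.hasMFDerivAt).mfderiv
  unfold dir
  change (mfderiv 𝓘(ℝ, E4) 𝓘(ℝ, 𝔸) (f * f') x) (X x) = _
  rw [h2]
  change f x * _ + _ * f' x = _
  rw [add_comm]; rfl

theorem dir_smul (X : VField M) {f : M → ℝ} {f' : M → F}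
    {x : M} (hf : MDifferentiableAt 𝓘(ℝ, E4) 𝓘(ℝ, ℝ) f x)
    (hf' : MDifferentiableAt 𝓘(ℝ, E4) 𝓘(ℝ, F) f' x) :
    dir X (fun y => f y • f' y) x = dir X f x • f' x + f x • dir X f' x := by
  have h := mvfderiv_smul hf hf'
  have h' := congrArg (fun L => L (X x)) h
  have : dir X (fun y => f y • f' y) x = f x • dir X f' x + dir X f x • f' x := h'
  rw [this, add_comm]

theorem mdifferentiableAt_of_contMDiffOn {f : M → F} (hU : IsOpen U)
    (hf : ContMDiffOn 𝓘(ℝ, E4) 𝓘(ℝ, F) ∞ f U) {x : M} (hx : x ∈ U) :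
    MDifferentiableAt 𝓘(ℝ, E4) 𝓘(ℝ, F) f x :=
  ((hf x hx).contMDiffAt (hU.mem_nhds hx)).mdifferentiableAt (by simp)

theorem dir_sum_smul (e : Fin 4 → VField M) (X : VField M) (f : M → F) {x : M} (c : Fin 4 → ℝ)
    (hX : X x = ∑ a, c a • e a x) : dir X f x = ∑ a, c a • dir (e a) f x := by
  have h1 : dir X f x = (mfderiv 𝓘(ℝ, E4) 𝓘(ℝ, F) f x) (∑ a, c a • e a x) := by
    rw [← hX]; rfl
  rw [h1, map_sum]
  exact Finset.sum_congr rfl fun a _ => map_smul _ _ _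

theorem dR_neg (X : VField M) (f : M → ℝ) (x : M) : dR X (fun y => - f y) x = - dR X f x :=
  dir_neg X f x

variable [IsManifold 𝓘(ℝ, E4) ∞ M]

theorem contMDiffOn_dir {X : VField M} {U : Set M} (hU : IsOpen U)
    (hX : ContMDiffOn 𝓘(ℝ, E4) 𝓘(ℝ, E4).tangent ∞
      (fun x => (⟨x, X x⟩ : TangentBundle 𝓘(ℝ, E4) M)) U)
    {f : M → F} (hf : ContMDiffOn 𝓘(ℝ, E4) 𝓘(ℝ, F) ∞ f U) :
    ContMDiffOn 𝓘(ℝ, E4) 𝓘(ℝ, F) ∞ (dir X f) U := by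
  have h1 := hf.contMDiffOn_tangentMapWithin (m := ∞) le_rfl hU.uniqueMDiffOn
  have h2 := h1.comp hX (fun x hx => by simpa using hx)
  have h3 : ContMDiff 𝓘(ℝ, F).tangent 𝓘(ℝ, F) ∞
      (fun p : TangentBundle 𝓘(ℝ, F) F => p.2) :=
    contMDiff_snd_tangentBundle_modelSpace F 𝓘(ℝ, F)
  refine (h3.comp_contMDiffOn h2).congr fun x hx => ?_
  simp only [Function.comp, tangentMapWithin, dir]
  rw [mfderivWithin_of_isOpen hU hx]

/-- The derivative along a vector field, read in a chart. -/
theorem dir_symm_extChartAt (X : VField M) {f : M → F} (x : M) {z : E4}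
    (hz : z ∈ (extChartAt 𝓘(ℝ, E4) x).target)
    (hf : MDifferentiableAt 𝓘(ℝ, E4) 𝓘(ℝ, F) f ((extChartAt 𝓘(ℝ, E4) x).symm z)) :
    dir X f ((extChartAt 𝓘(ℝ, E4) x).symm z) =
      fderiv ℝ (f ∘ (extChartAt 𝓘(ℝ, E4) x).symm) z
        (VectorField.mpullbackWithin 𝓘(ℝ, E4) 𝓘(ℝ, E4) (extChartAt 𝓘(ℝ, E4) x).symm X
          (Set.range 𝓘(ℝ, E4)) z) := by
  have : IsManifold 𝓘(ℝ, E4) 1 M := IsManifold.of_le (n := ∞) (by simp)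
  have hinv := isInvertible_mfderivWithin_extChartAt_symm (I := 𝓘(ℝ, E4)) hz
  have hd := mdifferentiableWithinAt_extChartAt_symm (I := 𝓘(ℝ, E4)) hz
  rw [VectorField.mpullbackWithin_apply]
  have hr : Set.range 𝓘(ℝ, E4) = Set.univ := 𝓘(ℝ, E4).range_eq_univ
  rw [hr] at hinv hd ⊢
  rw [mdifferentiableWithinAt_univ] at hd
  rw [mfderivWithin_univ] at hinv ⊢
  have h1 := hf.hasMFDerivAt.comp z hd.hasMFDerivAt
  have h2 := h1.mfderiv
  rw [mfderiv_eq_fderiv] at h2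
  rw [h2]
  change _ = (mfderiv 𝓘(ℝ, E4) 𝓘(ℝ, F) f ((extChartAt 𝓘(ℝ, E4) x).symm z))
    ((mfderiv 𝓘(ℝ, E4) 𝓘(ℝ, E4) (extChartAt 𝓘(ℝ, E4) x).symm z) _)
  rw [hinv.self_apply_inverse]
  rfl

/-- In a chart this is the symmetry of the second derivative, in the form
`VectorField.fderiv_apply_lieBracket`. The remaining work is to transport both sides to the chart,
for vector-valued f, so that it can later be applied to the chart itself. -/
theorem dir_mlieBracket {X Y : VField M} {U : Set M} (hU : IsOpen U)
    (hX : ContMDiffOn 𝓘(ℝ, E4) 𝓘(ℝ, E4).tangent ∞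
      (fun x => (⟨x, X x⟩ : TangentBundle 𝓘(ℝ, E4) M)) U)
    (hY : ContMDiffOn 𝓘(ℝ, E4) 𝓘(ℝ, E4).tangent ∞
      (fun x => (⟨x, Y x⟩ : TangentBundle 𝓘(ℝ, E4) M)) U)
    {f : M → F} (hf : ContMDiffOn 𝓘(ℝ, E4) 𝓘(ℝ, F) ∞ f U) {x : M} (hx : x ∈ U) :
    dir X (dir Y f) x - dir Y (dir X f) x =
      dir (VectorField.mlieBracket 𝓘(ℝ, E4) X Y) f x := by
  have : IsManifold 𝓘(ℝ, E4) 2 M := IsManifold.of_le (n := ∞) (by norm_cast)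
  have : IsManifold 𝓘(ℝ, E4) 1 M := IsManifold.of_le (n := ∞) (by simp)
  set φ := extChartAt 𝓘(ℝ, E4) x with hφ
  have hUx : U ∈ 𝓝 x := hU.mem_nhds hx
  have hφx : φ x ∈ φ.target := mem_extChartAt_target x
  have hsx : φ.symm (φ x) = x := extChartAt_to_inv x
  set V := VectorField.mpullbackWithin 𝓘(ℝ, E4) 𝓘(ℝ, E4) φ.symm X (Set.range 𝓘(ℝ, E4)) with hV
  set W := VectorField.mpullbackWithin 𝓘(ℝ, E4) 𝓘(ℝ, E4) φ.symm Y (Set.range 𝓘(ℝ, E4)) with hW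
  have hr : Set.range 𝓘(ℝ, E4) = Set.univ := 𝓘(ℝ, E4).range_eq_univ
  have hfd : ∀ {f : M → F}, ContMDiffOn 𝓘(ℝ, E4) 𝓘(ℝ, F) ∞ f U → ∀ y ∈ U,
      MDifferentiableAt 𝓘(ℝ, E4) 𝓘(ℝ, F) f y := fun h y hy =>
    ((h y hy).contMDiffAt (hU.mem_nhds hy)).mdifferentiableAt (by simp)
  have hev : ∀ᶠ z in 𝓝 (φ x), z ∈ φ.target ∧ φ.symm z ∈ U := by
    have h1 : φ.target ∈ 𝓝 (φ x) := by
      rw [hφ]; exact extChartAt_target_mem_nhds x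
    have h2 : φ.symm ⁻¹' U ∈ 𝓝 (φ x) := by
      have := (continuousAt_extChartAt_symm (I := 𝓘(ℝ, E4)) x)
      apply this.preimage_mem_nhds
      rw [← hφ, hsx]; exact hUx
    filter_upwards [h1, h2] with z hz1 hz2 using ⟨hz1, hz2⟩
  have key : ∀ Z : VField M, ∀ h : M → F, ContMDiffOn 𝓘(ℝ, E4) 𝓘(ℝ, F) ∞ h U →
      (dir Z h ∘ φ.symm) =ᶠ[𝓝 (φ x)] fun z => fderiv ℝ (h ∘ φ.symm) z
        (VectorField.mpullbackWithin 𝓘(ℝ, E4) 𝓘(ℝ, E4) φ.symm Z (Set.range 𝓘(ℝ, E4)) z) := by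
    intro Z h hh
    filter_upwards [hev] with z hz
    exact dir_symm_extChartAt Z x hz.1 (hfd hh _ hz.2)
  have key2 : ∀ Z : VField M, ∀ h : M → F, ContMDiffOn 𝓘(ℝ, E4) 𝓘(ℝ, F) ∞ h U →
      dir Z h x = fderiv ℝ (h ∘ φ.symm) (φ x)
        (VectorField.mpullbackWithin 𝓘(ℝ, E4) 𝓘(ℝ, E4) φ.symm Z (Set.range 𝓘(ℝ, E4)) (φ x)) := by
    intro Z h hh
    have := (key Z h hh).self_of_nhds
    simpa [hsx] using this
  rw [key2 X _ (contMDiffOn_dir hU hY hf), key2 Y _ (contMDiffOn_dir hU hX hf), key2 _ _ hf,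
    (key X f hf).fderiv_eq, (key Y f hf).fderiv_eq]
  have hF : ContDiffAt ℝ 2 (f ∘ φ.symm) (φ x) := by
    have h1 : ContMDiffAt 𝓘(ℝ, E4) 𝓘(ℝ, F) ∞ f (φ.symm (φ x)) := by
      rw [hsx]; exact (hf x hx).contMDiffAt hUx
    have h2 : ContMDiffAt 𝓘(ℝ, E4) 𝓘(ℝ, E4) ∞ φ.symm (φ x) :=
      ((contMDiffOn_extChartAt_symm x).contMDiffAt (by
        rw [hφ]; exact extChartAt_target_mem_nhds x))
    have h3 := h1.comp (φ x) h2
    exact h3.contDiffAt.of_le (by norm_cast)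
  have hdiff : ∀ Z : VField M, ContMDiffOn 𝓘(ℝ, E4) 𝓘(ℝ, E4).tangent ∞
      (fun x => (⟨x, Z x⟩ : TangentBundle 𝓘(ℝ, E4) M)) U → DifferentiableAt ℝ
        (VectorField.mpullbackWithin 𝓘(ℝ, E4) 𝓘(ℝ, E4) φ.symm Z (Set.range 𝓘(ℝ, E4))) (φ x) := by
    intro Z hZ
    have h1 : MDifferentiableWithinAt 𝓘(ℝ, E4) 𝓘(ℝ, E4).tangent
        (fun x => (Z x : TangentBundle 𝓘(ℝ, E4) M)) Set.univ x :=
      (((hZ x hx).contMDiffAt hUx).mdifferentiableAt (by simp)).mdifferentiableWithinAt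
    have h2 := h1.differentiableWithinAt_mpullbackWithin_vectorField
    have hs : (extChartAt 𝓘(ℝ, E4) x).symm ⁻¹' Set.univ ∩ Set.range 𝓘(ℝ, E4) ∈
        𝓝 (extChartAt 𝓘(ℝ, E4) x x) := by
      rw [hr, Set.preimage_univ, Set.univ_inter]; exact Filter.univ_mem
    exact h2.differentiableAt hs
  rw [← hV, ← hW]
  have h5 := VectorField.fderiv_apply_lieBracket hF (by simp) (hdiff Y hY) (hdiff X hX)
  rw [← hV, ← hW] at h5
  rw [← h5]
  congr 1
  have h6 : VectorField.lieBracketWithin ℝ V W (φ.symm ⁻¹' Set.univ ∩ Set.range 𝓘(ℝ, E4)) (φ x)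
      = VectorField.lieBracket ℝ V W (φ x) := by
    have hs : φ.symm ⁻¹' Set.univ ∩ Set.range 𝓘(ℝ, E4) = Set.univ := by
      rw [hr, Set.preimage_univ, Set.univ_inter]
    rw [hs]
    exact congrFun VectorField.lieBracketWithin_univ (φ x)
  -- The manifold bracket is by definition the chart bracket pulled back along φ; the outer pullback
  -- along `φ.symm` undoes this, because the two derivatives are mutually inverse.
  have h7 := ContinuousLinearMap.inverse_apply_inverse_apply (E₁ := E4) (E₂ := E4)
    (D := mfderiv 𝓘(ℝ, E4) 𝓘(ℝ, E4) φ x)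
    (S := mfderivWithin 𝓘(ℝ, E4) 𝓘(ℝ, E4) φ.symm (Set.range 𝓘(ℝ, E4)) (φ x))
    (mfderiv_extChartAt_comp_mfderivWithin_extChartAt_symm' (I := 𝓘(ℝ, E4))
      (mem_extChartAt_source x))
    (mfderivWithin_extChartAt_symm_comp_mfderiv_extChartAt' (I := 𝓘(ℝ, E4))
      (mem_extChartAt_source x)) (VectorField.lieBracket ℝ V W (φ x))
  rw [VectorField.mpullbackWithin_apply, ← VectorField.mlieBracketWithin_univ]
  rw [← h6] at h7 ⊢
  refine h7.symm.trans ?_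
  -- The base points `φ.symm (φ x)` and `x` agree only propositionally, so the brackets are compared
  -- as elements of `E4`, outside the dependent tangent spaces.
  have h8 : ∀ y, y = x → (VectorField.mlieBracketWithin 𝓘(ℝ, E4) X Y Set.univ x : E4) =
      (VectorField.mlieBracketWithin 𝓘(ℝ, E4) X Y Set.univ y : E4) := by
    rintro _ rfl; rfl
  let T : E4 →L[ℝ] E4 := mfderivWithin 𝓘(ℝ, E4) 𝓘(ℝ, E4) φ.symm (Set.range 𝓘(ℝ, E4)) (φ x)
  exact congrArg T.inverse (h8 _ hsx)

end DirectionalDerivative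

end

/-! ### Orthonormal frames: structure functions, Jacobi, Bianchi, and d² = 0. -/

section

section Frame

variable {M : Type*} [TopologicalSpace M] [ChartedSpace E4 M] [IsManifold 𝓘(ℝ, E4) ∞ M]
variable {g : Metric4 M} {U : Set M} {e : Fin 4 → VField M}
variable {F : Type*} [NormedAddCommGroup F] [NormedSpace ℝ F]

theorem structFun_swap (g : Metric4 M) (e : Fin 4 → VField M) (a b c : Fin 4) (x : M) :
    structFun g e a b c x = - structFun g e b a c x := by
  unfold structFun
  rw [VectorField.mlieBracket_swap_apply, map_neg]; rfl

theorem leviCivita_swap (g : Metric4 M) (e : Fin 4 → VField M) (a b c : Fin 4) (x : M) :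
    leviCivita g e a b c x = - leviCivita g e a c b x := by
  unfold leviCivita
  rw [structFun_swap g e a c b, structFun_swap g e c b a, structFun_swap g e b a c]
  ring

/-- This is the vanishing of the torsion; together with `leviCivita_swap` (metric compatibility) it
is all that is used of the Koszul formula. -/
theorem structFun_eq (g : Metric4 M) (e : Fin 4 → VField M) (a b c : Fin 4) (x : M) :
    structFun g e a b c x = leviCivita g e a b c x - leviCivita g e b a c x := by
  unfold leviCivita
  rw [structFun_swap g e a c b, structFun_swap g e c b a, structFun_swap g e b a c]
  ring

theorem IsOrthonormalFrame.mono (he : IsOrthonormalFrame g U e) {V : Set M} (h : V ⊆ U) :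
    IsOrthonormalFrame g V e :=
  ⟨fun a => (he.1 a).mono h, fun x hx => he.2 x (h hx)⟩

theorem IsOrthonormalFrame.linearIndependent (he : IsOrthonormalFrame g U e) {x : M} (hx : x ∈ U)
    {c : Fin 4 → ℝ} (h : ∑ a, c a • e a x = 0) (a : Fin 4) : c a = 0 := by
  have h1 := congrArg (fun v => g.inner x v (e a x)) h
  simp only [map_sum, map_smul, map_zero, sum_apply,
    smul_apply, zero_apply, he.2 x hx] at h1
  simpa [kron] using h1

theorem IsOrthonormalFrame.expand (he : IsOrthonormalFrame g U e) {x : M} (hx : x ∈ U)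
    (v : TangentSpace 𝓘(ℝ, E4) x) : v = ∑ a, g.inner x v (e a x) • e a x := by
  let u : Fin 4 → E4 := fun a => e a x
  have hli : LinearIndependent ℝ u := by
    rw [Fintype.linearIndependent_iff]
    intro c hc a
    exact he.linearIndependent hx hc a
  have hcard : Fintype.card (Fin 4) = Module.finrank ℝ E4 := by simp
  have hspan := hli.span_eq_top_of_card_eq_finrank' hcard
  let w : E4 := v
  have hv : w ∈ Submodule.span ℝ (Set.range u) := by
    rw [hspan]; trivial
  obtain ⟨c, hc⟩ := (Submodule.mem_span_range_iff_exists_fun ℝ).1 hv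
  have hc' : v = ∑ a, c a • e a x := hc.symm
  have h2 : ∀ b, g.inner x v (e b x) = c b := by
    intro b
    have h1 := congrArg (fun v => g.inner x v (e b x)) hc'
    simp only [map_sum, map_smul, sum_apply,
      smul_apply, he.2 x hx] at h1
    simpa [kron] using h1
  simp only [h2]
  exact hc'

theorem IsOrthonormalFrame.dir_comm (he : IsOrthonormalFrame g U e) (hU : IsOpen U) {f : M → F}
    (hf : ContMDiffOn 𝓘(ℝ, E4) 𝓘(ℝ, F) ∞ f U) {x : M} (hx : x ∈ U) (a b : Fin 4) :
    dir (e a) (dir (e b) f) x - dir (e b) (dir (e a) f) x =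
      ∑ c, structFun g e a b c x • dir (e c) f x := by
  rw [dir_mlieBracket hU (he.1 a) (he.1 b) hf hx]
  exact dir_sum_smul e _ f _ (he.expand hx _)

theorem IsOrthonormalFrame.contMDiffOn_structFun (he : IsOrthonormalFrame g U e) (hU : IsOpen U)
    (a b c : Fin 4) : ContMDiffOn 𝓘(ℝ, E4) 𝓘(ℝ, ℝ) ∞ (structFun g e a b c) U := by
  intro x hx
  have : IsManifold 𝓘(ℝ, E4) (∞ + 1) M := by simpa using (inferInstance : IsManifold 𝓘(ℝ, E4) ∞ M)
  have hat : ∀ a, ContMDiffAt 𝓘(ℝ, E4) 𝓘(ℝ, E4).tangent ∞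
      (fun x => (⟨x, e a x⟩ : TangentBundle 𝓘(ℝ, E4) M)) x := fun a =>
    (he.1 a x hx).contMDiffAt (hU.mem_nhds hx)
  have : IsManifold 𝓘(ℝ, E4) (minSmoothness ℝ 2) M := by
    rw [minSmoothness_of_isRCLikeNormedField]
    exact IsManifold.of_le (n := ∞) (by norm_cast)
  have : IsManifold 𝓘(ℝ, E4) (minSmoothness ℝ 3) M := by
    rw [minSmoothness_of_isRCLikeNormedField]
    exact IsManifold.of_le (n := ∞) (by norm_cast)
  have h1 := ContMDiffAt.mlieBracket_vectorField (m := ⊤) (n := ⊤) (hat a) (hat b) (by simp)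
  have h2 := (g.contMDiff x).clm_bundle_apply₂ (F₁ := E4) (F₂ := E4) (F₃ := ℝ)
    (E₃ := Bundle.Trivial M ℝ) h1 (hat c)
  have h3 := (Bundle.contMDiffAt_section x).1 h2
  exact h3.contMDiffWithinAt

theorem IsOrthonormalFrame.contMDiffOn_leviCivita (he : IsOrthonormalFrame g U e) (hU : IsOpen U)
    (a b c : Fin 4) : ContMDiffOn 𝓘(ℝ, E4) 𝓘(ℝ, ℝ) ∞ (leviCivita g e a b c) U :=
  contMDiffOn_const.mul (((he.contMDiffOn_structFun hU a b c).sub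
    (he.contMDiffOn_structFun hU b c a)).add (he.contMDiffOn_structFun hU c a b))

theorem IsOrthonormalFrame.contMDiffOn_dR (he : IsOrthonormalFrame g U e) (hU : IsOpen U)
    {f : M → ℝ} (hf : ContMDiffOn 𝓘(ℝ, E4) 𝓘(ℝ, ℝ) ∞ f U) (a : Fin 4) :
    ContMDiffOn 𝓘(ℝ, E4) 𝓘(ℝ, ℝ) ∞ (dR (e a) f) U :=
  contMDiffOn_dir hU (he.1 a) hf

theorem IsOrthonormalFrame.contMDiffOn_pot (he : IsOrthonormalFrame g U e) (hU : IsOpen U)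
    {A : Π x : M, TangentSpace 𝓘(ℝ, E4) x →L[ℝ] ℝ} (hA : IsSmoothOneForm A) (a : Fin 4) :
    ContMDiffOn 𝓘(ℝ, E4) 𝓘(ℝ, ℝ) ∞ (fun x => A x (e a x)) U := by
  intro x hx
  have hat : ContMDiffAt 𝓘(ℝ, E4) 𝓘(ℝ, E4).tangent ∞
      (fun x => (⟨x, e a x⟩ : TangentBundle 𝓘(ℝ, E4) M)) x :=
    (he.1 a x hx).contMDiffAt (hU.mem_nhds hx)
  have h2 := ContMDiffAt.clm_bundle_apply (F₁ := E4) (F₂ := ℝ)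
    (E₁ := fun x : M => TangentSpace 𝓘(ℝ, E4) x)
    (E₂ := Bundle.Trivial M ℝ) (b := fun x => x) (hA x) hat
  have h3 := (Bundle.contMDiffAt_section x).1 h2
  exact h3.contMDiffWithinAt

/-- The Jacobi identity for the frame. -/
theorem IsOrthonormalFrame.jacobi (he : IsOrthonormalFrame g U e) (hU : IsOpen U) {x : M}
    (hx : x ∈ U) (a b c d : Fin 4) :
    dR (e a) (structFun g e b c d) x + dR (e b) (structFun g e c a d) x
      + dR (e c) (structFun g e a b d) x
      + ∑ f, (structFun g e b c f x * structFun g e a f d x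
        + structFun g e c a f x * structFun g e b f d x
        + structFun g e a b f x * structFun g e c f d x) = 0 := by
  -- The chart is used as an `E4`-valued test function: it carries four coordinates at once, and its
  -- derivative is injective.
  set φ := extChartAt 𝓘(ℝ, E4) x with hφ
  have hxs : x ∈ φ.source := mem_extChartAt_source x
  have hV : IsOpen (U ∩ φ.source) := hU.inter (isOpen_extChartAt_source x)
  have hxV : x ∈ U ∩ φ.source := ⟨hx, hxs⟩
  have he' : IsOrthonormalFrame g (U ∩ φ.source) e := he.mono Set.inter_subset_left
  have hf : ContMDiffOn 𝓘(ℝ, E4) 𝓘(ℝ, E4) ∞ φ (U ∩ φ.source) := by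
    refine (contMDiffOn_extChartAt (x := x)).mono ?_
    rw [hφ, extChartAt_source]
    exact Set.inter_subset_right
  have hDf : ∀ a, ContMDiffOn 𝓘(ℝ, E4) 𝓘(ℝ, E4) ∞ (dir (e a) φ) (U ∩ φ.source) :=
    fun a => contMDiffOn_dir hV (he'.1 a) hf
  have hDDf : ∀ a b, ContMDiffOn 𝓘(ℝ, E4) 𝓘(ℝ, E4) ∞ (dir (e a) (dir (e b) φ)) (U ∩ φ.source) :=
    fun a b => contMDiffOn_dir hV (he'.1 a) (hDf b)
  have hmd : ∀ {G : Type} [NormedAddCommGroup G] [NormedSpace ℝ G] {f : M → G},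
      ContMDiffOn 𝓘(ℝ, E4) 𝓘(ℝ, G) ∞ f (U ∩ φ.source) → MDifferentiableAt 𝓘(ℝ, E4) 𝓘(ℝ, G) f x :=
    fun h => mdifferentiableAt_of_contMDiffOn hV h hxV
  -- The left side is the iterated commutator [e_a, [e_b, e_c]] acting on φ, and the right side its
  -- expansion in the frame. In the cyclic sum the third derivatives on the left cancel.
  have h3 : ∀ a b c, dir (e a) (dir (e b) (dir (e c) φ)) x - dir (e a) (dir (e c) (dir (e b) φ)) x
      - (dir (e b) (dir (e c) (dir (e a) φ)) x - dir (e c) (dir (e b) (dir (e a) φ)) x) =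
      ∑ d, (dR (e a) (structFun g e b c d) x
        + ∑ f, structFun g e b c f x * structFun g e a f d x) • dir (e d) φ x := by
    intro a b c
    rw [he'.dir_comm hV (hDf a) hxV b c,
      ← dir_sub _ (hmd (hDDf b c)) (hmd (hDDf c b))]
    have hev : (fun y => dir (e b) (dir (e c) φ) y - dir (e c) (dir (e b) φ) y) =ᶠ[𝓝 x]
        fun y => ∑ d, structFun g e b c d y • dir (e d) φ y := by
      filter_upwards [hV.mem_nhds hxV] with y hy
      exact he'.dir_comm hV hf hy b c
    have hC : ∀ d, MDifferentiableAt 𝓘(ℝ, E4) 𝓘(ℝ, ℝ) (structFun g e b c d) x := fun d =>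
      hmd (he'.contMDiffOn_structFun hV b c d)
    rw [dir_congr hev, dir_sum (f := fun d y => structFun g e b c d y • dir (e d) φ y) _ _ fun d _ => (hC d).smul (hmd (hDf d)), ← Finset.sum_sub_distrib]
    have h4 : ∀ d, dir (e a) (fun y => structFun g e b c d y • dir (e d) φ y) x
        - structFun g e b c d x • dir (e d) (dir (e a) φ) x
        = dR (e a) (structFun g e b c d) x • dir (e d) φ x
        + ∑ f, (structFun g e b c d x * structFun g e a d f x) • dir (e f) φ x := by
      intro d
      rw [dir_smul _ (hC d) (hmd (hDf d)), add_sub_assoc, ← smul_sub, he'.dir_comm hV hf hxV a d,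
        Finset.smul_sum]
      simp only [smul_smul]
      rfl
    rw [Finset.sum_congr rfl fun d _ => h4 d, Finset.sum_add_distrib, Finset.sum_comm (γ := Fin 4)]
    simp only [add_smul, Finset.sum_smul, Finset.sum_add_distrib]
  have h5 : ∑ d, (dR (e a) (structFun g e b c d) x + dR (e b) (structFun g e c a d) x
      + dR (e c) (structFun g e a b d) x
      + ∑ f, (structFun g e b c f x * structFun g e a f d x
        + structFun g e c a f x * structFun g e b f d x
        + structFun g e a b f x * structFun g e c f d x)) • dir (e d) φ x = 0 := by
    have := congrArg₂ (· + ·) (congrArg₂ (· + ·) (h3 a b c) (h3 b c a)) (h3 c a b)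
    simp only [← Finset.sum_add_distrib, ← add_smul] at this
    refine Eq.trans (Finset.sum_congr rfl fun d _ => ?_) (this.symm.trans ?_)
    · simp only [Finset.sum_add_distrib]
      congr 1
      ring
    · abel
  have h6 : mfderiv 𝓘(ℝ, E4) 𝓘(ℝ, E4) φ x (∑ d, (dR (e a) (structFun g e b c d) x
      + dR (e b) (structFun g e c a d) x + dR (e c) (structFun g e a b d) x
      + ∑ f, (structFun g e b c f x * structFun g e a f d x
        + structFun g e c a f x * structFun g e b f d x
        + structFun g e a b f x * structFun g e c f d x)) • e d x) = 0 := by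
    rw [map_sum]
    refine Eq.trans (Finset.sum_congr rfl fun d _ => ?_) h5
    exact map_smul _ _ _
  have : IsManifold 𝓘(ℝ, E4) 1 M := IsManifold.of_le (n := ∞) (by simp)
  have hinv := isInvertible_mfderiv_extChartAt (I := 𝓘(ℝ, E4)) hxs
  have h7 := hinv.injective (h6.trans (map_zero _).symm)
  exact he.linearIndependent hx h7 d


theorem dR_leviCivita_swap (g : Metric4 M) (e : Fin 4 → VField M) (X : VField M) (a b c : Fin 4)
    (x : M) : dR X (leviCivita g e a b c) x = - dR X (leviCivita g e a c b) x := by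
  rw [← dR_neg]
  congr 1
  funext y
  exact leviCivita_swap g e a b c y

theorem riemann_swap_left (g : Metric4 M) (e : Fin 4 → VField M) (a b c d : Fin 4) (x : M) :
    riemann g e a b c d x = - riemann g e b a c d x := by
  unfold riemann
  simp only [Fin.sum_univ_four, structFun_swap g e b a]
  ring

theorem riemann_swap_right (g : Metric4 M) (e : Fin 4 → VField M) (a b c d : Fin 4) (x : M) :
    riemann g e a b c d x = - riemann g e a b d c x := by
  unfold riemann
  rw [dR_leviCivita_swap g e _ a d c, dR_leviCivita_swap g e _ b d c]
  have h : ∀ a b f, leviCivita g e a c f x * leviCivita g e b f d x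
      = leviCivita g e b d f x * leviCivita g e a f c x := by
    intro a b f
    rw [leviCivita_swap g e a c f, leviCivita_swap g e b f d]
    ring
  have h' : ∀ f, leviCivita g e f c d x = - leviCivita g e f d c x := fun f =>
    leviCivita_swap g e f c d x
  simp only [h, h']
  have : ∀ f, leviCivita g e a d f x * leviCivita g e b f c x -
      leviCivita g e b d f x * leviCivita g e a f c x
      - structFun g e a b f x * - leviCivita g e f d c x =
      - (leviCivita g e b d f x * leviCivita g e a f c x
        - leviCivita g e a d f x * leviCivita g e b f c x
        - structFun g e a b f x * leviCivita g e f d c x) := fun f => by ring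
  simp only [this, Finset.sum_neg_distrib]
  ring

theorem IsOrthonormalFrame.mdifferentiableAt_leviCivita (he : IsOrthonormalFrame g U e)
    (hU : IsOpen U) {x : M} (hx : x ∈ U) (a b c : Fin 4) :
    MDifferentiableAt 𝓘(ℝ, E4) 𝓘(ℝ, ℝ) (leviCivita g e a b c) x :=
  mdifferentiableAt_of_contMDiffOn hU (he.contMDiffOn_leviCivita hU a b c) hx

theorem IsOrthonormalFrame.dR_structFun (he : IsOrthonormalFrame g U e)
    (hU : IsOpen U) {x : M} (hx : x ∈ U) (X : VField M) (a b c : Fin 4) :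
    dR X (structFun g e a b c) x = dR X (leviCivita g e a b c) x - dR X (leviCivita g e b a c) x := by
  have h : structFun g e a b c = fun y => leviCivita g e a b c y - leviCivita g e b a c y :=
    funext fun y => structFun_eq g e a b c y
  rw [h]
  exact dir_sub X (he.mdifferentiableAt_leviCivita hU hx a b c)
    (he.mdifferentiableAt_leviCivita hU hx b a c)

/-- For a torsion-free connection the first Bianchi identity is the Jacobi identity, with the
structure functions written through the connection coefficients. -/
theorem IsOrthonormalFrame.riemann_bianchi (he : IsOrthonormalFrame g U e) (hU : IsOpen U) {x : M}
    (hx : x ∈ U) (a b c d : Fin 4) :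
    riemann g e a b c d x + riemann g e b c a d x + riemann g e c a b d x = 0 := by
  have h := he.jacobi hU hx a b c d
  simp only [he.dR_structFun hU hx, structFun_eq] at h
  unfold riemann
  simp only [structFun_eq]
  rw [← h]
  simp only [Fin.sum_univ_four]
  ring

/-- The exterior derivative of a one-form in a frame. -/
def extDer (g : Metric4 M) (e : Fin 4 → VField M) (A : Fin 4 → M → ℝ) (a b : Fin 4) (x : M) : ℝ :=
  dR (e a) (A b) x - dR (e b) (A a) x - ∑ c, structFun g e a b c x * A c x

theorem extDer_swap (g : Metric4 M) (e : Fin 4 → VField M) (A : Fin 4 → M → ℝ) (a b : Fin 4)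
    (x : M) : extDer g e A a b x = - extDer g e A b a x := by
  unfold extDer
  simp only [Fin.sum_univ_four, structFun_swap g e b a]
  ring

theorem IsOrthonormalFrame.contMDiffOn_extDer (he : IsOrthonormalFrame g U e) (hU : IsOpen U)
    {A : Fin 4 → M → ℝ} (hA : ∀ a, ContMDiffOn 𝓘(ℝ, E4) 𝓘(ℝ, ℝ) ∞ (A a) U) (a b : Fin 4) :
    ContMDiffOn 𝓘(ℝ, E4) 𝓘(ℝ, ℝ) ∞ (extDer g e A a b) U := by
  unfold extDer
  refine ((he.contMDiffOn_dR hU (hA b) a).sub (he.contMDiffOn_dR hU (hA a) b)).sub ?_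
  exact contMDiffOn_finsetSum fun c _ => (he.contMDiffOn_structFun hU a b c).mul (hA c)

theorem IsOrthonormalFrame.extDer_closed (he : IsOrthonormalFrame g U e) (hU : IsOpen U)
    {A : Fin 4 → M → ℝ} (hA : ∀ a, ContMDiffOn 𝓘(ℝ, E4) 𝓘(ℝ, ℝ) ∞ (A a) U) {x : M}
    (hx : x ∈ U) (a b c : Fin 4) :
    dR (e a) (extDer g e A b c) x + dR (e b) (extDer g e A c a) x + dR (e c) (extDer g e A a b) x
      = ∑ d, (structFun g e a b d x * extDer g e A d c x + structFun g e b c d x * extDer g e A d a x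
        + structFun g e c a d x * extDer g e A d b x) := by
  have hmd : ∀ {f : M → ℝ}, ContMDiffOn 𝓘(ℝ, E4) 𝓘(ℝ, ℝ) ∞ f U →
      MDifferentiableAt 𝓘(ℝ, E4) 𝓘(ℝ, ℝ) f x :=
    fun h => mdifferentiableAt_of_contMDiffOn hU h hx
  have h1 : ∀ a b c, dR (e a) (extDer g e A b c) x = dR (e a) (dR (e b) (A c)) x
      - dR (e a) (dR (e c) (A b)) x - ∑ d, (dR (e a) (structFun g e b c d) x * A d x
        + structFun g e b c d x * dR (e a) (A d) x) := by
    intro a b c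
    have hC : ∀ d, MDifferentiableAt 𝓘(ℝ, E4) 𝓘(ℝ, ℝ) (structFun g e b c d) x := fun d =>
      hmd (he.contMDiffOn_structFun hU b c d)
    have hm : ∀ d ∈ Finset.univ, MDifferentiableAt 𝓘(ℝ, E4) 𝓘(ℝ, ℝ)
        (fun y => structFun g e b c d y * A d y) x := fun d _ => (hC d).mul (hmd (hA d))
    have h2 := dir_sub (e a) ((hmd (he.contMDiffOn_dR hU (hA c) b)).sub
      (hmd (he.contMDiffOn_dR hU (hA b) c))) (mdifferentiableAt_sum _ hm)
    have h3 := dir_sub (e a) (hmd (he.contMDiffOn_dR hU (hA c) b))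
      (hmd (he.contMDiffOn_dR hU (hA b) c))
    have h4 := dir_sum (e a) _ hm
    have h5 : ∀ d, dir (e a) (fun y => structFun g e b c d y * A d y) x
      = dR (e a) (structFun g e b c d) x * A d x
        + structFun g e b c d x * dR (e a) (A d) x := fun d => dir_mul (e a) (hC d) (hmd (hA d))
    simp only [h5] at h4
    refine h2.trans ?_
    rw [h4]
    congr 1
  have hcomm : ∀ a b c, dR (e a) (dR (e b) (A c)) x - dR (e b) (dR (e a) (A c)) x =
      ∑ d, structFun g e a b d x * dR (e d) (A c) x := fun a b c =>
    he.dir_comm hU (hA c) hx a b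
  have hJ := fun d => he.jacobi hU hx a b c d
  rw [h1 a b c, h1 b c a, h1 c a b]
  have e1 := hcomm a b c
  have e2 := hcomm b c a
  have e3 := hcomm c a b
  unfold extDer
  simp only [Fin.sum_univ_four] at *
  simp only [structFun_swap g e 0 a, structFun_swap g e 1 a, structFun_swap g e 2 a, structFun_swap g e 3 a, structFun_swap g e 0 b, structFun_swap g e 1 b, 
    structFun_swap g e 2 b, structFun_swap g e 3 b, 
    structFun_swap g e 0 c, structFun_swap g e 1 c, structFun_swap g e 2 c, structFun_swap g e 3 c]
  -- Second derivatives of the components cancel by the commutators `e1`, `e2`, `e3`; the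
  -- derivatives of the structure functions, which multiply components of A, cancel by Jacobi.
  linear_combination e1 + e2 + e3 - A 0 x * hJ 0 - A 1 x * hJ 1 - A 2 x * hJ 2 - A 3 x * hJ 3

end Frame

end

section

/-! ### Spinors as quaternions -/

/-- The quaternion with given components. -/
def mkH (a b c d : ℝ) : Quaternion ℝ := ⟨a, b, c, d⟩

@[simp] theorem mkH_re (a b c d : ℝ) : (mkH a b c d).re = a := rfl
@[simp] theorem mkH_imI (a b c d : ℝ) : (mkH a b c d).imI = b := rfl
@[simp] theorem mkH_imJ (a b c d : ℝ) : (mkH a b c d).imJ = c := rfl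
@[simp] theorem mkH_imK (a b c d : ℝ) : (mkH a b c d).imK = d := rfl

/-- The quaternions by which the matrices `quat` act. -/
def qu : Fin 4 → Quaternion ℝ
  | 0 => mkH 1 0 0 0
  | 1 => mkH 0 0 0 (-1)
  | 2 => mkH 0 0 (-1) 0
  | 3 => mkH 0 1 0 0

theorem qu_zero : qu 0 = mkH 1 0 0 0 := rfl
theorem qu_one : qu 1 = mkH 0 0 0 (-1) := rfl
theorem qu_two : qu 2 = mkH 0 0 (-1) 0 := rfl
theorem qu_three : qu 3 = mkH 0 1 0 0 := rfl

/-- The identification of `ℂ²` with the quaternions for which the matrices `quat` are left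
multiplications and complex scalars act on the right. -/
def toH (v : Fin 2 → ℂ) : Quaternion ℝ := mkH ((v 0).re) ((v 0).im) ((v 1).re) (-(v 1).im)

theorem toH_quat (a : Fin 4) (v : Fin 2 → ℂ) : toH ((quat a).mulVec v) = qu a * toH v := by
  fin_cases a <;> apply Quaternion.ext <;>
    simp [toH, quat, qu_zero, qu_one, qu_two, qu_three, Matrix.mulVec, dotProduct, Fin.sum_univ_two]

theorem toH_quat_star (a : Fin 4) (v : Fin 2 → ℂ) :
    toH ((quat a).conjTranspose.mulVec v) = star (qu a) * toH v := by
  fin_cases a <;> apply Quaternion.ext <;>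
    simp [toH, quat, qu_zero, qu_one, qu_two, qu_three, Matrix.mulVec, dotProduct, Fin.sum_univ_two,
      Matrix.conjTranspose_apply, Matrix.one_apply]

theorem toH_add (v w : Fin 2 → ℂ) : toH (v + w) = toH v + toH w := by
  apply Quaternion.ext <;> simp [toH]; ring

theorem toH_smul (c : ℂ) (v : Fin 2 → ℂ) : toH (c • v) = toH v * (c : Quaternion ℝ) := by
  apply Quaternion.ext <;> simp [toH] <;> ring

theorem toH_smul_real (c : ℝ) (v : Fin 2 → ℂ) : toH ((c : ℂ) • v) = c • toH v := by
  apply Quaternion.ext <;> simp [toH]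

theorem toH_eq_zero {v : Fin 2 → ℂ} : toH v = 0 ↔ v = 0 := by
  constructor
  · intro h
    have h0 := congrArg QuaternionAlgebra.re h
    have h1 := congrArg QuaternionAlgebra.imI h
    have h2 := congrArg QuaternionAlgebra.imJ h
    have h3 := congrArg QuaternionAlgebra.imK h
    simp [toH, Quaternion.re_zero, Quaternion.imI_zero, Quaternion.imJ_zero, Quaternion.imK_zero] at h0 h1 h2 h3
    funext i
    fin_cases i <;> apply Complex.ext <;> simp [h0, h1, h2, h3]
  · rintro rfl
    apply Quaternion.ext <;>
      simp [toH, Quaternion.re_zero, Quaternion.imI_zero, Quaternion.imJ_zero, Quaternion.imK_zero]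

/-- `toH` as a continuous real-linear map. -/
def toHL : (Fin 2 → ℂ) →L[ℝ] Quaternion ℝ :=
  LinearMap.toContinuousLinearMap
    { toFun := toH
      map_add' := toH_add
      map_smul' := fun c v => by
        have := toH_smul_real c v
        simpa using this }

theorem toHL_apply (v : Fin 2 → ℂ) : toHL v = toH v := rfl

/-- The action of a skew matrix on `𝕊`. -/
def rho (X : Fin 4 → Fin 4 → ℝ) : Quaternion ℝ :=
  (1 / 4 : ℝ) • ∑ b, ∑ c, X b c • (qu c * star (qu b))

/-- The action of a skew matrix on `𝕊'`. -/
def rho' (X : Fin 4 → Fin 4 → ℝ) : Quaternion ℝ :=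
  (1 / 4 : ℝ) • ∑ b, ∑ c, X b c • (star (qu c) * qu b)

theorem skew_diag {X : Fin 4 → Fin 4 → ℝ} (hX : ∀ a b, X a b = - X b a) (a : Fin 4) : X a a = 0 := by
  linarith [hX a a]

/-- Only the anti-self-dual combinations X₀₁ - X₂₃, X₀₂ + X₁₃, X₀₃ - X₁₂ survive here, and only the
self-dual ones in `rho'_eq`: this is the splitting so(4) = su(2) ⊕ su(2). -/
theorem rho_eq {X : Fin 4 → Fin 4 → ℝ} (hX : ∀ a b, X a b = - X b a) :
    rho X = mkH 0 ((1 / 2) * (X 0 3 - X 1 2)) ((1 / 2) * (-X 0 2 - X 1 3))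
      ((1 / 2) * (-X 0 1 + X 2 3)) := by
  have h10 := hX 1 0
  have h20 := hX 2 0
  have h30 := hX 3 0
  have h21 := hX 2 1
  have h31 := hX 3 1
  have h32 := hX 3 2
  apply Quaternion.ext <;> simp [rho, Fin.sum_univ_four, qu_zero, qu_one, qu_two, qu_three, skew_diag hX,
    h10, h20, h30, h21, h31, h32] <;> ring

theorem rho'_eq {X : Fin 4 → Fin 4 → ℝ} (hX : ∀ a b, X a b = - X b a) :
    rho' X = mkH 0 ((1 / 2) * (-X 0 3 - X 1 2)) ((1 / 2) * (X 0 2 - X 1 3))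
      ((1 / 2) * (X 0 1 + X 2 3)) := by
  have h10 := hX 1 0
  have h20 := hX 2 0
  have h30 := hX 3 0
  have h21 := hX 2 1
  have h31 := hX 3 1
  have h32 := hX 3 2
  apply Quaternion.ext <;> simp [rho', Fin.sum_univ_four, qu_zero, qu_one, qu_two, qu_three, skew_diag hX,
    h10, h20, h30, h21, h31, h32] <;> ring

/-- The infinitesimal form of Spin(4) covering SO(4), from which the soldering form is parallel. -/
theorem rho_mul_qu {X : Fin 4 → Fin 4 → ℝ} (hX : ∀ a b, X a b = - X b a) (b : Fin 4) :
    rho X * qu b - qu b * rho' X = ∑ c, X b c • qu c := by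
  have h10 := hX 1 0
  have h20 := hX 2 0
  have h30 := hX 3 0
  have h21 := hX 2 1
  have h31 := hX 3 1
  have h32 := hX 3 2
  rw [rho_eq hX, rho'_eq hX]
  fin_cases b <;> apply Quaternion.ext <;> simp [Fin.sum_univ_four, qu_zero, qu_one, qu_two, qu_three, skew_diag hX,
    h10, h20, h30, h21, h31, h32] <;> ring

theorem skew_bracket {X Y : Fin 4 → Fin 4 → ℝ} (hX : ∀ a b, X a b = - X b a)
    (hY : ∀ a b, Y a b = - Y b a) (c d : Fin 4) :
    ∑ f, (Y c f * X f d - X c f * Y f d) = - ∑ f, (Y d f * X f c - X d f * Y f c) := by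
  rw [← Finset.sum_neg_distrib]
  refine Finset.sum_congr rfl fun f _ => ?_
  rw [hX f d, hY f d, hX f c, hY f c]
  ring

/-- `rho` is a Lie algebra map for the transposed action X_{bc} e_c on frame vectors, whence the
order of the product on the right. That product is the quadratic term in `riemann`. -/
theorem rho_bracket {X Y : Fin 4 → Fin 4 → ℝ} (hX : ∀ a b, X a b = - X b a)
    (hY : ∀ a b, Y a b = - Y b a) :
    rho X * rho Y - rho Y * rho X = rho fun c d => ∑ f, (Y c f * X f d - X c f * Y f d) := by
  rw [rho_eq hX, rho_eq hY, rho_eq (skew_bracket hX hY)]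
  apply Quaternion.ext <;> simp [Fin.sum_univ_four, skew_diag hX, skew_diag hY, hX 1 0, hX 2 0, hX 3 0, hX 2 1,
    hX 3 1, hX 3 2, hY 1 0, hY 2 0, hY 3 0, hY 2 1, hY 3 1, hY 3 2] <;> ring

theorem rho'_bracket {X Y : Fin 4 → Fin 4 → ℝ} (hX : ∀ a b, X a b = - X b a)
    (hY : ∀ a b, Y a b = - Y b a) :
    rho' X * rho' Y - rho' Y * rho' X = rho' fun c d => ∑ f, (Y c f * X f d - X c f * Y f d) := by
  rw [rho'_eq hX, rho'_eq hY, rho'_eq (skew_bracket hX hY)]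
  apply Quaternion.ext <;> simp [Fin.sum_univ_four, skew_diag hX, skew_diag hY, hX 1 0, hX 2 0, hX 3 0, hX 2 1,
    hX 3 1, hX 3 2, hY 1 0, hY 2 0, hY 3 0, hY 2 1, hY 3 1, hY 3 2] <;> ring

/-! ### Anti-self-dual two-forms -/

theorem hodge_asd {F : Fin 4 → Fin 4 → ℝ} (hF : ∀ a b, F a b = - F b a)
    (h : ∀ a b, hodge F a b = - F a b) :
    F 2 3 = - F 0 1 ∧ F 1 3 = F 0 2 ∧ F 1 2 = - F 0 3 := by
  have h1 := h 2 3
  have h2 := h 1 3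
  have h3 := h 1 2
  have s2 : Int.sign 2 = 1 := rfl
  have s3 : Int.sign 3 = 1 := rfl
  simp [hodge, levi, Fin.sum_univ_four, s2, s3] at h1 h2 h3
  refine ⟨?_, ?_, ?_⟩
  · linarith [hF 1 0]
  · linarith [hF 2 0]
  · linarith [hF 3 0]

/-- The imaginary quaternion of an anti-self-dual two-form. -/
def asdQuat (F : Fin 4 → Fin 4 → ℝ) : Quaternion ℝ := mkH 0 (F 0 3) (-F 0 2) (-F 0 1)

theorem twoFormSpinor_eq {F : Fin 4 → Fin 4 → ℝ} (hF : ∀ a b, F a b = - F b a)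
    (h : ∀ a b, hodge F a b = - F a b) (B C : Fin 2) :
    twoFormSpinor F B C = (!![Complex.I * F 0 1 + F 0 2, -Complex.I * F 0 3;
      -Complex.I * F 0 3, -Complex.I * F 0 1 + F 0 2] : Matrix (Fin 2) (Fin 2) ℂ) B C := by
  obtain ⟨h1, h2, h3⟩ := hodge_asd hF h
  have hr : (((Real.sqrt 2 : ℝ) : ℂ))⁻¹ * (((Real.sqrt 2 : ℝ) : ℂ))⁻¹ = 1 / 2 := by
    rw [← mul_inv, ← Complex.ofReal_mul, Real.mul_self_sqrt (by norm_num)]; norm_num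
  generalize hk : (((Real.sqrt 2 : ℝ) : ℂ))⁻¹ = k at hr
  have h10 := hF 1 0
  have h20 := hF 2 0
  have h30 := hF 3 0
  have h21 := hF 2 1
  have h31 := hF 3 1
  have h32 := hF 3 2
  rw [h1] at h32
  rw [h2] at h31
  rw [h3] at h21
  fin_cases B <;> fin_cases C <;>
    simp [twoFormSpinor, eps, solder, quat, Fin.sum_univ_two, Fin.sum_univ_four, Matrix.one_apply,
      hk, skew_diag hF, h10, h20, h30, h21, h31, h32, h1, h2, h3] <;>
    ring_nf <;> (try simp only [Complex.I_sq])
  · linear_combination (2 * (Complex.I * F 0 1 + F 0 2)) * hr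
  · linear_combination (2 * (-Complex.I * F 0 3)) * hr
  · linear_combination (2 * (-Complex.I * F 0 3)) * hr
  · linear_combination (2 * (-Complex.I * F 0 1 + F 0 2)) * hr

end

/-! ### Spin connections and their curvature. -/

section

variable {M : Type*} [TopologicalSpace M] [ChartedSpace E4 M]

theorem mdifferentiableAt_clm_comp {F G : Type*} [NormedAddCommGroup F] [NormedSpace ℝ F]
    [NormedAddCommGroup G] [NormedSpace ℝ G] (L : F →L[ℝ] G) {f : M → F} {x : M}
    (hf : MDifferentiableAt 𝓘(ℝ, E4) 𝓘(ℝ, F) f x) :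
    MDifferentiableAt 𝓘(ℝ, E4) 𝓘(ℝ, G) (fun y => L (f y)) x :=
  L.mdifferentiableAt.comp x hf

theorem mdifferentiableAt_qmul {f f' : M → ℍ[ℝ]} {x : M}
    (hf : MDifferentiableAt 𝓘(ℝ, E4) 𝓘(ℝ, ℍ[ℝ]) f x)
    (hf' : MDifferentiableAt 𝓘(ℝ, E4) 𝓘(ℝ, ℍ[ℝ]) f' x) :
    MDifferentiableAt 𝓘(ℝ, E4) 𝓘(ℝ, ℍ[ℝ]) (fun y => f y * f' y) x :=
  (hf.hasMFDerivAt.mul' hf'.hasMFDerivAt).mdifferentiableAt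

theorem mdifferentiableAt_smul {f : M → ℝ} {f' : M → ℍ[ℝ]} {x : M}
    (hf : MDifferentiableAt 𝓘(ℝ, E4) 𝓘(ℝ, ℝ) f x)
    (hf' : MDifferentiableAt 𝓘(ℝ, E4) 𝓘(ℝ, ℍ[ℝ]) f' x) :
    MDifferentiableAt 𝓘(ℝ, E4) 𝓘(ℝ, ℍ[ℝ]) (fun y => f y • f' y) x :=
  hf.smul hf'

theorem dir_pi (X : VField M) {n : Type*} [Fintype n] {F : Type*} [NormedAddCommGroup F]
    [NormedSpace ℝ F] {f : M → n → F} {x : M}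
    (hf : MDifferentiableAt 𝓘(ℝ, E4) 𝓘(ℝ, n → F) f x) (i : n) :
    dir X f x i = dir X (fun y => f y i) x :=
  (dir_comp_clm X (ContinuousLinearMap.proj (R := ℝ) (φ := fun _ : n => F) i) hf).symm

theorem mdifferentiableAt_pi {n : Type*} [Fintype n] {F : Type*} [NormedAddCommGroup F]
    [NormedSpace ℝ F] {f : M → n → F} {x : M}
    (hf : ∀ i, MDifferentiableAt 𝓘(ℝ, E4) 𝓘(ℝ, F) (fun y => f y i) x) :
    MDifferentiableAt 𝓘(ℝ, E4) 𝓘(ℝ, n → F) f x := by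
  classical
  have h : f = fun y => ∑ i, ContinuousLinearMap.single ℝ (fun _ : n => F) i (f y i) := by
    funext y
    simp [Finset.univ_sum_single]
  rw [h]
  exact mdifferentiableAt_sum _ fun i _ => mdifferentiableAt_clm_comp _ (hf i)

/-- `rho` as a continuous linear map. -/
def rhoL : (Fin 4 → Fin 4 → ℝ) →L[ℝ] ℍ[ℝ] :=
  LinearMap.toContinuousLinearMap
    { toFun := rho
      map_add' := fun X Y => by
        simp only [rho, Pi.add_apply, add_smul, Finset.sum_add_distrib, smul_add]
      map_smul' := fun c X => by
        simp only [rho, Pi.smul_apply, smul_eq_mul, mul_smul, ← Finset.smul_sum, RingHom.id_apply]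
        rw [smul_comm] }

/-- `rho'` as a continuous linear map. -/
def rhoL' : (Fin 4 → Fin 4 → ℝ) →L[ℝ] ℍ[ℝ] :=
  LinearMap.toContinuousLinearMap
    { toFun := rho'
      map_add' := fun X Y => by
        simp only [rho', Pi.add_apply, add_smul, Finset.sum_add_distrib, smul_add]
      map_smul' := fun c X => by
        simp only [rho', Pi.smul_apply, smul_eq_mul, mul_smul, ← Finset.smul_sum, RingHom.id_apply]
        rw [smul_comm] }

variable [IsManifold 𝓘(ℝ, E4) ∞ M]
variable {g : Metric4 M} {U : Set M} {e : Fin 4 → VField M}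

/-- The connection coefficients on `𝕊`. -/
def gam (g : Metric4 M) (e : Fin 4 → VField M) (a : Fin 4) (x : M) : ℍ[ℝ] :=
  rho fun b c => leviCivita g e a b c x

/-- The connection coefficients on `𝕊'`. -/
def gam' (g : Metric4 M) (e : Fin 4 → VField M) (a : Fin 4) (x : M) : ℍ[ℝ] :=
  rho' fun b c => leviCivita g e a b c x

theorem IsOrthonormalFrame.mdifferentiableAt_leviCivita_matrix (he : IsOrthonormalFrame g U e)
    (hU : IsOpen U) {x : M} (hx : x ∈ U) (a : Fin 4) :
    MDifferentiableAt 𝓘(ℝ, E4) 𝓘(ℝ, Fin 4 → Fin 4 → ℝ)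
      (fun y b c => leviCivita g e a b c y) x :=
  mdifferentiableAt_pi fun b => mdifferentiableAt_pi fun c =>
    he.mdifferentiableAt_leviCivita hU hx a b c

theorem IsOrthonormalFrame.mdifferentiableAt_gam (he : IsOrthonormalFrame g U e)
    (hU : IsOpen U) {x : M} (hx : x ∈ U) (a : Fin 4) :
    MDifferentiableAt 𝓘(ℝ, E4) 𝓘(ℝ, ℍ[ℝ]) (gam g e a) x :=
  mdifferentiableAt_clm_comp rhoL (he.mdifferentiableAt_leviCivita_matrix hU hx a)

theorem IsOrthonormalFrame.mdifferentiableAt_gam' (he : IsOrthonormalFrame g U e)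
    (hU : IsOpen U) {x : M} (hx : x ∈ U) (a : Fin 4) :
    MDifferentiableAt 𝓘(ℝ, E4) 𝓘(ℝ, ℍ[ℝ]) (gam' g e a) x :=
  mdifferentiableAt_clm_comp rhoL' (he.mdifferentiableAt_leviCivita_matrix hU hx a)

theorem IsOrthonormalFrame.dir_leviCivita_matrix (he : IsOrthonormalFrame g U e)
    (hU : IsOpen U) {x : M} (hx : x ∈ U) (a b : Fin 4) :
    (fun c d => riemann g e a b c d x) =
      dir (e a) (fun y c d => leviCivita g e b c d y) x
        - dir (e b) (fun y c d => leviCivita g e a c d y) x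
        + (fun c d => ∑ f, (leviCivita g e b c f x * leviCivita g e a f d x
            - leviCivita g e a c f x * leviCivita g e b f d x))
        - ∑ f, structFun g e a b f x • (fun c d => leviCivita g e f c d x) := by
  funext c d
  have h := fun a b => he.mdifferentiableAt_leviCivita_matrix hU hx b |> fun h => dir_pi (e a) h c
  have h2 : ∀ a b, dir (e a) (fun y c d => leviCivita g e b c d y) x c d
      = dR (e a) (leviCivita g e b c d) x := by
    intro a b
    rw [h a b, dir_pi (e a) (mdifferentiableAt_pi fun d =>
      he.mdifferentiableAt_leviCivita hU hx b c d)]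
    rfl
  simp only [Pi.add_apply, Pi.sub_apply, h2, Finset.sum_apply, Pi.smul_apply, smul_eq_mul]
  unfold riemann
  rw [Finset.sum_sub_distrib]
  ring

/-- `rho` is a constant linear map and respects brackets, so it carries dω + ω ∧ ω to the curvature
of the spin connection. -/
theorem IsOrthonormalFrame.rho_riemann (he : IsOrthonormalFrame g U e)
    (hU : IsOpen U) {x : M} (hx : x ∈ U) (a b : Fin 4) :
    dir (e a) (gam g e b) x - dir (e b) (gam g e a) x
      + (gam g e a x * gam g e b x - gam g e b x * gam g e a x)
      - ∑ c, structFun g e a b c x • gam g e c x = rho fun c d => riemann g e a b c d x := by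
  have h := congrArg rhoL (he.dir_leviCivita_matrix hU hx a b)
  rw [map_sub, map_add, map_sub, map_sum,
    ← dir_comp_clm _ rhoL (he.mdifferentiableAt_leviCivita_matrix hU hx a),
    ← dir_comp_clm _ rhoL (he.mdifferentiableAt_leviCivita_matrix hU hx b)] at h
  simp only [map_smul] at h
  refine Eq.trans ?_ h.symm
  have h2 := rho_bracket (leviCivita_swap g e a · · x) (leviCivita_swap g e b · · x)
  change dir (e a) (gam g e b) x - dir (e b) (gam g e a) x
      + (rho _ * rho _ - rho _ * rho _) - _ = _
  rw [h2]
  rfl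

theorem IsOrthonormalFrame.rho'_riemann (he : IsOrthonormalFrame g U e)
    (hU : IsOpen U) {x : M} (hx : x ∈ U) (a b : Fin 4) :
    dir (e a) (gam' g e b) x - dir (e b) (gam' g e a) x
      + (gam' g e a x * gam' g e b x - gam' g e b x * gam' g e a x)
      - ∑ c, structFun g e a b c x • gam' g e c x = rho' fun c d => riemann g e a b c d x := by
  have h := congrArg rhoL' (he.dir_leviCivita_matrix hU hx a b)
  rw [map_sub, map_add, map_sub, map_sum,
    ← dir_comp_clm _ rhoL' (he.mdifferentiableAt_leviCivita_matrix hU hx a),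
    ← dir_comp_clm _ rhoL' (he.mdifferentiableAt_leviCivita_matrix hU hx b)] at h
  simp only [map_smul] at h
  refine Eq.trans ?_ h.symm
  have h2 := rho'_bracket (leviCivita_swap g e a · · x) (leviCivita_swap g e b · · x)
  change dir (e a) (gam' g e b) x - dir (e b) (gam' g e a) x
      + (rho' _ * rho' _ - rho' _ * rho' _) - _ = _
  rw [h2]
  rfl

/-- The Ricci identity for a connection `d + G` in a frame. -/
theorem IsOrthonormalFrame.ricci_identity (he : IsOrthonormalFrame g U e) (hU : IsOpen U)
    {f : M → ℍ[ℝ]} {G N : Fin 4 → M → ℍ[ℝ]} (hf : ContMDiffOn 𝓘(ℝ, E4) 𝓘(ℝ, ℍ[ℝ]) ∞ f U)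
    {x : M} (hx : x ∈ U) (hG : ∀ a, MDifferentiableAt 𝓘(ℝ, E4) 𝓘(ℝ, ℍ[ℝ]) (G a) x)
    (hN : ∀ y ∈ U, ∀ a, dir (e a) f y + G a y * f y = N a y) (a b : Fin 4) :
    (dir (e a) (G b) x - dir (e b) (G a) x + (G a x * G b x - G b x * G a x)
      - ∑ c, structFun g e a b c x • G c x) * f x =
    (dir (e a) (N b) x + G a x * N b x) - (dir (e b) (N a) x + G b x * N a x)
      - ∑ c, structFun g e a b c x • N c x := by
  have hfx := mdifferentiableAt_of_contMDiffOn hU hf hx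
  have hdir : ∀ a b, dir (e a) (N b) x =
      dir (e a) (dir (e b) f) x + (dir (e a) (G b) x * f x + G b x * dir (e a) f x) := by
    intro a b
    have h1 : N b =ᶠ[𝓝 x] fun y => dir (e b) f y + G b y * f y :=
      Filter.eventually_of_mem (hU.mem_nhds hx) fun y hy => (hN y hy b).symm
    rw [dir_congr h1, dir_add _ (mdifferentiableAt_of_contMDiffOn hU (contMDiffOn_dir hU (he.1 b) hf)
      hx) (mdifferentiableAt_qmul (hG b) hfx), dir_mul _ (hG b) hfx]
  have hc := he.dir_comm hU hf hx a b
  rw [hdir, hdir]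
  simp only [← hN x hx, smul_add, Finset.sum_add_distrib]
  rw [← hc, sub_mul, Finset.sum_mul]
  simp only [smul_mul_assoc]
  noncomm_ring

end

/-! ### The quaternionic Killing system and its curvature identities. -/

section

variable {M : Type*} [TopologicalSpace M] [ChartedSpace E4 M]

/-- `f` is differentiable at `x`, with derivative `d` along `X`. -/
def HasDir {F : Type*} [NormedAddCommGroup F] [NormedSpace ℝ F] (X : VField M) (f : M → F) (x : M)
    (d : F) : Prop := MDifferentiableAt 𝓘(ℝ, E4) 𝓘(ℝ, F) f x ∧ dir X f x = d

/-- Conjugation as a continuous linear map. -/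
def starCLM : ℍ[ℝ] →L[ℝ] ℍ[ℝ] :=
  LinearMap.toContinuousLinearMap
    { toFun := star
      map_add' := star_add
      map_smul' := fun c q => Quaternion.star_smul c q }

namespace HasDir

variable {F : Type*} [NormedAddCommGroup F] [NormedSpace ℝ F] {X : VField M} {x : M}

theorem of_mdifferentiableAt {f : M → F} (hf : MDifferentiableAt 𝓘(ℝ, E4) 𝓘(ℝ, F) f x) :
    HasDir X f x (dir X f x) := ⟨hf, rfl⟩

theorem add {f f' : M → F} {d d' : F} (h : HasDir X f x d) (h' : HasDir X f' x d') :
    HasDir X (fun y => f y + f' y) x (d + d') :=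
  ⟨h.1.add h'.1, by rw [dir_add X h.1 h'.1, h.2, h'.2]⟩

theorem sub {f f' : M → F} {d d' : F} (h : HasDir X f x d) (h' : HasDir X f' x d') :
    HasDir X (fun y => f y - f' y) x (d - d') :=
  ⟨h.1.sub h'.1, by rw [dir_sub X h.1 h'.1, h.2, h'.2]⟩

theorem neg {f : M → F} {d : F} (h : HasDir X f x d) : HasDir X (fun y => - f y) x (- d) :=
  ⟨h.1.neg, by rw [dir_neg, h.2]⟩

theorem clm {G : Type*} [NormedAddCommGroup G] [NormedSpace ℝ G] (L : F →L[ℝ] G) {f : M → F} {d : F}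
    (h : HasDir X f x d) : HasDir X (fun y => L (f y)) x (L d) :=
  ⟨mdifferentiableAt_clm_comp L h.1, by rw [dir_comp_clm X L h.1, h.2]⟩

theorem const_smul {f : M → F} {d : F} (k : ℝ) (h : HasDir X f x d) :
    HasDir X (fun y => k • f y) x (k • d) :=
  h.clm (k • ContinuousLinearMap.id ℝ F)

theorem smul {r : M → ℝ} {r' : ℝ} {f : M → ℍ[ℝ]} {d : ℍ[ℝ]} (h : HasDir X r x r')
    (h' : HasDir X f x d) : HasDir X (fun y => r y • f y) x (r' • f x + r x • d) :=
  ⟨mdifferentiableAt_smul h.1 h'.1, by rw [dir_smul X h.1 h'.1, h.2, h'.2]⟩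

theorem mul {f f' : M → ℍ[ℝ]} {d d' : ℍ[ℝ]} (h : HasDir X f x d)
    (h' : HasDir X f' x d') : HasDir X (fun y => f y * f' y) x (d * f' x + f x * d') :=
  ⟨mdifferentiableAt_qmul h.1 h'.1, by rw [dir_mul X h.1 h'.1, h.2, h'.2]⟩

theorem const_mul {f : M → ℍ[ℝ]} {d : ℍ[ℝ]} (q : ℍ[ℝ]) (h : HasDir X f x d) :
    HasDir X (fun y => q * f y) x (q * d) :=
  h.clm (ContinuousLinearMap.mul ℝ ℍ[ℝ] q)

theorem mul_const {f : M → ℍ[ℝ]} {d : ℍ[ℝ]} (q : ℍ[ℝ]) (h : HasDir X f x d) :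
    HasDir X (fun y => f y * q) x (d * q) :=
  h.clm ((ContinuousLinearMap.mul ℝ ℍ[ℝ]).flip q)

theorem star {f : M → ℍ[ℝ]} {d : ℍ[ℝ]} (h : HasDir X f x d) :
    HasDir X (fun y => Star.star (f y)) x (Star.star d) :=
  h.clm starCLM

end HasDir

variable [IsManifold 𝓘(ℝ, E4) ∞ M] {g : Metric4 M} {U : Set M} {e : Fin 4 → VField M}

theorem _root_.Quaternion.coeComplex_sub (z w : ℂ) : ((z - w : ℂ) : ℍ[ℝ]) = z - w :=
  map_sub Quaternion.ofComplex z w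

theorem _root_.Quaternion.coeComplex_mul_comm (z w : ℂ) : (z : ℍ[ℝ]) * w = w * z := by
  rw [← Quaternion.coeComplex_mul, mul_comm, Quaternion.coeComplex_mul]

/-- The normalization constant of the soldering symbols. -/
def kap : ℝ := (Real.sqrt 2)⁻¹

theorem kap_mul_kap : kap * kap = 1 / 2 := by
  unfold kap
  rw [← mul_inv, Real.mul_self_sqrt (by norm_num)]; norm_num

/-- The relations between the components of an anti-self-dual two-form. -/
def IsASDForm (F : Fin 4 → Fin 4 → ℝ) : Prop := F 2 3 = - F 0 1 ∧ F 1 3 = F 0 2 ∧ F 1 2 = - F 0 3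

/-- The Maxwell field as a quaternion valued function. -/
def maxwell (g : Metric4 M) (e : Fin 4 → VField M) (A : Fin 4 → M → ℝ) (x : M) : ℍ[ℝ] :=
  asdQuat fun a b => extDer g e A a b x

/-- A solution of the Killing spinor equations over an orthonormal frame, in quaternionic form. -/
structure IsKillingPair (g : Metric4 M) (U : Set M) (e : Fin 4 → VField M) (A : Fin 4 → M → ℝ)
    (c₀ c₁ c₂ c₃ c₄ : ℂ) (s t : M → ℍ[ℝ]) : Prop where
  isOpen : IsOpen U
  frame : IsOrthonormalFrame g U e
  smooth_A : ∀ a, ContMDiffOn 𝓘(ℝ, E4) 𝓘(ℝ, ℝ) ∞ (A a) U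
  smooth_s : ContMDiffOn 𝓘(ℝ, E4) 𝓘(ℝ, ℍ[ℝ]) ∞ s U
  smooth_t : ContMDiffOn 𝓘(ℝ, E4) 𝓘(ℝ, ℍ[ℝ]) ∞ t U
  asd : ∀ x ∈ U, IsASDForm fun a b => extDer g e A a b x
  eq_s : ∀ x ∈ U, ∀ a, dir (e a) s x + gam g e a x * s x = -(A a x • (s x * c₀))
    + kap • (maxwell g e A x * (qu a * (t x * c₁)) + qu a * (t x * c₂))
  eq_t : ∀ x ∈ U, ∀ a, dir (e a) t x + gam' g e a x * t x = -(A a x • (t x * c₃))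
    - kap • (star (qu a) * (s x * c₄))

/-- The covariant derivative of the Maxwell field. -/
def nablaMaxwell (g : Metric4 M) (e : Fin 4 → VField M) (A : Fin 4 → M → ℝ) (a : Fin 4) (x : M) :
    ℍ[ℝ] :=
  dir (e a) (maxwell g e A) x + gam g e a x * maxwell g e A x - maxwell g e A x * gam g e a x

/-- The soldering form is parallel. Moving connection coefficients across `qu` by this rule is what
makes them cancel in the curvature identities. -/
theorem gam_mul_qu (g : Metric4 M) (e : Fin 4 → VField M) (a b : Fin 4) (x : M) :
    gam g e a x * qu b = qu b * gam' g e a x + ∑ c, leviCivita g e a b c x • qu c := by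
  rw [← rho_mul_qu (leviCivita_swap g e a · · x) b]
  unfold gam gam'
  abel

theorem star_gam (g : Metric4 M) (e : Fin 4 → VField M) (a : Fin 4) (x : M) :
    star (gam g e a x) = - gam g e a x := by
  unfold gam
  rw [rho_eq (leviCivita_swap g e a · · x)]
  apply Quaternion.ext <;> simp

theorem star_gam' (g : Metric4 M) (e : Fin 4 → VField M) (a : Fin 4) (x : M) :
    star (gam' g e a x) = - gam' g e a x := by
  unfold gam'
  rw [rho'_eq (leviCivita_swap g e a · · x)]
  apply Quaternion.ext <;> simp

theorem gam'_mul_star_qu (g : Metric4 M) (e : Fin 4 → VField M) (a b : Fin 4) (x : M) :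
    gam' g e a x * star (qu b) = star (qu b) * gam g e a x
      + ∑ c, leviCivita g e a b c x • star (qu c) := by
  have h := congrArg star (gam_mul_qu g e a b x)
  simp only [star_mul, star_add, star_sum, star_gam, star_gam', Quaternion.star_smul] at h
  rw [mul_neg, neg_mul] at h
  rw [← sub_eq_zero] at h ⊢
  rw [← h]
  abel

theorem sum_structFun_smul (g : Metric4 M) (e : Fin 4 → VField M) (a b : Fin 4) (x : M)
    (q : Fin 4 → ℍ[ℝ]) : ∑ c, structFun g e a b c x • q c =
      ∑ c, leviCivita g e a b c x • q c - ∑ c, leviCivita g e b a c x • q c := by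
  rw [← Finset.sum_sub_distrib]
  refine Finset.sum_congr rfl fun c _ => ?_
  rw [structFun_eq, sub_smul]

namespace IsKillingPair

variable {A : Fin 4 → M → ℝ} {c₀ c₁ c₂ c₃ c₄ : ℂ} {s t : M → ℍ[ℝ]}

theorem mdifferentiableAt_maxwell (h : IsKillingPair g U e A c₀ c₁ c₂ c₃ c₄ s t) {x : M}
    (hx : x ∈ U) : MDifferentiableAt 𝓘(ℝ, E4) 𝓘(ℝ, ℍ[ℝ]) (maxwell g e A) x := by
  have hF : ∀ a b, MDifferentiableAt 𝓘(ℝ, E4) 𝓘(ℝ, ℝ) (extDer g e A a b) x := fun a b =>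
    mdifferentiableAt_of_contMDiffOn h.isOpen (h.frame.contMDiffOn_extDer h.isOpen h.smooth_A a b) hx
  have h1 : maxwell g e A = fun y => extDer g e A 0 1 y • qu 1 + extDer g e A 0 2 y • qu 2
      + extDer g e A 0 3 y • qu 3 := by
    funext y
    unfold maxwell asdQuat
    apply Quaternion.ext <;> simp [qu_one, qu_two, qu_three]
  rw [h1]
  exact ((mdifferentiableAt_smul (hF 0 1) mdifferentiableAt_const).add
    (mdifferentiableAt_smul (hF 0 2) mdifferentiableAt_const)).add
    (mdifferentiableAt_smul (hF 0 3) mdifferentiableAt_const)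

/-- The right side of the t-equation is differentiated once more and the Killing equations are
substituted. Connection terms cancel since the soldering form is parallel and the torsion is zero,
and terms quadratic in A are symmetric. The potential survives undifferentiated only because s and t
have different charges, with the factor c₀ - c₃. -/
theorem curvature_t (h : IsKillingPair g U e A c₀ c₁ c₂ c₃ c₄ s t) {x : M} (hx : x ∈ U)
    (a b : Fin 4) : (rho' fun c d => riemann g e a b c d x) * t x =
      -(extDer g e A a b x • (t x * c₃))
      + kap • ((A a x • star (qu b) - A b x • star (qu a)) * (s x * ((c₀ - c₃ : ℂ) * c₄ : ℂ)))
      - (kap * kap) • (star (qu b) * (maxwell g e A x * (qu a * (t x * (c₁ * c₄ : ℂ)))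
            + qu a * (t x * (c₂ * c₄ : ℂ)))
          - star (qu a) * (maxwell g e A x * (qu b * (t x * (c₁ * c₄ : ℂ)))
            + qu b * (t x * (c₂ * c₄ : ℂ)))) := by
  rw [← h.frame.rho'_riemann h.isOpen hx, h.frame.ricci_identity h.isOpen h.smooth_t hx
    (h.frame.mdifferentiableAt_gam' h.isOpen hx) h.eq_t]
  have hs := mdifferentiableAt_of_contMDiffOn h.isOpen h.smooth_s hx
  have ht := mdifferentiableAt_of_contMDiffOn h.isOpen h.smooth_t hx
  have hAd := fun a => mdifferentiableAt_of_contMDiffOn h.isOpen (h.smooth_A a) hx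
  have hN : ∀ a b, dir (e a) (fun y => -(A b y • (t y * c₃))
      - kap • (star (qu b) * (s y * c₄))) x =
      -(dR (e a) (A b) x • (t x * c₃) + A b x • (dir (e a) t x * c₃))
      - kap • (star (qu b) * (dir (e a) s x * c₄)) := fun a b =>
    (((HasDir.of_mdifferentiableAt (hAd b)).smul ((HasDir.of_mdifferentiableAt ht).mul_const _)).neg.sub
      ((((HasDir.of_mdifferentiableAt hs).mul_const _).const_mul _).const_smul kap)).2
  have es : ∀ a, dir (e a) s x = -(gam g e a x * s x) -(A a x • (s x * c₀))
    + kap • (maxwell g e A x * (qu a * (t x * c₁)) + qu a * (t x * c₂)) := fun a => by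
      rw [← sub_eq_zero, ← sub_eq_zero.mpr (h.eq_s x hx a)]; abel
  have et : ∀ a, dir (e a) t x = -(gam' g e a x * t x) -(A a x • (t x * c₃))
    - kap • (star (qu a) * (s x * c₄)) := fun a => by
      rw [← sub_eq_zero, ← sub_eq_zero.mpr (h.eq_t x hx a)]; abel
  have hG : ∀ a b, gam' g e a x * (star (qu b) * (s x * c₄)) =
      star (qu b) * (gam g e a x * (s x * c₄))
        + (∑ c, leviCivita g e a b c x • star (qu c)) * (s x * c₄) := by
    intro a b
    rw [← mul_assoc, gam'_mul_star_qu, add_mul, mul_assoc]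
  have hC : ∑ c, structFun g e a b c x • (-(A c x • (t x * c₃))
      - kap • (star (qu c) * (s x * c₄))) =
      -((∑ c, structFun g e a b c x * A c x) • (t x * c₃))
      - kap • ((∑ c, leviCivita g e a b c x • star (qu c)) * (s x * c₄))
      + kap • ((∑ c, leviCivita g e b a c x • star (qu c)) * (s x * c₄)) := by
    have h1 := sum_structFun_smul g e a b x fun c => star (qu c)
    rw [sub_add, ← smul_sub, ← sub_mul, ← h1]
    simp only [smul_sub, smul_neg, Finset.sum_sub_distrib, Finset.sum_smul, Finset.sum_mul,
      Finset.smul_sum, Finset.sum_neg_distrib, smul_mul_assoc, smul_smul, mul_comm kap]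
  rw [hN, hN, hC, es, es, et, et]
  unfold extDer
  simp only [mul_add, mul_sub, add_mul, sub_mul, mul_neg, neg_mul, smul_mul_assoc, mul_smul_comm,
    hG, mul_assoc, Quaternion.coeComplex_mul, Quaternion.coeComplex_sub, smul_add, smul_sub, smul_neg, smul_smul, sub_smul, Quaternion.coeComplex_mul_comm c₄ c₃]
  module

/-- The argument for t applies, with one new feature: Φ multiplies t in the s-equation, so its
covariant derivative appears. -/
theorem curvature_s (h : IsKillingPair g U e A c₀ c₁ c₂ c₃ c₄ s t) {x : M} (hx : x ∈ U)
    (a b : Fin 4) : (rho fun c d => riemann g e a b c d x) * s x =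
      -(extDer g e A a b x • (s x * c₀))
      + kap • (maxwell g e A x * ((A a x • qu b - A b x • qu a) * (t x * ((c₀ - c₃ : ℂ) * c₁ : ℂ)))
        + (A a x • qu b - A b x • qu a) * (t x * ((c₀ - c₃ : ℂ) * c₂ : ℂ)))
      + kap • ((nablaMaxwell g e A a x * qu b - nablaMaxwell g e A b x * qu a) * (t x * c₁))
      - (kap * kap) • (maxwell g e A x * ((qu b * star (qu a) - qu a * star (qu b))
            * (s x * (c₁ * c₄ : ℂ)))
          + (qu b * star (qu a) - qu a * star (qu b)) * (s x * (c₂ * c₄ : ℂ))) := by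
  rw [← h.frame.rho_riemann h.isOpen hx, h.frame.ricci_identity h.isOpen h.smooth_s hx
    (h.frame.mdifferentiableAt_gam h.isOpen hx) h.eq_s]
  have hs := mdifferentiableAt_of_contMDiffOn h.isOpen h.smooth_s hx
  have ht := mdifferentiableAt_of_contMDiffOn h.isOpen h.smooth_t hx
  have hAd := fun a => mdifferentiableAt_of_contMDiffOn h.isOpen (h.smooth_A a) hx
  have hm := h.mdifferentiableAt_maxwell hx
  have hN : ∀ a b, dir (e a) (fun y => -(A b y • (s y * c₀))
      + kap • (maxwell g e A y * (qu b * (t y * c₁)) + qu b * (t y * c₂))) x =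
      -(dR (e a) (A b) x • (s x * c₀) + A b x • (dir (e a) s x * c₀))
      + kap • ((dir (e a) (maxwell g e A) x * (qu b * (t x * c₁))
        + maxwell g e A x * (qu b * (dir (e a) t x * c₁))) + qu b * (dir (e a) t x * c₂)) :=
    fun a b =>
    have dt := HasDir.of_mdifferentiableAt (X := e a) ht
    (((HasDir.of_mdifferentiableAt (hAd b)).smul
      ((HasDir.of_mdifferentiableAt hs).mul_const _)).neg.add
      ((((HasDir.of_mdifferentiableAt hm).mul ((dt.mul_const _).const_mul _)).add
        ((dt.mul_const _).const_mul _)).const_smul kap)).2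
  have es : ∀ a, dir (e a) s x = -(gam g e a x * s x) -(A a x • (s x * c₀))
    + kap • (maxwell g e A x * (qu a * (t x * c₁)) + qu a * (t x * c₂)) := fun a => by
      rw [← sub_eq_zero, ← sub_eq_zero.mpr (h.eq_s x hx a)]; abel
  have et : ∀ a, dir (e a) t x = -(gam' g e a x * t x) -(A a x • (t x * c₃))
    - kap • (star (qu a) * (s x * c₄)) := fun a => by
      rw [← sub_eq_zero, ← sub_eq_zero.mpr (h.eq_t x hx a)]; abel
  have hG : ∀ a b (z : ℍ[ℝ]), gam g e a x * (qu b * z) =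
      qu b * (gam' g e a x * z) + (∑ c, leviCivita g e a b c x • qu c) * z := by
    intro a b z
    rw [← mul_assoc, gam_mul_qu, add_mul, mul_assoc]
  have hM : ∀ a (z : ℍ[ℝ]), gam g e a x * (maxwell g e A x * z) =
      nablaMaxwell g e A a x * z - dir (e a) (maxwell g e A) x * z
        + maxwell g e A x * (gam g e a x * z) := by
    intro a z
    unfold nablaMaxwell
    noncomm_ring
  have hC : ∑ c, structFun g e a b c x • (-(A c x • (s x * c₀))
      + kap • (maxwell g e A x * (qu c * (t x * c₁)) + qu c * (t x * c₂))) =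
      -((∑ c, structFun g e a b c x * A c x) • (s x * c₀))
      + kap • (maxwell g e A x * ((∑ c, leviCivita g e a b c x • qu c
          - ∑ c, leviCivita g e b a c x • qu c) * (t x * c₁))
        + (∑ c, leviCivita g e a b c x • qu c
          - ∑ c, leviCivita g e b a c x • qu c) * (t x * c₂)) := by
    rw [← sum_structFun_smul g e a b x fun c => qu c]
    simp only [smul_add, smul_neg, Finset.sum_add_distrib, Finset.sum_smul, Finset.sum_mul,
      Finset.mul_sum, mul_smul_comm,
      Finset.smul_sum, Finset.sum_neg_distrib, smul_mul_assoc, smul_smul, mul_comm kap]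
  rw [hN, hN, hC, es, es, et, et]
  unfold extDer
  simp only [mul_add, mul_sub, add_mul, sub_mul, mul_neg, neg_mul, smul_mul_assoc, mul_smul_comm,
    hM, hG, mul_assoc, Quaternion.coeComplex_mul, Quaternion.coeComplex_sub, smul_add, smul_sub,
    smul_neg, smul_smul, sub_smul, Quaternion.coeComplex_mul_comm c₄,
    Quaternion.coeComplex_mul_comm c₀, Quaternion.coeComplex_mul_comm c₃]
  module

end IsKillingPair

end

/-! ### The Maxwell equation. -/

section

variable {M : Type*} [TopologicalSpace M] [ChartedSpace E4 M] [IsManifold 𝓘(ℝ, E4) ∞ M]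
variable {g : Metric4 M} {U : Set M} {e : Fin 4 → VField M}
variable {A : Fin 4 → M → ℝ} {c₀ c₁ c₂ c₃ c₄ : ℂ} {s t : M → ℍ[ℝ]}

namespace IsKillingPair

theorem dir_maxwell (h : IsKillingPair g U e A c₀ c₁ c₂ c₃ c₄ s t) {x : M} (hx : x ∈ U)
    (a : Fin 4) : dir (e a) (maxwell g e A) x = mkH 0 (dR (e a) (extDer g e A 0 3) x)
      (-dR (e a) (extDer g e A 0 2) x) (-dR (e a) (extDer g e A 0 1) x) := by
  have hF : ∀ b c, HasDir (e a) (extDer g e A b c) x (dR (e a) (extDer g e A b c) x) := fun b c =>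
    HasDir.of_mdifferentiableAt (mdifferentiableAt_of_contMDiffOn h.isOpen
      (h.frame.contMDiffOn_extDer h.isOpen h.smooth_A b c) hx)
  have hcst : ∀ q : ℍ[ℝ], HasDir (e a) (fun _ : M => q) x 0 := fun q =>
    ⟨mdifferentiableAt_const, dir_const _ q x⟩
  have h1 : maxwell g e A = fun y => extDer g e A 0 1 y • qu 1 + extDer g e A 0 2 y • qu 2
      + extDer g e A 0 3 y • qu 3 := by
    funext y
    unfold maxwell asdQuat
    apply Quaternion.ext <;> simp [qu_one, qu_two, qu_three]
  rw [h1, ((((hF 0 1).smul (hcst _)).add ((hF 0 2).smul (hcst _))).add ((hF 0 3).smul (hcst _))).2]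
  apply Quaternion.ext <;> simp [qu_one, qu_two, qu_three]

theorem dR_extDer (h : IsKillingPair g U e A c₀ c₁ c₂ c₃ c₄ s t) {x : M} (hx : x ∈ U) (X : VField M) :
    dR X (extDer g e A 2 3) x = - dR X (extDer g e A 0 1) x ∧
    dR X (extDer g e A 1 3) x = dR X (extDer g e A 0 2) x ∧
    dR X (extDer g e A 1 2) x = - dR X (extDer g e A 0 3) x := by
  have hU := h.isOpen.mem_nhds hx
  refine ⟨?_, dir_congr (Filter.eventually_of_mem hU fun y hy => (h.asd y hy).2.1), ?_⟩
  · rw [← dR_neg]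
    exact dir_congr (Filter.eventually_of_mem hU fun y hy => (h.asd y hy).1)
  · rw [← dR_neg]
    exact dir_congr (Filter.eventually_of_mem hU fun y hy => (h.asd y hy).2.2)

/-- A closed anti-self-dual form is also coclosed. The four quaternion components of the sum are, up
to sign, the four components of dF = 0. -/
theorem maxwell_equation (h : IsKillingPair g U e A c₀ c₁ c₂ c₃ c₄ s t) {x : M} (hx : x ∈ U) :
    ∑ a, nablaMaxwell g e A a x * qu a = 0 := by
  have hcl := h.frame.extDer_closed h.isOpen h.smooth_A hx
  have hs : ∀ (X : VField M) a b, dR X (extDer g e A a b) x = - dR X (extDer g e A b a) x := by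
    intro X a b
    rw [← dR_neg]
    congr 1
    funext y
    exact extDer_swap g e A a b y
  have h1 := hcl 0 1 2
  have h2 := hcl 0 1 3
  have h3 := hcl 0 2 3
  have h4 := hcl 1 2 3
  obtain ⟨a1, a2, a3⟩ := h.asd x hx
  have d := fun a => h.dR_extDer hx (e a)
  have sk := extDer_swap g e A
  have dg : ∀ a, extDer g e A a a x = 0 := fun a => by linarith [sk a a x]
  have wd : ∀ a b, leviCivita g e a b b x = 0 := fun a b => by linarith [leviCivita_swap g e a b b x]
  simp only [hs _ 2 0, hs _ 3 0, hs _ 3 1, (d _).1, (d _).2.1, (d _).2.2, Fin.sum_univ_four, dg,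
    sk 1 0, sk 2 0, sk 3 0, sk 2 1, sk 3 1, sk 3 2, a1, a2, a3, structFun_eq, wd,
    leviCivita_swap g e _ 1 0, leviCivita_swap g e _ 2 0, leviCivita_swap g e _ 3 0,
    leviCivita_swap g e _ 2 1, leviCivita_swap g e _ 3 1, leviCivita_swap g e _ 3 2] at h1 h2 h3 h4
  simp only [Fin.sum_univ_four, nablaMaxwell, h.dir_maxwell hx, gam,
    rho_eq (leviCivita_swap g e _ · · x), maxwell, asdQuat, qu_zero, qu_one, qu_two, qu_three]
  apply Quaternion.ext <;> simp [Quaternion.re_zero, Quaternion.imI_zero, Quaternion.imJ_zero, Quaternion.imK_zero]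
  · linear_combination h4
  · linear_combination -h1
  · linear_combination -h2
  · linear_combination h3

end IsKillingPair

end

/-! ### Translation of spinor components into quaternions. -/

section

theorem mulVec_two (N : Matrix (Fin 2) (Fin 2) ℂ) (v : Fin 2 → ℂ) (C : Fin 2) :
    N.mulVec v C = N C 0 * v 0 + N C 1 * v 1 := by
  simp [Matrix.mulVec, dotProduct, Fin.sum_univ_two]

theorem toH_matrix_asdQuat (F : Fin 4 → Fin 4 → ℝ) (v : Fin 2 → ℂ) :
    toH (((F 0 1 : ℂ) • quat 1 + (F 0 2 : ℂ) • quat 2 + (F 0 3 : ℂ) • quat 3).mulVec v) =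
      asdQuat F * toH v := by
  simp only [Matrix.add_mulVec, Matrix.smul_mulVec, toH_add, toH_smul_real, toH_quat]
  rw [← smul_mul_assoc, ← smul_mul_assoc, ← smul_mul_assoc, ← add_mul, ← add_mul]
  congr 1
  unfold asdQuat
  apply Quaternion.ext <;> simp [qu_one, qu_two, qu_three]

theorem kap_mul_kap_complex : (kap : ℂ) * kap = 1 / 2 := by
  rw [← Complex.ofReal_mul, kap_mul_kap]; norm_num

theorem solder_eq (a : Fin 4) (B B' : Fin 2) : solder a B B' = (kap : ℂ) * quat a B B' := by
  unfold solder kap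
  rw [one_div]

/-- Inversion of the soldering symbols. -/
theorem eq_of_sum_solder {X : Fin 4 → ℂ} {r : Fin 2 → Fin 2 → ℂ}
    (h : ∀ B B', ∑ a, solder a B B' * X a = r B B') (a : Fin 4) :
    X a = kap * ∑ B, ∑ B', (starRingEnd ℂ) (quat a B B') * r B B' := by
  have h00 := h 0 0
  have h01 := h 0 1
  have h10 := h 1 0
  have h11 := h 1 1
  simp [solder_eq, Fin.sum_univ_four, quat] at h00 h01 h10 h11
  have hI := Complex.I_sq
  have hk := kap_mul_kap_complex
  fin_cases a <;> simp [Fin.sum_univ_two, quat, ← h00, ← h01, ← h10, ← h11] <;>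
    ring_nf <;> (try simp only [Complex.I_sq])
  · linear_combination (-2 * X 0) * hk
  · linear_combination (-2 * X 1) * hk
  · linear_combination (-2 * X 2) * hk
  · linear_combination (-2 * X 3) * hk

theorem toH_killing {X : Fin 4 → Fin 2 → ℂ} {F : Fin 4 → Fin 4 → ℝ} (hF : ∀ a b, F a b = - F b a)
    (hasd : ∀ a b, hodge F a b = - F a b) {c₁ c₂ : ℂ} {v : Fin 2 → ℂ}
    (h : ∀ B B' C, ∑ a, solder a B B' * X a C
      + (c₁ * twoFormSpinor F B C + c₂ * eps B C) * v B' = 0) (a : Fin 4) :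
    toH (X a) = kap • (asdQuat F * (qu a * (toH (eps.mulVec v) * c₁))
      + qu a * (toH (eps.mulVec v) * c₂)) := by
  have h1 : X a = (kap : ℂ) • ((c₁ • (((F 0 1 : ℂ) • quat 1 + (F 0 2 : ℂ) • quat 2
      + (F 0 3 : ℂ) • quat 3).mulVec ((quat a).mulVec (eps.mulVec v)))) +
      c₂ • ((quat a).mulVec (eps.mulVec v))) := by
    funext C
    have h2 := eq_of_sum_solder (X := fun a => X a C)
      (r := fun B B' => -((c₁ * twoFormSpinor F B C + c₂ * eps B C) * v B'))
      (fun B B' => eq_neg_of_add_eq_zero_left (h B B' C)) a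
    rw [h2]
    simp only [twoFormSpinor_eq hF hasd, Pi.add_apply, Pi.smul_apply, mulVec_two, smul_eq_mul,
      Matrix.add_apply, Matrix.smul_apply, Fin.sum_univ_two]
    fin_cases a <;> fin_cases C <;> simp [quat, eps, Matrix.one_apply] <;>
      ring_nf <;> simp
  rw [h1, toH_smul_real, toH_add, toH_smul, toH_smul, toH_matrix_asdQuat, toH_quat]
  simp only [mul_assoc]

/-- Contraction with ε intertwines transposes and adjoints of quaternionic matrices, ε Nᵀ = N† ε.
This is why primed spinors are read as `toH (eps.mulVec v)`: the connection on 𝕊' then also acts by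
left multiplication. -/
theorem eps_mulVec_quat_transpose (b c : Fin 4) (v : Fin 2 → ℂ) :
    eps.mulVec (((quat b).conjTranspose * quat c).transpose.mulVec v) =
      (quat c).conjTranspose.mulVec ((quat b).mulVec (eps.mulVec v)) := by
  rw [Matrix.mulVec_mulVec, Matrix.mulVec_mulVec, Matrix.mulVec_mulVec]
  congr 1
  have h1 : ∀ c, eps * (quat c).transpose = (quat c).conjTranspose * eps := by
    intro c
    ext i j
    fin_cases c <;> fin_cases i <;> fin_cases j <;> simp [eps, quat, Matrix.mul_apply,
      Fin.sum_univ_two, Matrix.conjTranspose_apply, Matrix.one_apply]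
  have h2 : ∀ c, eps * (quat c).conjTranspose.transpose = quat c * eps := by
    intro c
    ext i j
    fin_cases c <;> fin_cases i <;> fin_cases j <;> simp [eps, quat, Matrix.mul_apply,
      Fin.sum_univ_two, Matrix.conjTranspose_apply, Matrix.one_apply]
  rw [Matrix.transpose_mul, ← mul_assoc, h1, mul_assoc, h2, mul_assoc]

theorem toH_killing' {X : Fin 4 → Fin 2 → ℂ} {c₄ : ℂ} {v : Fin 2 → ℂ}
    (h : ∀ B B' C, ∑ a, solder a B B' * X a C + c₄ * eps B' C * v B = 0) (a : Fin 4) :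
    toH (eps.mulVec (X a)) = -(kap • (star (qu a) * (toH v * c₄))) := by
  have h1 : eps.mulVec (X a) = (kap : ℂ) • (-(1 : ℝ) : ℂ) • c₄ • ((quat a).conjTranspose.mulVec v) := by
    have h2 := fun C => eq_of_sum_solder (X := fun a => X a C)
      (r := fun B B' => -(c₄ * eps B' C * v B))
      (fun B B' => eq_neg_of_add_eq_zero_left (h B B' C)) a
    have h3 : X a = fun C => X a C := rfl
    rw [h3]
    simp only [h2]
    funext C
    simp only [Pi.smul_apply, mulVec_two, smul_eq_mul, Fin.sum_univ_two]
    fin_cases a <;> fin_cases C <;>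
      simp [quat, eps, Matrix.conjTranspose_apply] <;> ring_nf <;> simp
  rw [h1, toH_smul_real, ← Complex.ofReal_neg, toH_smul_real, toH_smul, toH_quat_star]
  simp [mul_assoc]

variable {M : Type*} [TopologicalSpace M] [ChartedSpace E4 M]

theorem contMDiffOn_comp {U : Set M} {f : M → Fin 2 → ℂ}
    (hf : ∀ A, ContMDiffOn 𝓘(ℝ, E4) 𝓘(ℝ, ℂ) ∞ (fun x => f x A) U) :
    ContMDiffOn 𝓘(ℝ, E4) 𝓘(ℝ, Fin 2 → ℂ) ∞ f U := contMDiffOn_pi_space.2 hf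

theorem dir_toH (X : VField M) {f : M → Fin 2 → ℂ} {x : M}
    (hf : MDifferentiableAt 𝓘(ℝ, E4) 𝓘(ℝ, Fin 2 → ℂ) f x) :
    dir X (fun y => toH (f y)) x = toH fun C => dC X (fun y => f y C) x := by
  rw [← toHL_apply]
  refine (dir_comp_clm X toHL hf).trans ?_
  congr 1
  funext C
  exact dir_pi X hf C

variable [IsManifold 𝓘(ℝ, E4) ∞ M]
variable {g : Metric4 M} {e : Fin 4 → VField M}

theorem toH_spinConn (g : Metric4 M) (e : Fin 4 → VField M) (a : Fin 4) (x : M) (v : Fin 2 → ℂ) :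
    toH ((spinConn g e a x).mulVec v) = gam g e a x * toH v := by
  have h4 : (1 / 4 : ℂ) = ((1 / 4 : ℝ) : ℂ) := by norm_num
  unfold spinConn gam rho
  rw [h4, Matrix.smul_mulVec, toH_smul_real, smul_mul_assoc, ← toHL_apply]
  simp only [Matrix.sum_mulVec, map_sum, Finset.sum_mul, toHL_apply]
  congr 1
  refine Finset.sum_congr rfl fun b _ => Finset.sum_congr rfl fun c _ => ?_
  rw [Matrix.smul_mulVec, toH_smul_real, ← Matrix.mulVec_mulVec, toH_quat, toH_quat_star,
    smul_mul_assoc, mul_assoc]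

theorem toH_spinConn' (g : Metric4 M) (e : Fin 4 → VField M) (a : Fin 4) (x : M) (v : Fin 2 → ℂ) :
    toH (eps.mulVec ((spinConn' g e a x).mulVec v)) = gam' g e a x * toH (eps.mulVec v) := by
  have h4 : (1 / 4 : ℂ) = ((1 / 4 : ℝ) : ℂ) := by norm_num
  unfold spinConn' gam' rho'
  rw [h4, Matrix.smul_mulVec, Matrix.mulVec_smul, toH_smul_real, smul_mul_assoc, ← toHL_apply]
  simp only [Matrix.transpose_sum, Matrix.sum_mulVec, Matrix.mulVec_sum, map_sum, Finset.sum_mul,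
    toHL_apply]
  congr 1
  refine Finset.sum_congr rfl fun b _ => Finset.sum_congr rfl fun c _ => ?_
  rw [Matrix.transpose_smul, Matrix.smul_mulVec, Matrix.mulVec_smul, toH_smul_real,
    eps_mulVec_quat_transpose, toH_quat_star, toH_quat, smul_mul_assoc, mul_assoc]

/-- Contraction with `ε` as a continuous real-linear map. -/
def epsL : (Fin 2 → ℂ) →L[ℝ] (Fin 2 → ℂ) :=
  LinearMap.toContinuousLinearMap (eps.mulVecLin.restrictScalars ℝ)

variable {S : SpinStructure g}

/-- The quaternion valued function of an unprimed spinor field in a frame. -/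
def Spinor.toH (α : Spinor S) (i : S.ι) (x : M) : ℍ[ℝ] := KillingSpinor.toH (α.comp i x)

/-- The quaternion valued function of a primed spinor field in a frame. -/
def Spinor'.toH (β : Spinor' S) (i : S.ι) (x : M) : ℍ[ℝ] :=
  KillingSpinor.toH (eps.mulVec (β.comp i x))

theorem isKillingPair {A : Π x : M, TangentSpace 𝓘(ℝ, E4) x →L[ℝ] ℝ} (hA : IsSmoothOneForm A)
    (hASD : S.IsFieldASD A) {c₀ c₁ c₂ c₃ c₄ : ℂ} {α : Spinor S} {β : Spinor' S}
    (h : S.KillingSpinorEquations A c₀ c₁ c₂ c₃ c₄ α β) (i : S.ι) :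
    IsKillingPair g (S.U i) (S.e i) (S.pot A i) c₀ c₁ c₂ c₃ c₄ (α.toH i) (β.toH i) := by
  have hα := contMDiffOn_comp (α.smooth i)
  have hβ := contMDiffOn_comp (β.smooth i)
  have hsw : ∀ x a b, S.field A i a b x = - S.field A i b a x := fun x a b =>
    extDer_swap g (S.e i) (S.pot A i) a b x
  refine ⟨S.isOpen_U i, S.frame i, fun a => (S.frame i).contMDiffOn_pot (S.isOpen_U i) hA a,
    toHL.contMDiff.comp_contMDiffOn hα, (toHL.comp epsL).contMDiff.comp_contMDiffOn hβ,
    fun x hx => hodge_asd (hsw x) (hASD i x hx), fun x hx a => ?_, fun x hx a => ?_⟩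
  · have hd := mdifferentiableAt_of_contMDiffOn (S.isOpen_U i) hα hx
    have h1 := toH_killing (X := fun a C => S.nabla α i a C x + c₀ * S.pot A i a x * α.comp i x C)
      (c₁ := c₁) (c₂ := c₂) (v := β.comp i x) (hsw x) (hASD i x hx) (fun B B' C => by
        rw [← (h i x hx B B' C).1]
        simp only [SpinStructure.nablaSpinor, SpinStructure.potSpinor, SpinStructure.fieldSpinor,
          mul_add, Finset.sum_add_distrib, Finset.mul_sum, Finset.sum_mul]
        congr 2
        refine Finset.sum_congr rfl fun a _ => ?_
        ring) a
    have h2 : (fun C => S.nabla α i a C x + c₀ * S.pot A i a x * α.comp i x C) =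
        (fun C => dC (S.e i a) (fun y => α.comp i y C) x)
        + (spinConn g (S.e i) a x).mulVec (α.comp i x)
        + ((S.pot A i a x : ℝ) : ℂ) • c₀ • α.comp i x := by
      funext C
      simp only [SpinStructure.nabla, Pi.add_apply, Pi.smul_apply, smul_eq_mul]
      ring
    rw [h2, toH_add, toH_add, toH_smul_real, toH_smul, toH_spinConn, ← dir_toH _ hd] at h1
    exact (eq_sub_of_add_eq h1).trans (by rw [sub_eq_neg_add]; rfl)
  · have hd := mdifferentiableAt_of_contMDiffOn (S.isOpen_U i) hβ hx
    have h1 := toH_killing' (X := fun a C => S.nabla' β i a C x + c₃ * S.pot A i a x * β.comp i x C)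
      (c₄ := c₄) (v := α.comp i x) (fun B B' C => by
        rw [← (h i x hx B B' C).2]
        simp only [SpinStructure.nablaSpinor', SpinStructure.potSpinor,
          mul_add, Finset.sum_add_distrib, Finset.mul_sum, Finset.sum_mul]
        congr 2
        refine Finset.sum_congr rfl fun a _ => ?_
        ring) a
    have h2 : (fun C => S.nabla' β i a C x + c₃ * S.pot A i a x * β.comp i x C) =
        (fun C => dC (S.e i a) (fun y => β.comp i y C) x)
        + (spinConn' g (S.e i) a x).mulVec (β.comp i x)
        + ((S.pot A i a x : ℝ) : ℂ) • c₃ • β.comp i x := by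
      funext C
      simp only [SpinStructure.nabla', Pi.add_apply, Pi.smul_apply, smul_eq_mul]
      ring
    have h3 : dir (S.e i a) (β.toH i) x =
        toH (eps.mulVec fun C => dC (S.e i a) (fun y => β.comp i y C) x) := by
      refine (dir_comp_clm _ (toHL.comp epsL) hd).trans ?_
      change toH (eps.mulVec _) = _
      congr 2
      funext C
      exact dir_pi _ hd C
    rw [h2, Matrix.mulVec_add, Matrix.mulVec_add, Matrix.mulVec_smul, Matrix.mulVec_smul, toH_add,
      toH_add, toH_smul_real, toH_smul, toH_spinConn', ← h3] at h1
    exact (eq_sub_of_add_eq h1).trans (by rw [sub_eq_add_neg, add_comm, ← sub_eq_add_neg]; rfl)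

end

section

/-! ### Contractions with the self-dual and anti-self-dual two-forms -/

/-- The imaginary units. -/
def qi (i : Fin 3) : ℍ[ℝ] := qu i.succ

theorem qi_zero : qi 0 = mkH 0 0 0 (-1) := rfl
theorem qi_one : qi 1 = mkH 0 0 (-1) 0 := rfl
theorem qi_two : qi 2 = mkH 0 1 0 0 := rfl

/-- Contraction with a basis of the self-dual two-forms. -/
def sdPart {V : Type*} [AddCommGroup V] (i : Fin 3) (T : Fin 4 → Fin 4 → V) : V :=
  ![T 0 1 + T 2 3, T 0 2 - T 1 3, T 0 3 + T 1 2] i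

/-- Contraction with a basis of the anti-self-dual two-forms. -/
def asdPart {V : Type*} [AddCommGroup V] (i : Fin 3) (T : Fin 4 → Fin 4 → V) : V :=
  ![T 0 1 - T 2 3, T 0 2 + T 1 3, T 0 3 - T 1 2] i

section

variable {V W : Type*} [AddCommGroup V] [AddCommGroup W]

theorem sd_add (i : Fin 3) (T T' : Fin 4 → Fin 4 → V) :
    sdPart i (fun a b => T a b + T' a b) = sdPart i T + sdPart i T' := by
  fin_cases i <;> simp [sdPart] <;> abel

theorem sd_sub (i : Fin 3) (T T' : Fin 4 → Fin 4 → V) :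
    sdPart i (fun a b => T a b - T' a b) = sdPart i T - sdPart i T' := by
  fin_cases i <;> simp [sdPart] <;> abel

theorem sd_neg (i : Fin 3) (T : Fin 4 → Fin 4 → V) :
    sdPart i (fun a b => - T a b) = - sdPart i T := by
  fin_cases i <;> simp [sdPart] <;> abel

theorem sd_map (L : V →+ W) (i : Fin 3) (T : Fin 4 → Fin 4 → V) :
    sdPart i (fun a b => L (T a b)) = L (sdPart i T) := by
  fin_cases i <;> simp [sdPart]

theorem asd_add (i : Fin 3) (T T' : Fin 4 → Fin 4 → V) :
    asdPart i (fun a b => T a b + T' a b) = asdPart i T + asdPart i T' := by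
  fin_cases i <;> simp [asdPart] <;> abel

theorem asd_sub (i : Fin 3) (T T' : Fin 4 → Fin 4 → V) :
    asdPart i (fun a b => T a b - T' a b) = asdPart i T - asdPart i T' := by
  fin_cases i <;> simp [asdPart] <;> abel

theorem asd_neg (i : Fin 3) (T : Fin 4 → Fin 4 → V) :
    asdPart i (fun a b => - T a b) = - asdPart i T := by
  fin_cases i <;> simp [asdPart] <;> abel

theorem asd_map (L : V →+ W) (i : Fin 3) (T : Fin 4 → Fin 4 → V) :
    asdPart i (fun a b => L (T a b)) = L (asdPart i T) := by
  fin_cases i <;> simp [asdPart]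

theorem sd_mul (i : Fin 3) (T : Fin 4 → Fin 4 → ℍ[ℝ]) (q : ℍ[ℝ]) :
    sdPart i (fun a b => T a b * q) = sdPart i T * q := sd_map (AddMonoidHom.mulRight q) i T

theorem asd_mul (i : Fin 3) (T : Fin 4 → Fin 4 → ℍ[ℝ]) (q : ℍ[ℝ]) :
    asdPart i (fun a b => T a b * q) = asdPart i T * q := asd_map (AddMonoidHom.mulRight q) i T

theorem mul_sd (i : Fin 3) (T : Fin 4 → Fin 4 → ℍ[ℝ]) (q : ℍ[ℝ]) :
    sdPart i (fun a b => q * T a b) = q * sdPart i T := sd_map (AddMonoidHom.mulLeft q) i T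

theorem mul_asd (i : Fin 3) (T : Fin 4 → Fin 4 → ℍ[ℝ]) (q : ℍ[ℝ]) :
    asdPart i (fun a b => q * T a b) = q * asdPart i T := asd_map (AddMonoidHom.mulLeft q) i T

theorem sd_smul (i : Fin 3) (T : Fin 4 → Fin 4 → ℍ[ℝ]) (k : ℝ) :
    sdPart i (fun a b => k • T a b) = k • sdPart i T := sd_map (DistribSMul.toAddMonoidHom ℍ[ℝ] k) i T

theorem asd_smul (i : Fin 3) (T : Fin 4 → Fin 4 → ℍ[ℝ]) (k : ℝ) :
    asdPart i (fun a b => k • T a b) = k • asdPart i T := asd_map (DistribSMul.toAddMonoidHom ℍ[ℝ] k) i T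

theorem sd_smul_const (i : Fin 3) (F : Fin 4 → Fin 4 → ℝ) (q : ℍ[ℝ]) :
    sdPart i (fun a b => F a b • q) = sdPart i F • q := sd_map ((smulAddHom ℝ ℍ[ℝ]).flip q) i F

theorem asd_smul_const (i : Fin 3) (F : Fin 4 → Fin 4 → ℝ) (q : ℍ[ℝ]) :
    asdPart i (fun a b => F a b • q) = asdPart i F • q := asd_map ((smulAddHom ℝ ℍ[ℝ]).flip q) i F

end

theorem IsASDForm.sd_eq {F : Fin 4 → Fin 4 → ℝ} (h : IsASDForm F) (i : Fin 3) : sdPart i F = 0 := by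
  obtain ⟨h1, h2, h3⟩ := h
  fin_cases i <;> simp [sdPart, h1, h2, h3]

theorem IsASDForm.asd_eq {F : Fin 4 → Fin 4 → ℝ} (h : IsASDForm F) (i : Fin 3) :
    asdPart i F = 2 * F 0 i.succ := by
  obtain ⟨h1, h2, h3⟩ := h
  fin_cases i <;> simp [asdPart, h1, h2, h3] <;> ring

theorem rho_eq_sum {X : Fin 4 → Fin 4 → ℝ} (hX : ∀ a b, X a b = - X b a) :
    rho X = (1 / 2 : ℝ) • ∑ j, asdPart j X • qi j := by
  rw [rho_eq hX]
  apply Quaternion.ext <;> simp [Fin.sum_univ_three, asdPart, qi_zero, qi_one, qi_two] <;> ring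

theorem rho'_eq_sum {X : Fin 4 → Fin 4 → ℝ} (hX : ∀ a b, X a b = - X b a) :
    rho' X = -((1 / 2 : ℝ) • ∑ j, sdPart j X • qi j) := by
  rw [rho'_eq hX]
  apply Quaternion.ext <;> simp [Fin.sum_univ_three, sdPart, qi_zero, qi_one, qi_two] <;> ring

/-- The quaternion of a vector. -/
def vecQuat (A : Fin 4 → ℝ) : ℍ[ℝ] := ∑ a, A a • qu a

theorem vecQuat_eq (A : Fin 4 → ℝ) : vecQuat A = mkH (A 0) (A 3) (-A 2) (-A 1) := by
  apply Quaternion.ext <;> simp [vecQuat, Fin.sum_univ_four, qu_zero, qu_one, qu_two, qu_three]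

/-- Vectors map between the two spin spaces. In this lemma and the next three the self-dual
contraction puts `qi` on the 𝕊' side of the vector, the anti-self-dual one on the 𝕊 side. -/
theorem sd_vec_star (A : Fin 4 → ℝ) (i : Fin 3) :
    sdPart i (fun a b => A a • star (qu b) - A b • star (qu a)) = -(qi i * star (vecQuat A)) := by
  rw [vecQuat_eq]
  fin_cases i <;> apply Quaternion.ext <;>
    simp [sdPart, qi_zero, qi_one, qi_two, qu_zero, qu_one, qu_two, qu_three]

theorem asd_vec_star (A : Fin 4 → ℝ) (i : Fin 3) :
    asdPart i (fun a b => A a • star (qu b) - A b • star (qu a)) = -(star (vecQuat A) * qi i) := by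
  rw [vecQuat_eq]
  fin_cases i <;> apply Quaternion.ext <;>
    simp [asdPart, qi_zero, qi_one, qi_two, qu_zero, qu_one, qu_two, qu_three]

theorem sd_vec (A : Fin 4 → ℝ) (i : Fin 3) :
    sdPart i (fun a b => A a • qu b - A b • qu a) = vecQuat A * qi i := by
  rw [vecQuat_eq]
  fin_cases i <;> apply Quaternion.ext <;>
    simp [sdPart, qi_zero, qi_one, qi_two, qu_zero, qu_one, qu_two, qu_three]

theorem asd_vec (A : Fin 4 → ℝ) (i : Fin 3) :
    asdPart i (fun a b => A a • qu b - A b • qu a) = qi i * vecQuat A := by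
  rw [vecQuat_eq]
  fin_cases i <;> apply Quaternion.ext <;>
    simp [asdPart, qi_zero, qi_one, qi_two, qu_zero, qu_one, qu_two, qu_three]

/-- The antisymmetrized products q̄_b q_a generate the rotations of 𝕊' and are self-dual; the
products q_b q̄_a below generate those of 𝕊 and are anti-self-dual. -/
theorem sd_star_mul (i : Fin 3) :
    sdPart i (fun a b => star (qu b) * qu a - star (qu a) * qu b) = (-4 : ℝ) • qi i := by
  fin_cases i <;> apply Quaternion.ext <;>
    simp [sdPart, qi_zero, qi_one, qi_two, qu_zero, qu_one, qu_two, qu_three] <;> norm_num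

theorem asd_star_mul (i : Fin 3) :
    asdPart i (fun a b => star (qu b) * qu a - star (qu a) * qu b) = 0 := by
  fin_cases i <;> apply Quaternion.ext <;>
    simp [asdPart, qu_zero, qu_one, qu_two, qu_three]

theorem sd_mul_star (i : Fin 3) :
    sdPart i (fun a b => qu b * star (qu a) - qu a * star (qu b)) = 0 := by
  fin_cases i <;> apply Quaternion.ext <;>
    simp [sdPart, qu_zero, qu_one, qu_two, qu_three]

theorem asd_mul_star (i : Fin 3) :
    asdPart i (fun a b => qu b * star (qu a) - qu a * star (qu b)) = (4 : ℝ) • qi i := by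
  fin_cases i <;> apply Quaternion.ext <;>
    simp [asdPart, qi_zero, qi_one, qi_two, qu_zero, qu_one, qu_two, qu_three] <;> norm_num

/-- For imaginary Φ the expression q̄_b Φ q_a - q̄_a Φ q_b is its own conjugate, hence real, and it
is a multiple of F itself. The c₁c₄ term of `curvature_t` therefore has the same shape as the c₃
term, and the two merge into c₃ + c₁c₄. -/
theorem sd_sandwich (F : Fin 4 → Fin 4 → ℝ) (i : Fin 3) :
    sdPart i (fun a b => star (qu b) * (asdQuat F * qu a) - star (qu a) * (asdQuat F * qu b)) = 0 := by
  fin_cases i <;> apply Quaternion.ext <;>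
    simp [sdPart, asdQuat, qu_zero, qu_one, qu_two, qu_three]

theorem asd_sandwich (F : Fin 4 → Fin 4 → ℝ) (i : Fin 3) :
    asdPart i (fun a b => star (qu b) * (asdQuat F * qu a) - star (qu a) * (asdQuat F * qu b)) =
      ((4 * F 0 i.succ : ℝ) : ℍ[ℝ]) := by
  fin_cases i <;> apply Quaternion.ext <;>
    simp [asdPart, asdQuat, qu_zero, qu_one, qu_two, qu_three] <;> ring

/-- With N = ∇Φ the right side contains the Maxwell divergence, so ∇Φ drops out of the self-dual
contraction of `curvature_s`. -/
theorem sd_vec_quat (N : Fin 4 → ℍ[ℝ]) (i : Fin 3) :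
    sdPart i (fun a b => N a * qu b - N b * qu a) = (∑ a, N a * qu a) * qi i := by
  fin_cases i <;> apply Quaternion.ext <;>
    simp [sdPart, Fin.sum_univ_four, qi_zero, qi_one, qi_two, qu_zero, qu_one, qu_two, qu_three] <;> ring

/-- The anti-self-dual contraction of ∇Φ need not vanish, but its trace against the units does,
again by the Maxwell equation. -/
theorem sum_qi_asd_vec_quat {N : Fin 4 → ℍ[ℝ]} (hN : ∀ a, (N a).re = 0)
    (h : ∑ a, N a * qu a = 0) :
    ∑ i, qi i * asdPart i (fun a b => N a * qu b - N b * qu a) = 0 := by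
  have h0 := congrArg (fun q : ℍ[ℝ] => q.re) h
  have h1 := congrArg (fun q : ℍ[ℝ] => q.imI) h
  have h2 := congrArg (fun q : ℍ[ℝ] => q.imJ) h
  have h3 := congrArg (fun q : ℍ[ℝ] => q.imK) h
  simp [Fin.sum_univ_four, hN, qu_zero, qu_one, qu_two, qu_three, Quaternion.re_zero,
    Quaternion.imI_zero, Quaternion.imJ_zero, Quaternion.imK_zero] at h0 h1 h2 h3
  apply Quaternion.ext <;>
    simp [asdPart, Fin.sum_univ_three, hN, qi_zero, qi_one, qi_two, qu_zero, qu_one, qu_two, qu_three,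
      Quaternion.re_zero, Quaternion.imI_zero, Quaternion.imJ_zero, Quaternion.imK_zero]
  · linarith
  · linarith
  · linarith
  · linarith

theorem sum_qi_mul_qi (q : ℍ[ℝ]) : ∑ i, qi i * (qi i * q) = (-3 : ℝ) • q := by
  apply Quaternion.ext <;> simp [Fin.sum_univ_three, qi_zero, qi_one, qi_two] <;> ring

theorem sum_qi_sandwich (F : Fin 4 → Fin 4 → ℝ) (q : ℍ[ℝ]) :
    ∑ i, qi i * (asdQuat F * (qi i * q)) = asdQuat F * q := by
  apply Quaternion.ext <;> simp [asdQuat, Fin.sum_univ_three, qi_zero, qi_one, qi_two] <;> ring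

theorem sum_smul_qi (F : Fin 4 → Fin 4 → ℝ) : ∑ i, F 0 (Fin.succ i) • qi i = asdQuat F := by
  apply Quaternion.ext <;> simp [asdQuat, Fin.sum_univ_three, qi_zero, qi_one, qi_two]

end

/-! ### Blocks of the curvature operator and the pointwise integrability conditions. -/

section

/-- The symmetries of a Riemann tensor. -/
structure IsCurvature (R : Fin 4 → Fin 4 → Fin 4 → Fin 4 → ℝ) : Prop where
  left : ∀ a b c d, R a b c d = - R b a c d
  right : ∀ a b c d, R a b c d = - R a b d c
  bianchi : ∀ a b c d, R a b c d + R b c a d + R c a b d = 0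

/-- The self-dual block of a curvature tensor. -/
def pp (R : Fin 4 → Fin 4 → Fin 4 → Fin 4 → ℝ) (i j : Fin 3) : ℝ :=
  (1 / 4) * sdPart i fun a b => sdPart j (R a b)

/-- The mixed block of a curvature tensor. -/
def pm (R : Fin 4 → Fin 4 → Fin 4 → Fin 4 → ℝ) (i j : Fin 3) : ℝ :=
  (1 / 4) * sdPart i fun a b => asdPart j (R a b)

/-- The anti-self-dual block of a curvature tensor. -/
def mm (R : Fin 4 → Fin 4 → Fin 4 → Fin 4 → ℝ) (i j : Fin 3) : ℝ :=
  (1 / 4) * asdPart i fun a b => asdPart j (R a b)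

namespace IsCurvature

variable {R : Fin 4 → Fin 4 → Fin 4 → Fin 4 → ℝ}

/-- The classical combination of four first Bianchi identities. -/
theorem pair (h : IsCurvature R) (a b c d : Fin 4) : R a b c d = R c d a b := by
  linarith [h.bianchi a b c d, h.bianchi b c d a, h.bianchi c d a b, h.bianchi d a b c,
    h.left a b c d, h.left b c a d, h.left c a b d, h.left c d b a, h.left d b c a,
    h.left d a c b, h.left a c d b, h.left a b d c, h.left b d a c, h.left b c d a,
    h.right a b c d, h.right b c a d, h.right c a b d, h.right c d a b, h.right b d c a,
    h.right a d b c, h.right d a b c, h.right a c b d, h.right d b a c, h.left b d c a,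
    h.left a d b c, h.left b a c d, h.right b d a c]

theorem mm_symm (h : IsCurvature R) (i j : Fin 3) : mm R i j = mm R j i := by
  fin_cases i <;> fin_cases j <;> simp [mm, asdPart] <;>
    linarith [h.pair 0 1 0 2, h.pair 0 1 1 3, h.pair 2 3 0 2, h.pair 2 3 1 3, h.pair 0 1 0 3,
      h.pair 0 1 1 2, h.pair 2 3 0 3, h.pair 2 3 1 2, h.pair 0 2 0 3, h.pair 0 2 1 2,
      h.pair 1 3 0 3, h.pair 1 3 1 2]

theorem mp_eq (h : IsCurvature R) (i j : Fin 3) :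
    (1 / 4) * asdPart i (fun a b => sdPart j (R a b)) = pm R j i := by
  have hp := h.pair
  fin_cases i <;> fin_cases j <;> simp [pm, asdPart, sdPart] <;>
    linarith [hp 0 1 2 3, hp 0 2 1 3, hp 0 3 1 2, hp 0 1 0 2, hp 0 1 1 3, hp 2 3 0 2, hp 2 3 1 3,
      hp 0 1 0 3, hp 0 1 1 2, hp 2 3 0 3, hp 2 3 1 2, hp 0 2 0 3, hp 0 2 1 2,
      hp 1 3 0 3, hp 1 3 1 2]

/-- The difference of the traces is a multiple of R₀₁₂₃ + R₁₂₀₃ + R₂₀₁₃, up to pair symmetry. -/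
theorem trace_mm (h : IsCurvature R) : ∑ i, mm R i i = ∑ i, pp R i i := by
  simp [mm, pp, asdPart, sdPart, Fin.sum_univ_three]
  linarith [h.bianchi 0 1 2 3, h.pair 0 1 2 3, h.pair 0 2 1 3, h.pair 0 3 1 2, h.left 2 0 1 3,
    h.pair 1 2 0 3]

end IsCurvature

theorem sd_comm (i j : Fin 3) (R : Fin 4 → Fin 4 → Fin 4 → Fin 4 → ℝ) :
    sdPart j (fun c d => sdPart i fun a b => R a b c d) = sdPart i fun a b => sdPart j (R a b) := by
  fin_cases i <;> fin_cases j <;> simp [sdPart] <;> ring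

theorem sd_asd_comm (i j : Fin 3) (R : Fin 4 → Fin 4 → Fin 4 → Fin 4 → ℝ) :
    sdPart j (fun c d => asdPart i fun a b => R a b c d) = asdPart i fun a b => sdPart j (R a b) := by
  fin_cases i <;> fin_cases j <;> simp [sdPart, asdPart] <;> ring

theorem asd_sd_comm (i j : Fin 3) (R : Fin 4 → Fin 4 → Fin 4 → Fin 4 → ℝ) :
    asdPart j (fun c d => sdPart i fun a b => R a b c d) = sdPart i fun a b => asdPart j (R a b) := by
  fin_cases i <;> fin_cases j <;> simp [sdPart, asdPart] <;> ring

theorem asd_comm (i j : Fin 3) (R : Fin 4 → Fin 4 → Fin 4 → Fin 4 → ℝ) :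
    asdPart j (fun c d => asdPart i fun a b => R a b c d) = asdPart i fun a b => asdPart j (R a b) := by
  fin_cases i <;> fin_cases j <;> simp [asdPart] <;> ring

/-- The contracted integrability conditions of the Killing spinor equations at a point. -/
structure IntegrabilityConditions (R : Fin 4 → Fin 4 → Fin 4 → Fin 4 → ℝ) (F : Fin 4 → Fin 4 → ℝ)
    (a s t : ℍ[ℝ]) (c₀ c₁ c₂ c₃ c₄ D : ℂ) : Prop where
  eb : ∀ i, (∑ j, pp R i j • qi j) * t =
    -(qi i * (t * (c₂ * c₄ : ℂ))) + qi i * (star a * (s * (D * c₄ : ℂ)))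
  nb : ∀ j, (∑ i, pm R i j • qi i) * t =
    F 0 j.succ • (t * (c₃ + c₁ * c₄ : ℂ)) + star a * (qi j * (s * (D * c₄ : ℂ)))
  ea : ∀ i, (∑ j, pm R i j • qi j) * s =
    asdQuat F * (a * (qi i * (t * (c₁ * D : ℂ)))) + a * (qi i * (t * (c₂ * D : ℂ)))
  na : -((∑ i, pp R i i) • s) = -(asdQuat F * (s * c₀)) + asdQuat F * (a * (t * (c₁ * D : ℂ)))
    - (3 : ℝ) • (a * (t * (c₂ * D : ℂ))) - asdQuat F * (s * (c₁ * c₄ : ℂ))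
    + (3 : ℝ) • (s * (c₂ * c₄ : ℂ))


variable {M : Type*} [TopologicalSpace M] [ChartedSpace E4 M] [IsManifold 𝓘(ℝ, E4) ∞ M]
variable {g : Metric4 M} {U : Set M} {e : Fin 4 → VField M}
variable {A : Fin 4 → M → ℝ} {c₀ c₁ c₂ c₃ c₄ : ℂ} {s t : M → ℍ[ℝ]}

theorem IsOrthonormalFrame.isCurvature (he : IsOrthonormalFrame g U e) (hU : IsOpen U) {x : M}
    (hx : x ∈ U) : IsCurvature fun a b c d => riemann g e a b c d x :=
  ⟨fun a b c d => riemann_swap_left g e a b c d x, fun a b c d => riemann_swap_right g e a b c d x,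
    fun a b c d => he.riemann_bianchi hU hx a b c d⟩

theorem re_nablaMaxwell (h : IsKillingPair g U e A c₀ c₁ c₂ c₃ c₄ s t) {x : M} (hx : x ∈ U)
    (a : Fin 4) : (nablaMaxwell g e A a x).re = 0 := by
  unfold nablaMaxwell
  rw [h.dir_maxwell hx]
  simp [gam, rho_eq (leviCivita_swap g e a · · x), maxwell, asdQuat]
  ring

/-- The self-dual and anti-self-dual contractions of `curvature_t` give `eb` and `nb`, and the
self-dual contraction of `curvature_s` gives `ea`. The remaining contraction contains the
anti-self-dual Weyl tensor and ∇Φ; only its trace against the units is kept, as `na`. -/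
theorem IsKillingPair.integrabilityConditions (h : IsKillingPair g U e A c₀ c₁ c₂ c₃ c₄ s t)
    {x : M} (hx : x ∈ U) :
    IntegrabilityConditions (fun a b c d => riemann g e a b c d x)
      (fun a b => extDer g e A a b x) (vecQuat fun a => A a x) (s x) (t x) c₀ c₁ c₂ c₃ c₄
      ((kap / 2 : ℝ) * (c₀ - c₃)) := by
  have hR := h.frame.isCurvature h.isOpen hx
  have hF := h.asd x hx
  set R := fun a b c d => riemann g e a b c d x with hRdef
  set F := fun a b => extDer g e A a b x with hFdef
  have hΦ : maxwell g e A x = asdQuat F := rfl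
  have skr : ∀ i c d, sdPart i (fun a b => R a b c d) = - sdPart i (fun a b => R a b d c) := by
    intro i c d
    rw [← sd_neg]; congr 1; funext a b; exact hR.right a b c d
  have skr' : ∀ i c d, asdPart i (fun a b => R a b c d) = - asdPart i (fun a b => R a b d c) := by
    intro i c d
    rw [← asd_neg]; congr 1; funext a b; exact hR.right a b c d
  have pis : ∀ i, sdPart i (fun a b => R a b) = fun c d => sdPart i fun a b => R a b c d := by
    intro i; funext c d; fin_cases i <;> simp [sdPart]
  have pia : ∀ i, asdPart i (fun a b => R a b) = fun c d => asdPart i fun a b => R a b c d := by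
    intro i; funext c d; fin_cases i <;> simp [asdPart]
  have lt : ∀ i, sdPart i (fun a b => rho' (R a b) * t x) = -((2 : ℝ) • ((∑ j, pp R i j • qi j) * t x)) := by
    intro i
    rw [sd_mul, show sdPart i (fun a b => rho' (R a b)) = rho' (sdPart i fun a b => R a b) from
      sd_map (rhoL' : (Fin 4 → Fin 4 → ℝ) →+ ℍ[ℝ]) i R, pis, rho'_eq_sum (skr i)]
    have h4 : ∀ j, sdPart j (fun c d => sdPart i fun a b => R a b c d) = 4 * pp R i j := by
      intro j
      rw [sd_comm, pp]
      ring
    simp only [h4, mul_smul, ← Finset.smul_sum]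
    simp only [neg_mul, smul_mul_assoc, smul_smul]
    norm_num
  have lt' : ∀ i, asdPart i (fun a b => rho' (R a b) * t x) = -((2 : ℝ) • ((∑ j, pm R j i • qi j) * t x)) := by
    intro i
    rw [asd_mul, show asdPart i (fun a b => rho' (R a b)) = rho' (asdPart i fun a b => R a b) from
      asd_map (rhoL' : (Fin 4 → Fin 4 → ℝ) →+ ℍ[ℝ]) i R, pia, rho'_eq_sum (skr' i)]
    have h4 : ∀ j, sdPart j (fun c d => asdPart i fun a b => R a b c d) = 4 * pm R j i := by
      intro j
      rw [sd_asd_comm, ← hR.mp_eq]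
      ring
    simp only [h4, mul_smul, ← Finset.smul_sum]
    simp only [neg_mul, smul_mul_assoc, smul_smul]
    norm_num
  have ls : ∀ i, sdPart i (fun a b => rho (R a b) * s x) = (2 : ℝ) • ((∑ j, pm R i j • qi j) * s x) := by
    intro i
    rw [sd_mul, show sdPart i (fun a b => rho (R a b)) = rho (sdPart i fun a b => R a b) from
      sd_map (rhoL : (Fin 4 → Fin 4 → ℝ) →+ ℍ[ℝ]) i R, pis, rho_eq_sum (skr i)]
    have h4 : ∀ j, asdPart j (fun c d => sdPart i fun a b => R a b c d) = 4 * pm R i j := by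
      intro j
      rw [asd_sd_comm, pm]
      ring
    simp only [h4, mul_smul, ← Finset.smul_sum]
    simp only [smul_mul_assoc, smul_smul]
    norm_num
  have ls' : ∀ i, asdPart i (fun a b => rho (R a b) * s x) = (2 : ℝ) • ((∑ j, mm R i j • qi j) * s x) := by
    intro i
    rw [asd_mul, show asdPart i (fun a b => rho (R a b)) = rho (asdPart i fun a b => R a b) from
      asd_map (rhoL : (Fin 4 → Fin 4 → ℝ) →+ ℍ[ℝ]) i R, pia, rho_eq_sum (skr' i)]
    have h4 : ∀ j, asdPart j (fun c d => asdPart i fun a b => R a b c d) = 4 * mm R i j := by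
      intro j
      rw [asd_comm, mm]
      ring
    simp only [h4, mul_smul, ← Finset.smul_sum]
    simp only [smul_mul_assoc, smul_smul]
    norm_num
  have hD : ∀ (z : ℍ[ℝ]) (c : ℂ), z * ((kap / 2 : ℝ) * (c₀ - c₃) * c : ℂ) =
      (kap / 2) • (z * ((c₀ - c₃ : ℂ) * c : ℂ)) := by
    intro z c
    rw [mul_assoc, Quaternion.coeComplex_mul, Quaternion.coeComplex_coe, ← mul_assoc,
      ← Quaternion.coe_commutes, mul_assoc, Quaternion.coe_mul_eq_smul]
  have et : ∀ a b, (rho' (R a b)) * t x = -(F a b • (t x * c₃))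
      + kap • ((A a x • star (qu b) - A b x • star (qu a)) * (s x * ((c₀ - c₃ : ℂ) * c₄ : ℂ)))
      - (kap * kap) • ((star (qu b) * (asdQuat F * qu a) - star (qu a) * (asdQuat F * qu b))
            * (t x * (c₁ * c₄ : ℂ))
          + (star (qu b) * qu a - star (qu a) * qu b) * (t x * (c₂ * c₄ : ℂ))) := by
    intro a b
    refine (h.curvature_t hx a b).trans ?_
    rw [hΦ]
    congr 2
    noncomm_ring
  have es : ∀ a b, (rho (R a b)) * s x = -(F a b • (s x * c₀))
      + kap • (asdQuat F * ((A a x • qu b - A b x • qu a) * (t x * ((c₀ - c₃ : ℂ) * c₁ : ℂ)))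
        + (A a x • qu b - A b x • qu a) * (t x * ((c₀ - c₃ : ℂ) * c₂ : ℂ)))
      + kap • ((nablaMaxwell g e A a x * qu b - nablaMaxwell g e A b x * qu a) * (t x * c₁))
      - (kap * kap) • (asdQuat F * ((qu b * star (qu a) - qu a * star (qu b))
            * (s x * (c₁ * c₄ : ℂ)))
          + (qu b * star (qu a) - qu a * star (qu b)) * (s x * (c₂ * c₄ : ℂ))) :=
    fun a b => h.curvature_s hx a b
  have hv : ∀ i, sdPart i (fun a b => A a x • star (qu b) - A b x • star (qu a)) = _ :=
    sd_vec_star fun a => A a x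
  have hv' : ∀ i, asdPart i (fun a b => A a x • star (qu b) - A b x • star (qu a)) = _ :=
    asd_vec_star fun a => A a x
  have hw : ∀ i, sdPart i (fun a b => A a x • qu b - A b x • qu a) = _ :=
    sd_vec fun a => A a x
  have hw' : ∀ i, asdPart i (fun a b => A a x • qu b - A b x • qu a) = _ :=
    asd_vec fun a => A a x
  have hN : ∀ i, sdPart i (fun a b => nablaMaxwell g e A a x * qu b - nablaMaxwell g e A b x * qu a) = 0 := by
    intro i
    rw [sd_vec_quat fun a => nablaMaxwell g e A a x, h.maxwell_equation hx, zero_mul]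
  refine ⟨fun i => ?_, fun i => ?_, fun i => ?_, ?_⟩
  · have h1 := lt i
    simp only [et] at h1
    rw [sd_sub, sd_add, sd_neg, sd_smul_const, sd_smul, sd_smul, sd_add, sd_mul, sd_mul, sd_mul,
      hF.sd_eq, sd_sandwich, sd_star_mul, hv, kap_mul_kap, zero_smul, zero_mul] at h1
    simp only [smul_mul_assoc] at h1
    rw [hD, ← sub_eq_zero]
    have h2 := congrArg (fun q => (1 / 2 : ℝ) • q) (sub_eq_zero.mpr h1)
    simp only [smul_zero] at h2
    rw [← h2]
    simp only [mul_smul_comm, neg_mul, mul_assoc]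
    module
  · have h1 := lt' i
    simp only [et] at h1
    rw [asd_sub, asd_add, asd_neg, asd_smul_const, asd_smul, asd_smul, asd_add, asd_mul, asd_mul,
      asd_mul, hF.asd_eq, asd_sandwich, asd_star_mul, hv', kap_mul_kap, zero_mul,
      Quaternion.coe_mul_eq_smul] at h1
    rw [hD, ← sub_eq_zero]
    have h2 := congrArg (fun q => (1 / 2 : ℝ) • q) (sub_eq_zero.mpr h1)
    simp only [smul_zero] at h2
    rw [← h2]
    simp only [mul_smul_comm, neg_mul, mul_assoc, Quaternion.coeComplex_add, mul_add]
    module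
  · have h1 := ls i
    simp only [es] at h1
    rw [sd_sub, sd_add, sd_add, sd_neg, sd_smul_const, sd_smul, sd_smul, sd_smul, sd_add, sd_add,
      mul_sd, mul_sd, sd_mul, sd_mul, sd_mul, sd_mul, sd_mul, hF.sd_eq,
      sd_mul_star, hw, hN, kap_mul_kap, zero_mul, zero_smul] at h1
    rw [mul_comm c₁, mul_comm c₂, hD, hD, ← sub_eq_zero]
    have h2 := congrArg (fun q => (-1 / 2 : ℝ) • q) (sub_eq_zero.mpr h1)
    simp only [smul_zero] at h2
    rw [← h2]
    simp only [mul_smul_comm, mul_assoc, zero_mul, mul_zero]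
    module
  · have h1 : ∑ i, qi i * asdPart i (fun a b => rho (R a b) * s x) = _ :=
      Finset.sum_congr rfl fun i _ => congrArg (fun q => qi i * q) (ls' i)
    -- `mm` is symmetric, so products of distinct units cancel in pairs and the squares leave minus
    -- the trace. The anti-self-dual Weyl tensor is thereby lost, and `trace_mm` brings back `pp`.
    have hmm : ∑ i, qi i * ((2 : ℝ) • ((∑ j, mm R i j • qi j) * s x)) =
        -((2 : ℝ) • (∑ i, pp R i i) • s x) := by
      rw [← hR.trace_mm]
      simp only [Fin.sum_univ_three, hR.mm_symm 1 0, hR.mm_symm 2 0, hR.mm_symm 2 1]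
      apply Quaternion.ext <;> simp [qi_zero, qi_one, qi_two] <;> ring
    have hNN := sum_qi_asd_vec_quat (N := fun a => nablaMaxwell g e A a x)
      (fun a => re_nablaMaxwell h hx a) (h.maxwell_equation hx)
    have hsw := sum_qi_sandwich F
    have hqq := sum_qi_mul_qi
    have hsF := sum_smul_qi F
    rw [hmm] at h1
    have h2 : ∀ i, asdPart i (fun a b => rho (R a b) * s x) =
        -((2 * F 0 i.succ) • (s x * c₀))
        + kap • (asdQuat F * (qi i * (vecQuat (fun a => A a x) * (t x * ((c₀ - c₃ : ℂ) * c₁ : ℂ))))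
          + qi i * (vecQuat (fun a => A a x) * (t x * ((c₀ - c₃ : ℂ) * c₂ : ℂ))))
        + kap • (asdPart i (fun a b => nablaMaxwell g e A a x * qu b
          - nablaMaxwell g e A b x * qu a) * (t x * c₁))
        - (2 : ℝ) • (asdQuat F * (qi i * (s x * (c₁ * c₄ : ℂ))) + qi i * (s x * (c₂ * c₄ : ℂ))) := by
      intro i
      simp only [es]
      rw [asd_sub, asd_add, asd_add, asd_neg, asd_smul_const, asd_smul, asd_smul, asd_smul, asd_add,
        asd_add, mul_asd, mul_asd, asd_mul, asd_mul, asd_mul, asd_mul, asd_mul, hF.asd_eq,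
        asd_mul_star, hw', kap_mul_kap]
      simp only [smul_mul_assoc, mul_smul_comm, mul_assoc]
      module
    simp only [h2, mul_add, mul_sub, mul_neg, Finset.sum_add_distrib, Finset.sum_sub_distrib,
      Finset.sum_neg_distrib, mul_smul_comm, smul_add, ← Finset.smul_sum, hsw, hqq] at h1
    simp only [← mul_assoc (qi _) (asdPart _ _), ← Finset.sum_mul, hNN, zero_mul, mul_smul,
      ← Finset.smul_sum] at h1
    have h3 : ∑ i, F 0 (Fin.succ i) • (qi i * (s x * c₀)) = asdQuat F * (s x * c₀) := by
      rw [← hsF, Finset.sum_mul]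
      simp only [smul_mul_assoc]
    rw [h3] at h1
    rw [mul_comm c₁, mul_comm c₂, hD, hD, ← sub_eq_zero]
    have h5 := congrArg (fun q => (-1 / 2 : ℝ) • q) (sub_eq_zero.mpr h1)
    simp only [smul_zero] at h5
    rw [← h5]
    simp only [mul_smul_comm]
    module

end

/-! ### Isotropy of the self-dual block and elimination of the spinors. -/

section

theorem re_mul_comm (p q : ℍ[ℝ]) : (p * q).re = (q * p).re := by
  simp; ring

theorem eq_zero_of_qi_mul_re {q : ℍ[ℝ]} (h0 : q.re = 0) (h : ∀ i, (qi i * q).re = 0) : q = 0 := by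
  have h1 := h 0
  have h2 := h 1
  have h3 := h 2
  simp [qi_zero, qi_one, qi_two] at h1 h2 h3
  exact Quaternion.ext _ _ h0 (by simpa using h3) (by simpa using h2) (by simpa using h1)

theorem sum_smul_qi_re (P : Fin 3 → ℝ) : (∑ j, P j • qi j).re = 0 := by
  simp [Fin.sum_univ_three, qi_zero, qi_one, qi_two]

theorem sum_smul_qi_injective {P P' : Fin 3 → ℝ} (h : ∑ j, P j • qi j = ∑ j, P' j • qi j) :
    P = P' := by
  have h1 := congrArg (fun q : ℍ[ℝ] => q.imI) h
  have h2 := congrArg (fun q : ℍ[ℝ] => q.imJ) h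
  have h3 := congrArg (fun q : ℍ[ℝ] => q.imK) h
  simp [Fin.sum_univ_three, qi_zero, qi_one, qi_two] at h1 h2 h3
  funext j
  fin_cases j <;> assumption

/-- By `eb`, left multiplication of one fixed quaternion w = yt⁻¹ by every unit gives an imaginary
quaternion. Hence w is a real number S, and `pp` is S times the identity, whether or not c₀ = c₃. -/
theorem IntegrabilityConditions.pp_eq {R : Fin 4 → Fin 4 → Fin 4 → Fin 4 → ℝ}
    {F : Fin 4 → Fin 4 → ℝ} {a s t : ℍ[ℝ]} {c₀ c₁ c₂ c₃ c₄ D : ℂ}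
    (h : IntegrabilityConditions R F a s t c₀ c₁ c₂ c₃ c₄ D) (ht : t ≠ 0) :
    ∃ S : ℝ, (∀ i j, pp R i j = if i = j then S else 0) ∧
      star a * (s * (D * c₄ : ℂ)) = t * (S + c₂ * c₄ : ℂ) := by
  set y := -(t * (c₂ * c₄ : ℂ)) + star a * (s * (D * c₄ : ℂ)) with hy
  have h1 : ∀ i, (∑ j, pp R i j • qi j) = qi i * (y * t⁻¹) := by
    intro i
    rw [← mul_assoc, eq_mul_inv_iff_mul_eq₀ ht, h.eb i, hy]
    noncomm_ring
  have h2 : y * t⁻¹ = ((y * t⁻¹).re : ℍ[ℝ]) := by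
    rw [← sub_eq_zero]
    refine eq_zero_of_qi_mul_re (by simp) fun i => ?_
    have h3 := sum_smul_qi_re (pp R i)
    rw [h1] at h3
    rw [mul_sub, Quaternion.re_sub, h3]
    fin_cases i <;> simp [qi_zero, qi_one, qi_two]
  set S := (y * t⁻¹).re
  refine ⟨S, fun i j => ?_, ?_⟩
  · have h3 : ∑ j, pp R i j • qi j = ∑ j, (if i = j then S else 0) • qi j := by
      rw [h1, h2]
      simp [Quaternion.mul_coe_eq_smul]
    exact congrFun (sum_smul_qi_injective h3) j
  · have h3 : y = t * (S : ℍ[ℝ]) := by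
      rw [← Quaternion.coe_commutes, ← h2, mul_assoc, inv_mul_cancel₀ ht, mul_one]
    rw [hy] at h3
    rw [Quaternion.coeComplex_add, Quaternion.coeComplex_coe, mul_add, ← h3]
    abel

/-- The consequences of the integrability conditions for `H = s̄at` and `f = s̄Φs`. -/
structure SandwichConditions (f H : ℍ[ℝ]) (σ τ S : ℝ) (c₀ c₁ c₂ c₃ c₄ D : ℂ) : Prop where
  re_f : f.re = 0
  re_ea : ∀ v : ℍ[ℝ], v.re = 0 →
    (f * (H * (v * (c₁ * D : ℂ))) + σ • (H * (v * (c₂ * D : ℂ)))).re = 0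
  re_nb : ∀ w : ℍ[ℝ], w.re = 0 →
    ((τ * (f * star w).re) • ((c₃ + c₁ * c₄ : ℂ) : ℍ[ℝ]) + σ • (star H * (w * (D * c₄ : ℂ)))).re = 0
  adj : ∀ v w : ℍ[ℝ], v.re = 0 → w.re = 0 →
    τ * ((f * (H * (v * (c₁ * D : ℂ))) + σ • (H * (v * (c₂ * D : ℂ)))) * star w).re =
      σ * (star v * ((τ * (f * star w).re) • ((c₃ + c₁ * c₄ : ℂ) : ℍ[ℝ])
        + σ • (star H * (w * (D * c₄ : ℂ))))).re
  eb : star H * (D * c₄ : ℂ) = τ • ((S + c₂ * c₄ : ℂ) : ℍ[ℝ])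
  na : -((3 * S * (σ * σ)) • (1 : ℍ[ℝ])) = -(σ • (f * c₀)) + f * (H * (c₁ * D : ℂ))
    - (3 * σ) • (H * (c₂ * D : ℂ)) - σ • (f * (c₁ * c₄ : ℂ))
    + (3 * (σ * σ)) • ((c₂ * c₄ : ℂ) : ℍ[ℝ])

/-- The coordinates of an imaginary quaternion in the basis `qi`. -/
def coord (e : ℍ[ℝ]) (i : Fin 3) : ℝ := (e * star (qi i)).re

theorem sum_coord {e : ℍ[ℝ]} (he : e.re = 0) : ∑ i, coord e i • qi i = e := by
  apply Quaternion.ext <;> simp [coord, Fin.sum_univ_three, qi_zero, qi_one, qi_two, he]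

theorem re_sum_qi_mul_star (P : Fin 3 → ℝ) (f : ℍ[ℝ]) :
    ((∑ j, P j • qi j) * star f).re = ∑ j, P j * coord f j := by
  simp [coord, Fin.sum_univ_three, qi_zero, qi_one, qi_two]
  ring

/-- Testing the identities on t v t̄ and s w s̄, and multiplying by s̄ or t̄, leaves s, t and a only
in the combinations f, H and the squared norms. The entries of `pm` are eliminated as well: what
remains of them is that `pm` is real and that `ea` and `nb` contain transposed maps. -/
theorem IntegrabilityConditions.sandwich {R : Fin 4 → Fin 4 → Fin 4 → Fin 4 → ℝ}
    {F : Fin 4 → Fin 4 → ℝ} {a s t : ℍ[ℝ]} {c₀ c₁ c₂ c₃ c₄ D : ℂ}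
    (h : IntegrabilityConditions R F a s t c₀ c₁ c₂ c₃ c₄ D) (hs : s ≠ 0) (ht : t ≠ 0) {S : ℝ}
    (hpp : ∀ i j, pp R i j = if i = j then S else 0)
    (hS : star a * (s * (D * c₄ : ℂ)) = t * (S + c₂ * c₄ : ℂ)) :
    SandwichConditions (star s * (asdQuat F * s)) (star s * (a * t)) (Quaternion.normSq s)
      (Quaternion.normSq t) S c₀ c₁ c₂ c₃ c₄ D := by
  set σ := Quaternion.normSq s with hσ
  set τ := Quaternion.normSq t with hτ
  set Φ := asdQuat F with hΦ
  have hΦ0 : Φ.re = 0 := by simp [hΦ, asdQuat]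
  have hss : ∀ q : ℍ[ℝ], star s * (s * q) = σ • q := fun q => by
    rw [← mul_assoc, Quaternion.star_mul_self, Quaternion.coe_mul_eq_smul]
  have hss' : ∀ q : ℍ[ℝ], s * (star s * q) = σ • q := fun q => by
    rw [← mul_assoc, Quaternion.self_mul_star, Quaternion.coe_mul_eq_smul]
  have htt : ∀ q : ℍ[ℝ], star t * (t * q) = τ • q := fun q => by
    rw [← mul_assoc, Quaternion.star_mul_self, Quaternion.coe_mul_eq_smul]
  have htt' : ∀ q : ℍ[ℝ], t * (star t * q) = τ • q := fun q => by
    rw [← mul_assoc, Quaternion.self_mul_star, Quaternion.coe_mul_eq_smul]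
  -- `Rp` and `Rm` are the mixed block and its transpose, as maps of imaginary quaternions.
  set Rp : ℍ[ℝ] → ℍ[ℝ] := fun e => ∑ i, coord e i • ∑ j, pm R i j • qi j with hRp
  set Rm : ℍ[ℝ] → ℍ[ℝ] := fun f => ∑ j, coord f j • ∑ i, pm R i j • qi i with hRm
  have hRp0 : ∀ e, (Rp e).re = 0 := fun e => by
    simp [hRp, Fin.sum_univ_three, qi_zero, qi_one, qi_two]
  have hRm0 : ∀ e, (Rm e).re = 0 := fun e => by
    simp [hRm, Fin.sum_univ_three, qi_zero, qi_one, qi_two]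
  have hadj : ∀ e f, (Rp e * star f).re = (star e * Rm f).re := by
    intro e f
    rw [re_mul_comm (star e), hRp, hRm]
    simp [coord, Fin.sum_univ_three, qi_zero, qi_one, qi_two]
    ring
  have hea : ∀ e : ℍ[ℝ], e.re = 0 → Rp e * s =
      Φ * (a * (e * (t * (c₁ * D : ℂ)))) + a * (e * (t * (c₂ * D : ℂ))) := by
    intro e he
    have h1 : ∀ q, e * q = ∑ i, coord e i • (qi i * q) := fun q => by
      conv_lhs => rw [← sum_coord he]
      simp only [Finset.sum_mul, smul_mul_assoc]
    simp only [hRp, h1, Finset.sum_mul, smul_mul_assoc, Finset.mul_sum, mul_smul_comm,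
      ← Finset.sum_add_distrib, ← smul_add]
    refine Finset.sum_congr rfl fun i _ => ?_
    rw [← h.ea i]
    simp only [Finset.sum_mul, smul_mul_assoc]
  have hnb : ∀ f : ℍ[ℝ], f.re = 0 → Rm f * t = (Φ * star f).re • (t * (c₃ + c₁ * c₄ : ℂ))
      + star a * (f * (s * (D * c₄ : ℂ))) := by
    intro f hf
    have h1 : ∀ q, f * q = ∑ i, coord f i • (qi i * q) := fun q => by
      conv_lhs => rw [← sum_coord hf]
      simp only [Finset.sum_mul, smul_mul_assoc]
    rw [hΦ, ← sum_smul_qi, re_sum_qi_mul_star, h1]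
    simp only [hRm, Finset.sum_mul, smul_mul_assoc, Finset.mul_sum, mul_smul_comm,
      ← Finset.sum_add_distrib, Finset.sum_smul]
    refine Finset.sum_congr rfl fun i _ => ?_
    rw [mul_comm, mul_smul, ← smul_add, ← h.nb i]
    simp only [Finset.sum_mul, smul_mul_assoc]
  have imv : ∀ v q : ℍ[ℝ], v.re = 0 → (q * (v * star q)).re = 0 := by
    intro v q hv
    simp [hv]; ring
  have imv' : ∀ v q : ℍ[ℝ], v.re = 0 → (star q * (v * q)).re = 0 := by
    intro v q hv
    simp [hv]; ring
  have e1 : ∀ v : ℍ[ℝ], v.re = 0 → σ • (star s * (Rp (t * (v * star t)) * s)) =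
      τ • (star s * (Φ * s) * (star s * (a * t) * (v * (c₁ * D : ℂ)))
        + σ • (star s * (a * t) * (v * (c₂ * D : ℂ)))) := by
    intro v hv
    rw [hea _ (imv v t hv)]
    simp only [mul_assoc, mul_add, htt, hss', mul_smul_comm]
    module
  have e2 : ∀ w : ℍ[ℝ], w.re = 0 → star t * (Rm (s * (w * star s)) * t) =
      (τ * (star s * (Φ * s) * star w).re) • ((c₃ + c₁ * c₄ : ℂ) : ℍ[ℝ])
        + σ • (star (star s * (a * t)) * (w * (D * c₄ : ℂ))) := by
    intro w hw
    rw [hnb _ (imv w s hw)]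
    have h1 : (Φ * star (s * (w * star s))).re = (star s * (Φ * s) * star w).re := by
      rw [mul_assoc, re_mul_comm (star s)]
      simp only [star_mul, star_star, mul_assoc]
    rw [h1]
    simp only [star_mul, star_star, mul_assoc, mul_add, htt, hss, mul_smul_comm]
    module
  have hσ0 : σ ≠ 0 := Quaternion.normSq_ne_zero.2 hs
  have hτ0 : τ ≠ 0 := Quaternion.normSq_ne_zero.2 ht
  refine ⟨imv' Φ s hΦ0, fun v hv => ?_, fun w hw => ?_, fun v w hv hw => ?_, ?_, ?_⟩
  · have h1 := congrArg (fun q : ℍ[ℝ] => q.re) (e1 v hv)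
    simp only [Quaternion.re_smul, imv' _ _ (hRp0 _), smul_eq_mul, mul_zero] at h1
    exact (mul_eq_zero.1 h1.symm).resolve_left hτ0
  · rw [← e2 w hw]
    exact imv' _ _ (hRm0 _)
  · rw [← e2 w hw, ← smul_eq_mul, ← Quaternion.re_smul, ← smul_mul_assoc, ← e1 v hv, smul_mul_assoc,
      Quaternion.re_smul, smul_eq_mul]
    congr 1
    set e := t * (v * star t) with he
    set f := s * (w * star s) with hf
    calc (star s * (Rp e * s) * star w).re = (star s * (Rp e * s * star w)).re := by rw [mul_assoc]
      _ = (Rp e * s * star w * star s).re := re_mul_comm _ _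
      _ = (Rp e * star f).re := by simp only [hf, star_mul, star_star, mul_assoc]
      _ = (star e * Rm f).re := hadj e f
      _ = (t * (star v * (star t * Rm f))).re := by simp only [he, star_mul, star_star, mul_assoc]
      _ = (star v * (star t * Rm f) * t).re := re_mul_comm _ _
      _ = (star v * (star t * (Rm f * t))).re := by simp only [mul_assoc]
  · simp only [star_mul, star_star, mul_assoc]
    rw [hS, htt]
  · have h1 := congrArg (fun q => σ • (star s * q)) h.na
    have h3 : ∑ i, pp R i i = 3 * S := by simp [hpp]
    rw [h3] at h1
    have h2 : star s * s = σ • (1 : ℍ[ℝ]) := by simpa using hss 1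
    simp only [mul_add, mul_sub, mul_neg, mul_smul_comm, h2, hss] at h1
    simp only [mul_assoc, hss']
    rw [← hΦ] at h1
    simp only [mul_smul_comm]
    rw [← sub_eq_zero, ← sub_eq_zero.mpr h1]
    module

end

/-! ### Rigidity of the pointwise conditions when c₀ ≠ c₃. -/

section

open ComplexConjugate

theorem coeComplex_injective {z w : ℂ} (h : (z : ℍ[ℝ]) = w) : z = w := by
  have h0 := congrArg (fun q : ℍ[ℝ] => q.re) h
  have h1 := congrArg (fun q : ℍ[ℝ] => q.imI) h
  exact Complex.ext (by simpa using h0) (by simpa using h1)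

theorem _root_.Quaternion.coeComplex_neg (z : ℂ) : ((-z : ℂ) : ℍ[ℝ]) = -z :=
  map_neg Quaternion.ofComplex z

theorem coeComplex_eq_zero {z : ℂ} : (z : ℍ[ℝ]) = 0 ↔ z = 0 :=
  ⟨fun h => coeComplex_injective (by simpa using h), fun h => by rw [h, Quaternion.coeComplex_zero]⟩

theorem star_coeComplex (z : ℂ) : star (z : ℍ[ℝ]) = (conj z : ℂ) := by
  apply Quaternion.ext <;> simp

/-- The unit `J`. -/
def unitJ : ℍ[ℝ] := mkH 0 0 1 0

theorem unitJ_mul (z : ℂ) : unitJ * z = (conj z : ℂ) * unitJ := by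
  apply Quaternion.ext <;> simp [unitJ]

/-- For H ≠ 0, H̄fH is imaginary, so the hypothesis makes z̄₂z₁ purely imaginary: z̄₂z₁ = -z₂z̄₁.
This sign lets the conjugations be removed. -/
theorem mul_coeComplex_eq_of_conj {f H : ℍ[ℝ]} (hf : f.re = 0) {σ : ℝ} (hσ : σ ≠ 0) {z₁ z₂ : ℂ}
    (h : f * (H * (conj z₁ : ℂ)) + σ • (H * (conj z₂ : ℂ)) = 0) :
    f * (H * z₁) = σ • (H * z₂) := by
  by_cases hH : H = 0
  · simp [hH]
  have h1 : star H * (f * H) * ((conj z₁ : ℂ) : ℍ[ℝ]) =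
      -((σ * Quaternion.normSq H) • ((conj z₂ : ℂ) : ℍ[ℝ])) := by
    have h2 := congrArg (fun q => star H * q) (eq_neg_of_add_eq_zero_left h)
    simp only [mul_neg, mul_smul_comm, ← mul_assoc, Quaternion.star_mul_self] at h2
    rw [Quaternion.coe_mul_eq_smul, smul_smul] at h2
    rw [← h2]
    simp only [mul_assoc]
  have h3 : star H * (f * H) * ((Complex.normSq z₁ : ℝ) : ℍ[ℝ]) =
      -((σ * Quaternion.normSq H) • ((conj z₂ * z₁ : ℂ) : ℍ[ℝ])) := by
    have h4 := congrArg (fun q => q * (z₁ : ℍ[ℝ])) h1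
    simp only [mul_assoc, neg_mul, smul_mul_assoc, ← Quaternion.coeComplex_mul] at h4
    rw [mul_assoc, mul_assoc, ← h4, mul_comm (conj z₁), Complex.mul_conj, Quaternion.coeComplex_coe]
  have him : (star H * (f * H)).re = 0 := by simp [hf]; ring
  have h5 : (conj z₂ * z₁).re = 0 := by
    have h6 := congrArg (fun q : ℍ[ℝ] => q.re) h3
    rw [← Quaternion.coe_commutes, Quaternion.coe_mul_eq_smul] at h6
    simp only [Quaternion.re_smul, Quaternion.re_neg, him, mul_zero, Quaternion.re_coeComplex,
      smul_eq_mul] at h6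
    have h7 : σ * Quaternion.normSq H ≠ 0 := mul_ne_zero hσ (Quaternion.normSq_ne_zero.2 hH)
    exact (mul_eq_zero.1 (neg_eq_zero.1 h6.symm)).resolve_left h7
  by_cases hz : z₁ = 0
  · subst hz
    have h8 : σ • (H * ((conj z₂ : ℂ) : ℍ[ℝ])) = 0 := by simpa using h
    rcases smul_eq_zero.1 h8 with h9 | h9
    · exact absurd h9 hσ
    rcases mul_eq_zero.1 h9 with h10 | h10
    · exact absurd h10 hH
    have h11 : z₂ = 0 := by simpa using coeComplex_eq_zero.1 h10
    simp [h11]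
  · have h8 : conj z₂ * z₁ = - (z₂ * conj z₁) := by
      apply Complex.ext
      · simp at h5 ⊢; linarith
      · simp; ring
    have hz' : ((conj z₁ : ℂ) : ℍ[ℝ]) ≠ 0 := by
      rw [Ne, coeComplex_eq_zero]
      simpa using hz
    refine mul_right_cancel₀ hz' ?_
    have h9 := congrArg (fun q => q * (z₁ : ℍ[ℝ])) (eq_neg_of_add_eq_zero_left h)
    simp only [mul_assoc, neg_mul, smul_mul_assoc, ← Quaternion.coeComplex_mul] at h9 ⊢
    rw [mul_comm z₁, h9, h8, Quaternion.coeComplex_neg]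
    simp

namespace SandwichConditions

variable {f H : ℍ[ℝ]} {σ τ S : ℝ} {c₀ c₁ c₂ c₃ c₄ D : ℂ}

/-- If c₄ = 0, then S = 0 and c₃ is imaginary, and `adj` determines the `ea` expression completely.
Its values at J and i turn `na` into f c₀ = f c₃. -/
theorem c₄_ne_zero (h : SandwichConditions f H σ τ S c₀ c₁ c₂ c₃ c₄ D) (hσ : σ ≠ 0) (hτ : τ ≠ 0)
    (hf : f ≠ 0) (hd : c₀ ≠ c₃) : c₄ ≠ 0 := by
  rintro rfl
  have hS : S = 0 := by
    have h1 := congrArg (fun q : ℍ[ℝ] => q.re) h.eb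
    simp at h1
    exact h1.resolve_left hτ
  have hff : (f * star f).re ≠ 0 := by
    rw [Quaternion.self_mul_star, Quaternion.re_coe]
    exact Quaternion.normSq_ne_zero.2 hf
  have hc : c₃.re = 0 := by
    have h1 := h.re_nb f h.re_f
    simp only [mul_zero, add_zero, Quaternion.coeComplex_zero, smul_zero, Quaternion.re_smul,
      Quaternion.re_coeComplex, smul_eq_mul] at h1
    exact (mul_eq_zero.1 h1).resolve_left (mul_ne_zero hτ hff)
  have hX : ∀ v : ℍ[ℝ], v.re = 0 → f * (H * (v * (c₁ * D : ℂ))) + σ • (H * (v * (c₂ * D : ℂ))) =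
      (σ * (star v * (c₃ : ℍ[ℝ])).re) • f := by
    intro v hv
    rw [← sub_eq_zero]
    refine eq_zero_of_qi_mul_re ?_ fun i => ?_
    · rw [Quaternion.re_sub, h.re_ea v hv, Quaternion.re_smul, h.re_f]; simp
    · have hq : (qi i).re = 0 := by fin_cases i <;> rfl
      have h1 := h.adj v (qi i) hv hq
      have hsq : star (qi i) = - qi i := by
        fin_cases i <;> apply Quaternion.ext <;> simp [qi_zero, qi_one, qi_two]
      simp only [mul_zero, add_zero, Quaternion.coeComplex_zero, smul_zero, mul_smul_comm,
        Quaternion.re_smul, smul_eq_mul, hsq, mul_neg, Quaternion.re_neg] at h1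
      rw [mul_sub, Quaternion.re_sub, re_mul_comm, re_mul_comm (qi i) (_ • f), smul_mul_assoc,
        Quaternion.re_smul, smul_eq_mul]
      refine mul_left_cancel₀ hτ ?_
      linear_combination -h1
  -- At v = J the real part on the right of `hX` vanishes, and moving J past the complex constants
  -- conjugates them.
  have hJ : f * (H * ((conj (c₁ * D) : ℂ) : ℍ[ℝ])) + σ • (H * ((conj (c₂ * D) : ℂ) : ℍ[ℝ])) = 0 := by
    have h1 := hX unitJ rfl
    rw [unitJ_mul, unitJ_mul] at h1
    have h2 : (star unitJ * (c₃ : ℍ[ℝ])).re = 0 := by simp [unitJ]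
    have hJ0 : unitJ ≠ 0 := fun h => by
      have := congrArg (fun q : ℍ[ℝ] => q.imJ) h
      simp [unitJ, Quaternion.imJ_zero] at this
    refine mul_right_cancel₀ hJ0 ?_
    rw [h2, mul_zero, zero_smul] at h1
    simp only [add_mul, smul_mul_assoc, mul_assoc, zero_mul]
    exact h1
  have hK := mul_coeComplex_eq_of_conj h.re_f hσ hJ
  have hI := hX Complex.I (by simp)
  have h3 : f * (c₃ : ℍ[ℝ]) = -((2 : ℝ) • (H * ((c₂ * D : ℂ) : ℍ[ℝ]))) := by
    have hc3 : (star ((Complex.I : ℂ) : ℍ[ℝ]) * (c₃ : ℍ[ℝ])).re = c₃.im := by simp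
    have hc3' : c₃ = Complex.I * c₃.im := by apply Complex.ext <;> simp [hc]
    have h4 := congrArg (fun q => q * ((Complex.I : ℂ) : ℍ[ℝ])) hI
    simp only [hc3, add_mul, smul_mul_assoc, mul_assoc] at h4
    have h5 : ∀ z : ℂ, ((Complex.I : ℂ) : ℍ[ℝ]) * ((z : ℍ[ℝ]) * ((Complex.I : ℂ) : ℍ[ℝ])) = -z := by
      intro z
      rw [← Quaternion.coeComplex_mul, ← Quaternion.coeComplex_mul, ← Quaternion.coeComplex_neg]
      congr 1
      linear_combination z * Complex.I_sq
    rw [h5, h5, mul_neg, mul_neg, mul_neg, hK] at h4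
    rw [hc3', Quaternion.coeComplex_mul, Quaternion.coeComplex_coe, ← Quaternion.coe_commutes,
      Quaternion.coe_mul_eq_smul, mul_smul_comm]
    refine smul_right_injective _ hσ ?_
    simp only
    rw [smul_smul, ← h4]
    module
  have hna := h.na
  rw [hS, hK] at hna
  simp only [mul_zero, zero_mul, Quaternion.coeComplex_zero, smul_zero, zero_smul, neg_zero,
    sub_zero, add_zero] at hna
  have h6 : σ • (f * (c₃ : ℍ[ℝ]) - f * (c₀ : ℍ[ℝ])) = 0 := by
    rw [h3, hna]
    module
  rw [← mul_sub, ← Quaternion.coeComplex_sub] at h6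
  rcases smul_eq_zero.1 h6 with h7 | h7
  · exact hσ h7
  rcases mul_eq_zero.1 h7 with h8 | h8
  · exact hf h8
  · exact hd (sub_eq_zero.1 (coeComplex_eq_zero.1 h8)).symm

section Components

variable {p₁ p₂ p₃ : ℝ} {h : ℂ}

/-- Once H is a complex number h, the splitting ℍ = ℂ ⊕ ℂJ separates each condition into axial
components (1, i) and transverse components (J, K). This lemma and the following ones read these
off, pairing real equations into complex ones. -/
theorem transverse_mul (hs : SandwichConditions (mkH 0 p₁ p₂ p₃) h σ τ S c₀ c₁ c₂ c₃ c₄ D)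
    (hτ : τ ≠ 0) : (p₂ + Complex.I * p₃) * (conj h * (c₁ * D)) = 0 := by
  have ad21 := hs.adj (mkH 0 0 1 0) (mkH 0 1 0 0) rfl rfl
  have ad31 := hs.adj (mkH 0 0 0 1) (mkH 0 1 0 0) rfl rfl
  clear hs
  generalize c₁ * D = a1 at *
  generalize c₂ * D = a2 at *
  generalize c₃ + c₁ * c₄ = b3 at *
  generalize D * c₄ = b4 at *
  simp [hτ] at ad21 ad31
  apply Complex.ext
  · simp
    linarith
  · simp
    linarith

theorem transverse_na (hs : SandwichConditions (mkH 0 p₁ p₂ p₃) h σ τ S c₀ c₁ c₂ c₃ c₄ D) :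
    (p₂ - Complex.I * p₃) * (h * (c₁ * D) - σ * (c₀ + c₁ * c₄)) = 0 := by
  have na2 := congrArg (fun q : ℍ[ℝ] => q.imJ) hs.na
  have na3 := congrArg (fun q : ℍ[ℝ] => q.imK) hs.na
  clear hs
  generalize c₁ * D = a1 at *
  generalize c₂ * D = a2 at *
  generalize c₁ * c₄ = b1 at *
  generalize c₂ * c₄ = b2 at *
  simp at na2 na3
  apply Complex.ext
  · simp
    linarith
  · simp
    linarith

theorem axial_na (hs : SandwichConditions (mkH 0 p₁ p₂ p₃) h σ τ S c₀ c₁ c₂ c₃ c₄ D) :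
    -(3 * S * (σ * σ) : ℂ) = -(σ * Complex.I * p₁ * c₀) + Complex.I * p₁ * (h * (c₁ * D))
      - 3 * σ * (h * (c₂ * D)) - σ * Complex.I * p₁ * (c₁ * c₄) + 3 * (σ * σ) * (c₂ * c₄) := by
  have na0 := congrArg (fun q : ℍ[ℝ] => q.re) hs.na
  have na1 := congrArg (fun q : ℍ[ℝ] => q.imI) hs.na
  clear hs
  generalize c₁ * D = a1 at *
  generalize c₂ * D = a2 at *
  generalize c₁ * c₄ = b1 at *
  generalize c₂ * c₄ = b2 at *
  simp at na0 na1
  apply Complex.ext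
  · simp
    linarith
  · simp
    linarith

theorem re_transverse (hs : SandwichConditions (mkH 0 p₁ p₂ p₃) h σ τ S c₀ c₁ c₂ c₃ c₄ D)
    (hτ : τ ≠ 0) (hne : p₂ ≠ 0 ∨ p₃ ≠ 0) : (c₃ + c₁ * c₄).re = 0 := by
  have nb2 := hs.re_nb (mkH 0 0 1 0) rfl
  have nb3 := hs.re_nb (mkH 0 0 0 1) rfl
  clear hs
  generalize c₃ + c₁ * c₄ = b3 at *
  generalize D * c₄ = b4 at *
  simp [hτ] at nb2 nb3
  tauto

theorem im_transverse (hs : SandwichConditions (mkH 0 p₁ p₂ p₃) h σ τ S c₀ c₁ c₂ c₃ c₄ D)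
    (hσ : σ ≠ 0) (hτ : τ ≠ 0) (h1 : h * (c₁ * D) = 0) (hne : p₂ ≠ 0 ∨ p₃ ≠ 0) :
    (c₃ + c₁ * c₄).im = 0 := by
  have ad12 := hs.adj (mkH 0 1 0 0) (mkH 0 0 1 0) rfl rfl
  have ad13 := hs.adj (mkH 0 1 0 0) (mkH 0 0 0 1) rfl rfl
  clear hs
  have h1r := congrArg Complex.re h1
  have h1i := congrArg Complex.im h1
  clear h1
  generalize c₁ * D = a1 at *
  generalize c₂ * D = a2 at *
  generalize c₃ + c₁ * c₄ = b3 at *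
  generalize D * c₄ = b4 at *
  simp only [Complex.mul_re, Complex.mul_im, Complex.zero_re, Complex.zero_im] at h1r h1i
  simp at ad12 ad13
  have e2 : σ * τ * p₂ * b3.im = 0 := by linear_combination -ad12 - τ * p₂ * h1i + τ * p₃ * h1r
  have e3 : σ * τ * p₃ * b3.im = 0 := by linear_combination -ad13 - τ * p₃ * h1i - τ * p₂ * h1r
  simp [hσ, hτ] at e2 e3
  tauto

theorem axial (hs : SandwichConditions (mkH 0 p₁ 0 0) h σ τ S c₀ c₁ c₂ c₃ c₄ D) :
    τ * (-p₁ * (h * (c₁ * D)) + σ * Complex.I * (h * (c₂ * D))) =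
      σ * (τ * p₁ * (c₃ + c₁ * c₄) + σ * Complex.I * (conj h * (D * c₄))) := by
  have ea1 := hs.re_ea (mkH 0 1 0 0) rfl
  have nb1 := hs.re_nb (mkH 0 1 0 0) rfl
  have ad11 := hs.adj (mkH 0 1 0 0) (mkH 0 1 0 0) rfl rfl
  clear hs
  generalize c₁ * D = a1 at *
  generalize c₂ * D = a2 at *
  generalize c₃ + c₁ * c₄ = b3 at *
  generalize D * c₄ = b4 at *
  simp at ea1 nb1 ad11
  apply Complex.ext
  · simp
    linear_combination τ * ea1 - σ * nb1
  · simp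
    linear_combination ad11

theorem adjoint_transverse (hs : SandwichConditions (mkH 0 p₁ 0 0) h σ τ S c₀ c₁ c₂ c₃ c₄ D) :
    τ * (h * conj (σ * (c₂ * D) - Complex.I * p₁ * (c₁ * D))) =
      σ ^ 2 * (h * (D * c₄)) := by
  have ad22 := hs.adj (mkH 0 0 1 0) (mkH 0 0 1 0) rfl rfl
  have ad23 := hs.adj (mkH 0 0 1 0) (mkH 0 0 0 1) rfl rfl
  clear hs
  generalize c₁ * D = a1 at *
  generalize c₂ * D = a2 at *
  generalize c₃ + c₁ * c₄ = b3 at *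
  generalize D * c₄ = b4 at *
  simp at ad22 ad23
  apply Complex.ext
  · simp [pow_two]
    linear_combination ad22
  · simp [pow_two]
    linear_combination ad23

end Components

/-- If h = 0, both c₃ + c₁c₄ and c₀ + c₁c₄ vanish: from the transverse components if f has any,
otherwise from the axial ones. -/
theorem ne_zero_of_axis {p₁ p₂ p₃ : ℝ} {h : ℂ}
    (hs : SandwichConditions (mkH 0 p₁ p₂ p₃) h σ τ S c₀ c₁ c₂ c₃ c₄ D) (hσ : σ ≠ 0) (hτ : τ ≠ 0)
    (hf : mkH 0 p₁ p₂ p₃ ≠ 0) (hb : conj h * (D * c₄) = τ * (S + c₂ * c₄)) (hd : c₀ ≠ c₃) :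
    h ≠ 0 := by
  have hσ' : (σ : ℂ) ≠ 0 := Complex.ofReal_ne_zero.2 hσ
  have hτ' : (τ : ℂ) ≠ 0 := Complex.ofReal_ne_zero.2 hτ
  rintro rfl
  have hb' : (S : ℂ) + c₂ * c₄ = 0 := by simpa [hτ'] using hb
  have hNa := hs.axial_na
  by_cases hne : p₂ ≠ 0 ∨ p₃ ≠ 0
  · have h0 : c₃ + c₁ * c₄ = 0 :=
      Complex.ext (hs.re_transverse hτ hne) (hs.im_transverse hσ hτ (by simp) hne)
    have h1 := hs.transverse_na
    have h2 : (p₂ - Complex.I * p₃ : ℂ) ≠ 0 := by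
      intro h2
      have h3 := congrArg Complex.re h2
      have h4 := congrArg Complex.im h2
      simp at h3 h4
      tauto
    have h3 : (σ : ℂ) * (c₀ + c₁ * c₄) = 0 := by
      linear_combination -(mul_eq_zero.1 h1).resolve_left h2
    exact hd (by linear_combination (mul_eq_zero.1 h3).resolve_left hσ' - h0)
  · obtain ⟨rfl, rfl⟩ : p₂ = 0 ∧ p₃ = 0 := by tauto
    have hp : (p₁ : ℂ) ≠ 0 := by
      rw [Ne, Complex.ofReal_eq_zero]
      rintro rfl
      exact hf (Quaternion.ext _ _ rfl rfl rfl rfl)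
    have hpσ := mul_ne_zero (mul_ne_zero hσ' Complex.I_ne_zero) hp
    have h0 := hs.axial
    have h1 : (σ * τ * p₁ : ℂ) * (c₃ + c₁ * c₄) = 0 := by
      simp only [map_zero, zero_mul, mul_zero, add_zero] at h0
      linear_combination -h0
    have h2 : (σ * Complex.I * p₁ : ℂ) * (c₀ + c₁ * c₄) = 0 := by
      linear_combination hNa + 3 * (σ : ℂ) ^ 2 * hb'
    have h3 := (mul_eq_zero.1 h1).resolve_left (mul_ne_zero (mul_ne_zero hσ' hτ') hp)
    have h4 := (mul_eq_zero.1 h2).resolve_left hpσ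
    exact hd (by linear_combination h4 - h3)

/-- `eb` gives H̄ times the nonzero complex number Dc₄ as a complex number, so H is complex. A
transverse part of f would force c₁D = 0 and then c₃ + c₁c₄ = 0 = c₀ + c₁c₄. What is left are the
axial equations. -/
theorem rigidity (hs : SandwichConditions f H σ τ S c₀ c₁ c₂ c₃ c₄ D) (hσ : σ ≠ 0) (hτ : τ ≠ 0)
    (hf : f ≠ 0) (hD : D ≠ 0) (hd : c₀ ≠ c₃) :
    ∃ (h : ℂ) (p : ℝ), H = h ∧ h ≠ 0 ∧ f = mkH 0 p 0 0 ∧ p ≠ 0 ∧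
      conj h * (D * c₄) = τ * (S + c₂ * c₄) ∧
      τ * (σ * (c₂ * D) - Complex.I * p * (c₁ * D)) = σ ^ 2 * conj (D * c₄) ∧
      (c₀ - c₃) * p = 4 * σ * (c₂ * c₄).im := by
  have hc₄ := hs.c₄_ne_zero hσ hτ hf hd
  obtain ⟨h, rfl⟩ : ∃ h : ℂ, H = h := by
    have h1 := congrArg star hs.eb
    rw [star_mul, star_star, star_coeComplex, Quaternion.star_smul, star_coeComplex] at h1
    have h2 : conj (D * c₄) ≠ 0 := by simpa using ⟨hD, hc₄⟩
    refine ⟨(conj (D * c₄))⁻¹ * (τ * conj (S + c₂ * c₄)), ?_⟩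
    have h3 : ((conj (D * c₄) : ℂ) : ℍ[ℝ]) ≠ 0 := by rwa [Ne, coeComplex_eq_zero]
    refine mul_left_cancel₀ h3 ?_
    rw [h1, ← Quaternion.coeComplex_mul, mul_inv_cancel_left₀ h2, Quaternion.coeComplex_mul,
      Quaternion.coeComplex_coe, Quaternion.coe_mul_eq_smul]
  obtain ⟨p₁, p₂, p₃, rfl⟩ : ∃ p₁ p₂ p₃, f = mkH 0 p₁ p₂ p₃ :=
    ⟨f.imI, f.imJ, f.imK, Quaternion.ext _ _ hs.re_f rfl rfl rfl⟩
  have hb : conj h * (D * c₄) = τ * (S + c₂ * c₄) := by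
    refine coeComplex_injective ?_
    rw [Quaternion.coeComplex_mul, Quaternion.coeComplex_mul τ, Quaternion.coeComplex_coe,
      Quaternion.coe_mul_eq_smul, ← hs.eb, star_coeComplex]
  have hσ' : (σ : ℂ) ≠ 0 := Complex.ofReal_ne_zero.2 hσ
  have hτ' : (τ : ℂ) ≠ 0 := Complex.ofReal_ne_zero.2 hτ
  have hh := hs.ne_zero_of_axis hσ hτ hf hb hd
  obtain ⟨rfl, rfl⟩ : p₂ = 0 ∧ p₃ = 0 := by
    by_contra hcon
    have hne : p₂ ≠ 0 ∨ p₃ ≠ 0 := by tauto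
    have h2 : (p₂ + Complex.I * p₃ : ℂ) ≠ 0 := by
      intro h2
      have h3 := congrArg Complex.re h2
      have h4 := congrArg Complex.im h2
      simp at h3 h4
      tauto
    have h2' : (p₂ - Complex.I * p₃ : ℂ) ≠ 0 := by
      intro h2
      have h3 := congrArg Complex.re h2
      have h4 := congrArg Complex.im h2
      simp at h3 h4
      tauto
    have h3 : c₁ * D = 0 :=
      (mul_eq_zero.1 ((mul_eq_zero.1 (hs.transverse_mul hτ)).resolve_left h2)).resolve_left
        (by simpa using hh)
    have h4 : c₃ + c₁ * c₄ = 0 :=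
      Complex.ext (hs.re_transverse hτ hne) (hs.im_transverse hσ hτ (by simp [h3]) hne)
    have h5 : (σ : ℂ) * (c₀ + c₁ * c₄) = 0 := by
      linear_combination -(mul_eq_zero.1 hs.transverse_na).resolve_left h2' + h * h3
    exact hd (by linear_combination (mul_eq_zero.1 h5).resolve_left hσ' - h4)
  have hp : p₁ ≠ 0 := by
    rintro rfl
    exact hf (Quaternion.ext _ _ rfl rfl rfl rfl)
  have hS1 : τ * (σ * (c₂ * D) - Complex.I * p₁ * (c₁ * D)) = σ ^ 2 * conj (D * c₄) := by
    have h1 := congrArg conj (mul_left_cancel₀ hh (show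
      h * (τ * conj (σ * (c₂ * D) - Complex.I * p₁ * (c₁ * D))) = h * (σ ^ 2 * (D * c₄)) by
        linear_combination hs.adjoint_transverse))
    rw [map_mul, Complex.conj_conj, map_mul, map_pow, Complex.conj_ofReal, Complex.conj_ofReal] at h1
    exact h1
  refine ⟨h, p₁, rfl, hh, rfl, hp, hb, hS1, ?_⟩
  have hT : h * conj (D * c₄) = τ * (S + conj (c₂ * c₄)) := by
    have h1 := congrArg conj hb
    simpa using h1
  have h1 : -p₁ * (h * (c₁ * D)) + σ * Complex.I * (h * (c₂ * D)) =
      σ * p₁ * (c₃ + c₁ * c₄) + σ ^ 2 * Complex.I * (S + c₂ * c₄) := by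
    refine mul_left_cancel₀ hτ' ?_
    linear_combination hs.axial + σ ^ 2 * Complex.I * hb
  have h2 : h * (σ * (c₂ * D) - Complex.I * p₁ * (c₁ * D)) = σ ^ 2 * (S + conj (c₂ * c₄)) := by
    refine mul_left_cancel₀ hτ' ?_
    linear_combination h * hS1 + σ ^ 2 * hT
  have h3 : c₂ * c₄ - conj (c₂ * c₄) = 2 * (c₂ * c₄).im * Complex.I := by
    rw [Complex.sub_conj]; push_cast; ring
  have hNa := hs.axial_na
  refine mul_left_cancel₀ (mul_ne_zero hσ' Complex.I_ne_zero) ?_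
  -- The combination eliminates h, c₁ + S-dependence and the products with D, leaving c₀ - c₃
  -- against c₂c₄ minus its conjugate.
  linear_combination hNa + Complex.I * h1 - 2 * h2 + 2 * (σ : ℂ) ^ 2 * h3 -
    (σ * (h * (c₂ * D)) - σ ^ 2 * (S + c₂ * c₄)) * Complex.I_sq

end SandwichConditions

end

section

/-! ### Curvature tensors with isotropic self-dual part and no mixed part -/

/-- The mixed block of `R` vanishes, and its self-dual block is `S` times the identity. -/
structure IsIsotropic (R : Fin 4 → Fin 4 → Fin 4 → Fin 4 → ℝ) (S : ℝ) : Prop where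
  pp : ∀ i j, pp R i j = if i = j then S else 0
  pm : ∀ i j, pm R i j = 0

theorem hodge_eq_neg {T : Fin 4 → Fin 4 → ℝ} (hT : ∀ a b, T a b = - T b a)
    (h : ∀ i, sdPart i T = 0) (a b : Fin 4) : hodge T a b = - T a b := by
  have h0 := h 0
  have h1 := h 1
  have h2 := h 2
  simp only [sdPart, Matrix.cons_val] at h0 h1 h2
  have s2 : Int.sign 2 = 1 := rfl
  have s3 : Int.sign 3 = 1 := rfl
  have h10 := hT 1 0
  have h20 := hT 2 0
  have h30 := hT 3 0
  have h21 := hT 2 1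
  have h31 := hT 3 1
  have h32 := hT 3 2
  fin_cases a <;> fin_cases b <;>
    simp [hodge, levi, Fin.sum_univ_four, s2, s3, skew_diag hT, h10, h20, h30, h21, h31, h32] <;>
    linarith

namespace IsIsotropic

variable {R : Fin 4 → Fin 4 → Fin 4 → Fin 4 → ℝ} {S : ℝ}

/-- The two blocks give the sum and the difference of each dual pair of components, hence the
components themselves. -/
theorem sd_left (h : IsIsotropic R S) (i : Fin 3) :
    sdPart i (fun a b => R a b 0 1) = (if i = 0 then 2 * S else 0) ∧
    sdPart i (fun a b => R a b 2 3) = (if i = 0 then 2 * S else 0) ∧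
    sdPart i (fun a b => R a b 0 2) = (if i = 1 then 2 * S else 0) ∧
    sdPart i (fun a b => R a b 1 3) = (if i = 1 then -2 * S else 0) ∧
    sdPart i (fun a b => R a b 0 3) = (if i = 2 then 2 * S else 0) ∧
    sdPart i (fun a b => R a b 1 2) = (if i = 2 then 2 * S else 0) := by
  have p0 := h.pp i 0
  have p1 := h.pp i 1
  have p2 := h.pp i 2
  have m0 := h.pm i 0
  have m1 := h.pm i 1
  have m2 := h.pm i 2
  fin_cases i <;> simp [KillingSpinor.pp, KillingSpinor.pm, sdPart, asdPart] at * <;>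
    refine ⟨?_, ?_, ?_, ?_, ?_, ?_⟩ <;> linarith

theorem sd_eq (h : IsIsotropic R S) (hR : IsCurvature R) (i : Fin 3) (c d : Fin 4) :
    sdPart i (fun a b => R a b c d) =
      2 * S * sdPart i (fun a b => kron a c * kron b d - kron a d * kron b c) := by
  have hsw : ∀ c d, sdPart i (fun a b => R a b c d) = - sdPart i (fun a b => R a b d c) := by
    intro c d
    rw [← sd_neg]
    congr 1
    funext a b
    exact hR.right a b c d
  have hdiag : ∀ c, sdPart i (fun a b => R a b c c) = 0 := fun c => by linarith [hsw c c]
  obtain ⟨h01, h23, h02, h13, h03, h12⟩ := h.sd_left i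
  fin_cases c <;> fin_cases d <;> simp only [Fin.isValue, Fin.zero_eta, Fin.mk_one, Fin.reduceFinMk] <;>
    first
    | rw [hdiag]
    | rw [h01] | rw [h23] | rw [h02] | rw [h13] | rw [h03] | rw [h12]
    | rw [hsw, h01] | rw [hsw, h23] | rw [hsw, h02] | rw [hsw, h13] | rw [hsw, h03] | rw [hsw, h12]
  all_goals fin_cases i <;> simp [sdPart, kron]

/-- Trace-free Ricci is encoded in the mixed block, and the scalar curvature in the trace of `pp`;
the unknown block `mm` contributes only through its trace, by Bianchi. -/
theorem ricci_eq (h : IsIsotropic R S) (hR : IsCurvature R) (a b : Fin 4) :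
    ∑ c, R a c b c = 6 * S * kron a b := by
  have p := h.sd_left
  have p0 := p 0
  have p1 := p 1
  have p2 := p 2
  simp [sdPart] at p0 p1 p2
  obtain ⟨p01, p02, p03, p04, p05, p06⟩ := p0
  obtain ⟨p11, p12, p13, p14, p15, p16⟩ := p1
  obtain ⟨p21, p22, p23, p24, p25, p26⟩ := p2
  have hp := hR.pair
  have hb := hR.bianchi 0 1 2 3
  have l10 := hR.left 1 0
  have l20 := hR.left 2 0
  have l30 := hR.left 3 0
  have l21 := hR.left 2 1
  have l31 := hR.left 3 1
  have l32 := hR.left 3 2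
  have r10 := fun a b => hR.right a b 1 0
  have r20 := fun a b => hR.right a b 2 0
  have r30 := fun a b => hR.right a b 3 0
  have r21 := fun a b => hR.right a b 2 1
  have r31 := fun a b => hR.right a b 3 1
  have r32 := fun a b => hR.right a b 3 2
  have ld : ∀ a c d, R a a c d = 0 := fun a c d => by linarith [hR.left a a c d]
  have rd : ∀ a b c, R a b c c = 0 := fun a b c => by linarith [hR.right a b c c]
  fin_cases a <;> fin_cases b <;>
    simp [kron, Fin.sum_univ_four, ld, rd, l10, l20, l30, l21, l31, l32, r10, r20, r30, r21, r31,
      r32] at hb ⊢ <;>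
    linarith [hp 0 1 2 3, hp 0 2 1 3, hp 0 3 1 2, hp 0 1 0 2, hp 0 1 1 3, hp 2 3 0 2, hp 2 3 1 3,
      hp 0 1 0 3, hp 0 1 1 2, hp 2 3 0 3, hp 2 3 1 2, hp 0 2 0 3, hp 0 2 1 2, hp 1 3 0 3, hp 1 3 1 2]

end IsIsotropic

section

variable {M : Type*} [TopologicalSpace M] [ChartedSpace E4 M] [IsManifold 𝓘(ℝ, E4) ∞ M]
variable {g : Metric4 M} {e : Fin 4 → VField M} {x : M} {S : ℝ}

theorem IsIsotropic.scalar_eq (h : IsIsotropic (fun a b c d => riemann g e a b c d x) S)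
    (hR : IsCurvature fun a b c d => riemann g e a b c d x) : scalar g e x = 24 * S := by
  have h1 : ∀ a, ricci g e a a x = 6 * S := fun a =>
    (h.ricci_eq hR a a).trans (by simp [kron])
  simp only [scalar, h1, Fin.sum_univ_four]
  ring

theorem IsIsotropic.einstein (h : IsIsotropic (fun a b c d => riemann g e a b c d x) S)
    (hR : IsCurvature fun a b c d => riemann g e a b c d x) (a b : Fin 4) :
    ricci g e a b x = scalar g e x / 4 * kron a b := by
  rw [h.scalar_eq hR]
  exact (h.ricci_eq hR a b).trans (by ring)

/-- The Ricci terms of the Weyl tensor reduce to the constant-curvature tensor with factor 2S, whose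
self-dual part is that of Riemann by `sd_eq`. -/
theorem IsIsotropic.antiSelfDual (h : IsIsotropic (fun a b c d => riemann g e a b c d x) S)
    (hR : IsCurvature fun a b c d => riemann g e a b c d x) (a b c d : Fin 4) :
    hodge (fun p q => weyl g e p q c d x) a b = - weyl g e a b c d x := by
  have hW : ∀ a b, weyl g e a b c d x = riemann g e a b c d x
      - (2 * S) * (kron a c * kron b d - kron a d * kron b c) := fun a b => by
    have hr : ∀ a b, ricci g e a b x = 6 * S * kron a b := h.ricci_eq hR
    simp only [weyl, hr, h.scalar_eq hR]
    ring
  refine hodge_eq_neg (fun a b => ?_) (fun i => ?_) a b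
  · rw [hW, hW, hR.left a b c d]
    ring
  · have h1 := h.sd_eq hR i c d
    simp only [hW]
    rw [sd_sub, h1]
    fin_cases i <;> simp [sdPart] <;> ring

end

/-! ### The integrability conditions for `c₀ = c₃` -/

namespace IntegrabilityConditions

variable {R : Fin 4 → Fin 4 → Fin 4 → Fin 4 → ℝ} {F : Fin 4 → Fin 4 → ℝ} {a s t : ℍ[ℝ]}
  {c₀ c₁ c₂ c₃ c₄ : ℂ}

theorem asdQuat_eq_zero : asdQuat F = 0 ↔ ∀ j : Fin 3, F 0 j.succ = 0 := by
  constructor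
  · intro h
    rw [← sum_smul_qi] at h
    have h1 : (fun j : Fin 3 => F 0 j.succ) = fun _ => 0 :=
      sum_smul_qi_injective (by rw [h]; simp)
    exact congrFun h1
  · intro h
    rw [← sum_smul_qi]
    simp [h]

theorem pp_eq_of_eq (h : IntegrabilityConditions R F a s t c₀ c₁ c₂ c₃ c₄ 0) (ht : t ≠ 0) :
    ∃ S : ℝ, (∀ i j, pp R i j = if i = j then S else 0) ∧ c₂ * c₄ = -S := by
  obtain ⟨S, h1, h2⟩ := h.pp_eq ht
  refine ⟨S, h1, ?_⟩
  have h3 : t * ((S + c₂ * c₄ : ℂ) : ℍ[ℝ]) = 0 := by rw [← h2]; simp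
  linear_combination coeComplex_eq_zero.1 ((mul_eq_zero.1 h3).resolve_left ht)

theorem pm_eq_zero (h : IntegrabilityConditions R F a s t c₀ c₁ c₂ c₃ c₄ 0) (hs : s ≠ 0)
    (i j : Fin 3) : pm R i j = 0 := by
  have h1 := h.ea i
  simp [hs] at h1
  have h2 : pm R i = fun _ => 0 := sum_smul_qi_injective (by rw [h1]; simp)
  exact congrFun h2 j

/-- A substitute for `pm_eq_zero` at points where s may vanish but the field does. -/
theorem pm_eq_zero_of_field (h : IntegrabilityConditions R F a s t c₀ c₁ c₂ c₃ c₄ 0) (ht : t ≠ 0)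
    (hF : asdQuat F = 0) (i j : Fin 3) : pm R i j = 0 := by
  have h1 := h.nb j
  simp [ht, asdQuat_eq_zero.1 hF j] at h1
  have h2 : (fun i => pm R i j) = fun _ => 0 := sum_smul_qi_injective (by rw [h1]; simp)
  exact congrFun h2 i

theorem coupling (h : IntegrabilityConditions R F a s t c₀ c₁ c₂ c₃ c₄ 0) (ht : t ≠ 0)
    (hF : asdQuat F ≠ 0) (hpm : ∀ i j, pm R i j = 0) : c₃ = -(c₁ * c₄) := by
  rw [Ne, asdQuat_eq_zero, not_forall] at hF
  obtain ⟨j, hj⟩ := hF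
  have h1 := h.nb j
  simp only [hpm, zero_smul, Finset.sum_const_zero, zero_mul, Quaternion.coeComplex_zero, mul_zero,
    add_zero] at h1
  rcases smul_eq_zero.1 h1.symm with h2 | h2
  · exact absurd h2 hj
  rcases mul_eq_zero.1 h2 with h3 | h3
  · exact absurd h3 ht
  exact eq_neg_of_add_eq_zero_left (coeComplex_eq_zero.1 h3)

end IntegrabilityConditions

end

/-! ### The exterior derivative of the potential forces c₀ = c₃. -/

section

open ComplexConjugate

/-- The real part as a continuous linear map. -/
def reCLM : ℍ[ℝ] →L[ℝ] ℝ :=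
  LinearMap.toContinuousLinearMap
    { toFun := fun q => q.re
      map_add' := fun _ _ => rfl
      map_smul' := fun _ _ => rfl }

theorem antisymm_sum {w : Fin 4 → Fin 4 → ℝ} (hw : ∀ a c, w a c = - w c a) (A V : Fin 4 → ℝ) :
    ∑ a, ∑ c, A a * w a c * V c = - ∑ a, ∑ c, V a * w a c * A c := by
  rw [Finset.sum_comm, ← Finset.sum_neg_distrib]
  refine Finset.sum_congr rfl fun a _ => ?_
  rw [← Finset.sum_neg_distrib]
  refine Finset.sum_congr rfl fun c _ => ?_
  rw [hw c a]
  ring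

/-- The exterior derivative of a form that annihilates `V` and `V'`, evaluated on `V'` and `V`. -/
theorem exterior_of_annihilates {w : Fin 4 → Fin 4 → Fin 4 → ℝ} (hw : ∀ b a c, w b a c = - w b c a)
    {dA : Fin 4 → Fin 4 → ℝ} {A V V' E E' : Fin 4 → ℝ}
    (h : ∀ b, ∑ a, dA b a * V a = - E b - ∑ a, ∑ c, A a * w b a c * V c)
    (h' : ∀ b, ∑ a, dA b a * V' a = - E' b - ∑ a, ∑ c, A a * w b a c * V' c) :
    ∑ b, ∑ a, V' b * V a * (dA b a - dA a b - ∑ c, (w b a c - w a b c) * A c) =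
      - ∑ b, V' b * E b + ∑ b, V b * E' b := by
  -- Skewness of w moves the connection from V to A, so this is the contraction of V with the
  -- covariant derivative of A.
  have k : ∀ b, ∑ a, V a * (dA b a - ∑ c, w b a c * A c) = - E b := by
    intro b
    have h1 := h b
    rw [antisymm_sum (hw b)] at h1
    have h2 : ∑ a, V a * (dA b a - ∑ c, w b a c * A c) =
        ∑ a, dA b a * V a - ∑ a, ∑ c, V a * w b a c * A c := by
      rw [← Finset.sum_sub_distrib]
      refine Finset.sum_congr rfl fun a _ => ?_
      rw [mul_sub, Finset.mul_sum, mul_comm]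
      simp only [mul_assoc]
    rw [h2, h1]
    ring
  have k' : ∀ b, ∑ a, V' a * (dA b a - ∑ c, w b a c * A c) = - E' b := by
    intro b
    have h1 := h' b
    rw [antisymm_sum (hw b)] at h1
    have h2 : ∑ a, V' a * (dA b a - ∑ c, w b a c * A c) =
        ∑ a, dA b a * V' a - ∑ a, ∑ c, V' a * w b a c * A c := by
      rw [← Finset.sum_sub_distrib]
      refine Finset.sum_congr rfl fun a _ => ?_
      rw [mul_sub, Finset.mul_sum, mul_comm]
      simp only [mul_assoc]
    rw [h2, h1]
    ring
  have e1 : ∑ b, V' b * E b = - ∑ b, ∑ a, V' b * (V a * (dA b a - ∑ c, w b a c * A c)) := by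
    rw [← Finset.sum_neg_distrib]
    refine Finset.sum_congr rfl fun b _ => ?_
    rw [← Finset.mul_sum, k]
    ring
  have e2 : ∑ b, V b * E' b = - ∑ b, ∑ a, V a * (V' b * (dA a b - ∑ c, w a b c * A c)) := by
    rw [Finset.sum_comm, ← Finset.sum_neg_distrib]
    refine Finset.sum_congr rfl fun a _ => ?_
    rw [← Finset.mul_sum, k']
    ring
  rw [e1, e2, neg_neg, ← sub_eq_add_neg, ← Finset.sum_sub_distrib]
  refine Finset.sum_congr rfl fun b _ => ?_
  rw [← Finset.sum_sub_distrib]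
  refine Finset.sum_congr rfl fun a _ => ?_
  simp only [sub_mul, Finset.sum_sub_distrib]
  ring

theorem two_form_eq {F : Fin 4 → Fin 4 → ℝ} (hF : ∀ a b, F a b = - F b a) (h : IsASDForm F)
    (V V' : Fin 4 → ℝ) : ∑ b, ∑ a, V' b * V a * F b a =
      (asdQuat F * ((∑ b, V' b • qu b) * star (∑ b, V b • qu b))).re := by
  obtain ⟨h1, h2, h3⟩ := h
  simp [Fin.sum_univ_four, asdQuat, qu_zero, qu_one, qu_two, qu_three, skew_diag hF, hF 1 0, hF 2 0,
    hF 3 0, hF 2 1, hF 3 1, hF 3 2, h1, h2, h3]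
  ring

/-- The components of the vector `s ū t̄`. -/
def vec (s t u : ℍ[ℝ]) (a : Fin 4) : ℝ := (star s * (qu a * (t * u))).re

theorem sum_vec (s t u : ℍ[ℝ]) : ∑ a, vec s t u a • qu a = s * (star u * star t) := by
  apply Quaternion.ext <;>
    simp [vec, Fin.sum_univ_four, qu_zero, qu_one, qu_two, qu_three] <;> ring

theorem sum_mul_vec (A : Fin 4 → ℝ) (s t u : ℍ[ℝ]) :
    ∑ a, A a * vec s t u a = (star s * (vecQuat A * (t * u))).re := by
  have h : (star s * (vecQuat A * (t * u))).re =
      reCLM (∑ a, A a • (star s * (qu a * (t * u)))) := by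
    unfold vecQuat
    simp only [Finset.sum_mul, Finset.mul_sum, smul_mul_assoc, mul_smul_comm]
    rfl
  rw [h, map_sum]
  simp only [map_smul]
  rfl

variable {M : Type*} [TopologicalSpace M] [ChartedSpace E4 M] [IsManifold 𝓘(ℝ, E4) ∞ M]
variable {g : Metric4 M} {U : Set M} {e : Fin 4 → VField M}
variable {A : Fin 4 → M → ℝ} {c₀ c₁ c₂ c₃ c₄ : ℂ} {s t : M → ℍ[ℝ]}

/-- The identity A(V) = 0 near x is differentiated, with the derivative of V expressed through the
covariant derivatives of s and t. The result has the form required by `exterior_of_annihilates`. -/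
theorem IsKillingPair.dir_annihilates (h : IsKillingPair g U e A c₀ c₁ c₂ c₃ c₄ s t) {x : M}
    (hx : x ∈ U) {u : ℍ[ℝ]}
    (hu : ∀ᶠ y in 𝓝 x, ∑ a, A a y * vec (s y) (t y) u a = 0) (b : Fin 4) :
    ∑ a, dR (e b) (A a) x * vec (s x) (t x) u a =
      - (star (dir (e b) s x + gam g e b x * s x) * (vecQuat (fun a => A a x) * (t x * u))
        + star (s x) * (vecQuat (fun a => A a x) * ((dir (e b) t x + gam' g e b x * t x) * u))).re
      - ∑ a, ∑ c, A a x * leviCivita g e b a c x * vec (s x) (t x) u c := by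
  set N := dir (e b) s x + gam g e b x * s x with hN
  set M := dir (e b) t x + gam' g e b x * t x with hM
  have hs : HasDir (e b) s x (N - gam g e b x * s x) :=
    ⟨mdifferentiableAt_of_contMDiffOn h.isOpen h.smooth_s hx, by rw [hN]; abel⟩
  have ht : HasDir (e b) t x (M - gam' g e b x * t x) :=
    ⟨mdifferentiableAt_of_contMDiffOn h.isOpen h.smooth_t hx, by rw [hM]; abel⟩
  have hA : ∀ a, HasDir (e b) (A a) x (dR (e b) (A a) x) := fun a =>
    .of_mdifferentiableAt (mdifferentiableAt_of_contMDiffOn h.isOpen (h.smooth_A a) hx)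
  have hq := fun a => (hA a).smul ((ht.mul_const u).const_mul (qu a))
  have hd := (hs.star.mul ((((hq 0).add (hq 1)).add (hq 2)).add (hq 3))).clm reCLM
  have h0 : (fun y => reCLM (star (s y) * (A 0 y • (qu 0 * (t y * u)) + A 1 y • (qu 1 * (t y * u))
      + A 2 y • (qu 2 * (t y * u)) + A 3 y • (qu 3 * (t y * u))))) =ᶠ[𝓝 x] fun _ => (0 : ℝ) := by
    filter_upwards [hu] with y hy
    rw [← hy, sum_mul_vec, vecQuat, Fin.sum_univ_four]
    simp only [add_mul, smul_mul_assoc]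
    rfl
  have h1 := hd.2
  rw [dir_congr h0, dir_const] at h1
  have hG : ∀ a (z : ℍ[ℝ]), gam g e b x * (qu a * z) =
      qu a * (gam' g e b x * z) + (∑ c, leviCivita g e b a c x • qu c) * z := by
    intro a z
    rw [← mul_assoc, gam_mul_qu, add_mul, mul_assoc]
  have e1 : ∑ a, dR (e b) (A a) x * vec (s x) (t x) u a =
      reCLM (star (s x) * ∑ a, dR (e b) (A a) x • (qu a * (t x * u))) := by
    rw [sum_mul_vec, vecQuat]
    simp only [Finset.sum_mul, smul_mul_assoc]
    rfl
  have e2 : ∑ a, ∑ c, A a x * leviCivita g e b a c x * vec (s x) (t x) u c =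
      reCLM (star (s x) * ∑ a, A a x • ((∑ c, leviCivita g e b a c x • qu c) * (t x * u))) := by
    rw [Finset.mul_sum, map_sum]
    refine Finset.sum_congr rfl fun a _ => ?_
    simp only [mul_assoc]
    rw [← Finset.mul_sum, sum_mul_vec, mul_smul_comm, map_smul]
    rfl
  have e3 : ∀ q : ℍ[ℝ], q.re = reCLM q := fun _ => rfl
  rw [e1, e2, e3, ← map_neg, ← map_sub, ← sub_eq_zero, ← map_sub]
  refine Eq.trans ?_ h1.symm
  congr 1
  unfold vecQuat
  simp only [Fin.sum_univ_four, mul_add, add_mul, sub_mul, mul_sub, smul_add, smul_sub,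
    smul_mul_assoc, mul_smul_comm, star_sub, star_mul, star_gam, mul_neg, neg_mul, mul_assoc, hG]
  module

/-- Since A(V) = 0, contraction with V removes the gauge terms c₀ and c₃ from the Killing equations.
-/
theorem sum_vec_mul {A V : Fin 4 → ℝ} {Φ s t u a : ℍ[ℝ]} {c₀ c₁ c₂ c₃ c₄ : ℂ} {N T : Fin 4 → ℍ[ℝ]}
    (hN : ∀ b, N b = -(A b • (s * c₀)) + kap • (Φ * (qu b * (t * c₁)) + qu b * (t * c₂)))
    (hT : ∀ b, T b = -(A b • (t * c₃)) - kap • (star (qu b) * (s * c₄)))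
    (hV : ∑ b, A b * V b = 0) {Q : ℍ[ℝ]} (hQ : ∑ b, V b • qu b = Q) :
    ∑ b, V b * (star (N b) * (a * (t * u)) + star s * (a * (T b * u))).re =
      kap * (star (Φ * (Q * (t * c₁)) + Q * (t * c₂)) * (a * (t * u))
        - star s * (a * (star Q * (s * c₄) * u))).re := by
  have hN' : ∑ b, V b • N b = kap • (Φ * (Q * (t * c₁)) + Q * (t * c₂)) := by
    have h1 : ∀ b, V b • N b = -((A b * V b) • (s * c₀))
        + kap • (Φ * ((V b • qu b) * (t * c₁)) + (V b • qu b) * (t * c₂)) := by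
      intro b
      rw [hN]
      simp only [smul_mul_assoc, mul_smul_comm]
      module
    simp only [h1, Finset.sum_add_distrib, Finset.sum_neg_distrib, ← Finset.sum_smul, hV, zero_smul,
      neg_zero, zero_add, ← Finset.smul_sum, ← Finset.mul_sum, ← Finset.sum_mul, hQ]
  have hT' : ∑ b, V b • T b = -(kap • (star Q * (s * c₄))) := by
    have h1 : ∀ b, V b • T b = -((A b * V b) • (t * c₃))
        - kap • (star (V b • qu b) * (s * c₄)) := by
      intro b
      rw [hT, Quaternion.star_smul]
      simp only [smul_mul_assoc]
      module
    simp only [h1, Finset.sum_sub_distrib, Finset.sum_neg_distrib, ← Finset.sum_smul, hV, zero_smul,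
      neg_zero, zero_sub, ← Finset.smul_sum, ← Finset.sum_mul, ← star_sum, hQ]
  have h2 : ∀ (r : ℝ) (q : ℍ[ℝ]), r * q.re = reCLM (r • q) := fun _ _ => rfl
  have h3 : ∑ b, V b • (star (N b) * (a * (t * u)) + star s * (a * (T b * u))) =
      star (∑ b, V b • N b) * (a * (t * u)) + star s * (a * ((∑ b, V b • T b) * u)) := by
    simp only [star_sum, Quaternion.star_smul, Finset.sum_mul, Finset.mul_sum, smul_add,
      Finset.sum_add_distrib, smul_mul_assoc, mul_smul_comm]
  simp only [h2]
  rw [← map_sum, h3, hN', hT', Quaternion.star_smul]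
  congr 1
  simp only [smul_mul_assoc, mul_smul_comm, neg_mul, mul_neg, smul_sub]
  abel

theorem cross_term {Φ s t a : ℍ[ℝ]} {h : ℂ} {f : ℍ[ℝ]} (hs : s ≠ 0) (hΦ : Φ.re = 0)
    (hh : star s * (a * t) = h) (hf : star s * (Φ * s) = f) (u u' : ℍ[ℝ]) (c₁ c₂ c₄ : ℂ) :
    star (Φ * (s * (star u' * star t) * (t * c₁)) + s * (star u' * star t) * (t * c₂)) *
        (a * (t * u)) - star s * (a * (star (s * (star u' * star t)) * (s * c₄) * u)) =
      Quaternion.normSq t • (-((Quaternion.normSq s)⁻¹ • (star (c₁ : ℍ[ℝ]) * (u' * (f * (h * u)))))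
        + star (c₂ : ℍ[ℝ]) * (u' * (h * u))) - Quaternion.normSq s • (h * (u' * (c₄ * u))) := by
  have hss : ∀ q : ℍ[ℝ], star s * (s * q) = Quaternion.normSq s • q := fun q => by
    rw [← mul_assoc, Quaternion.star_mul_self, Quaternion.coe_mul_eq_smul]
  have hss' : ∀ q : ℍ[ℝ], s * (star s * q) = Quaternion.normSq s • q := fun q => by
    rw [← mul_assoc, Quaternion.self_mul_star, Quaternion.coe_mul_eq_smul]
  have htt : ∀ q : ℍ[ℝ], star t * (t * q) = Quaternion.normSq t • q := fun q => by
    rw [← mul_assoc, Quaternion.star_mul_self, Quaternion.coe_mul_eq_smul]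
  have hσ : Quaternion.normSq s ≠ 0 := Quaternion.normSq_ne_zero.2 hs
  have hΦ' : star Φ = - Φ := by
    apply Quaternion.ext <;> simp [hΦ]
  have h1 : star s * (Φ * (a * (t * u))) = (Quaternion.normSq s)⁻¹ • (f * (h * u)) := by
    rw [← hf, ← hh]
    simp only [mul_assoc, hss', mul_smul_comm, smul_smul, inv_mul_cancel₀ hσ, one_smul]
  have h2 : ∀ q, star s * (a * (t * q)) = h * q := fun q => by
    rw [← hh]; simp only [mul_assoc]
  simp only [star_add, star_mul, star_star, mul_assoc, add_mul, htt, hss, hΦ', mul_smul_comm,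
    neg_mul, mul_neg, h1, h2, smul_add, smul_neg, Quaternion.star_smul, smul_mul_assoc]

/-- The unit `K`. -/
def unitK : ℍ[ℝ] := mkH 0 0 0 1

/-- `rigidity` alone is not contradictory at a single point; the contradiction comes from using it
on a neighbourhood and computing F = dA on two vector fields that A annihilates. -/
theorem IsKillingPair.c₀_eq_c₃ (h : IsKillingPair g U e A c₀ c₁ c₂ c₃ c₄ s t) {x : M}
    (hx : x ∈ U) (hs : s x ≠ 0) (ht : t x ≠ 0) (hF : maxwell g e A x ≠ 0) : c₀ = c₃ := by
  by_contra hd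
  set D : ℂ := (kap / 2 : ℝ) * (c₀ - c₃) with hD
  have hk : kap ≠ 0 := fun h0 => by simpa [h0] using kap_mul_kap
  have hD0 : D ≠ 0 := by
    rw [hD]
    refine mul_ne_zero ?_ (sub_ne_zero.2 hd)
    exact Complex.ofReal_ne_zero.2 (by simpa using hk)
  have hrig : ∀ y ∈ U, s y ≠ 0 → t y ≠ 0 → maxwell g e A y ≠ 0 → ∃ (S : ℝ) (z : ℂ) (p : ℝ),
      star (s y) * (vecQuat (fun a => A a y) * t y) = z ∧
      star (s y) * (maxwell g e A y * s y) = mkH 0 p 0 0 ∧ p ≠ 0 ∧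
      conj z * (D * c₄) = (Quaternion.normSq (t y) : ℝ) * (S + c₂ * c₄) ∧
      (Quaternion.normSq (t y) : ℝ) *
          ((Quaternion.normSq (s y) : ℝ) * (c₂ * D) - Complex.I * p * (c₁ * D)) =
        ((Quaternion.normSq (s y) : ℝ) : ℂ) ^ 2 * conj (D * c₄) ∧
      (c₀ - c₃) * p = 4 * (Quaternion.normSq (s y) : ℝ) * (c₂ * c₄).im := by
    intro y hy hsy hty hFy
    have hI := h.integrabilityConditions hy
    obtain ⟨S, hpp, hS⟩ := hI.pp_eq hty
    obtain ⟨z, p, hz, -, hp, hp0, h1, h2, h3⟩ := (hI.sandwich hsy hty hpp hS).rigidity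
      (Quaternion.normSq_ne_zero.2 hsy) (Quaternion.normSq_ne_zero.2 hty)
      (mul_ne_zero (star_ne_zero.2 hsy) (mul_ne_zero hFy hsy)) hD0 hd
    exact ⟨S, z, p, hz, hp, hp0, h1, h2, h3⟩
  -- A paired with `vec s t u` is Re(Hu), which vanishes for u = J and u = K exactly because H is
  -- complex.
  have hvec : ∀ y ∈ U, s y ≠ 0 → t y ≠ 0 → maxwell g e A y ≠ 0 →
      ∑ a, A a y * vec (s y) (t y) unitJ a = 0 ∧ ∑ a, A a y * vec (s y) (t y) unitK a = 0 := by
    intro y hy hsy hty hFy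
    obtain ⟨-, z, -, hz, -⟩ := hrig y hy hsy hty hFy
    rw [sum_mul_vec, sum_mul_vec, ← mul_assoc (vecQuat _), ← mul_assoc, hz,
      ← mul_assoc (vecQuat _) _ unitK, ← mul_assoc (star _), hz]
    simp [unitJ, unitK]
  have hev : ∀ᶠ y in 𝓝 x, y ∈ U ∧ s y ≠ 0 ∧ t y ≠ 0 ∧ maxwell g e A y ≠ 0 := by
    filter_upwards [h.isOpen.mem_nhds hx,
      (mdifferentiableAt_of_contMDiffOn h.isOpen h.smooth_s hx).continuousAt.eventually_ne hs,
      (mdifferentiableAt_of_contMDiffOn h.isOpen h.smooth_t hx).continuousAt.eventually_ne ht,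
      (h.mdifferentiableAt_maxwell hx).continuousAt.eventually_ne hF] with y h1 h2 h3 h4
    exact ⟨h1, h2, h3, h4⟩
  have dJ := h.dir_annihilates hx (u := unitJ) (by
    filter_upwards [hev] with y hy
    exact (hvec y hy.1 hy.2.1 hy.2.2.1 hy.2.2.2).1)
  have dK := h.dir_annihilates hx (u := unitK) (by
    filter_upwards [hev] with y hy
    exact (hvec y hy.1 hy.2.1 hy.2.2.1 hy.2.2.2).2)
  obtain ⟨vJ, vK⟩ := hvec x hx hs ht hF
  obtain ⟨S, z, p, hz, hf, hp, h1, h2, h3⟩ := hrig x hx hs ht hF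
  have hext := exterior_of_annihilates (fun b a c => leviCivita_swap g e b a c x) dJ dK
  have hext' : ∀ b a, dR (e b) (A a) x - dR (e a) (A b) x
      - ∑ c, (leviCivita g e b a c x - leviCivita g e a b c x) * A c x = extDer g e A b a x := by
    intro b a
    simp only [extDer, structFun_eq]
  have hN := h.eq_s x hx
  have hT := h.eq_t x hx
  simp only [hext'] at hext
  rw [two_form_eq (fun a b => extDer_swap g e A a b x) (h.asd x hx), sum_vec, sum_vec,
    sum_vec_mul hN hT vK (sum_vec _ _ _), sum_vec_mul hN hT vJ (sum_vec _ _ _),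
    cross_term hs rfl hz hf, cross_term hs rfl hz hf] at hext
  have hl : (asdQuat (fun a b => extDer g e A a b x) * (s x * (star unitK * star (t x)) *
      star (s x * (star unitJ * star (t x))))).re = -(Quaternion.normSq (t x) * p) := by
    have k1 : s x * (star unitK * star (t x)) * star (s x * (star unitJ * star (t x))) =
        Quaternion.normSq (t x) • (s x * (star unitK * (unitJ * star (s x)))) := by
      have k2 : star (t x) * (t x * (unitJ * star (s x))) =
          Quaternion.normSq (t x) • (unitJ * star (s x)) := by
        rw [← mul_assoc, Quaternion.star_mul_self, Quaternion.coe_mul_eq_smul]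
      simp only [star_mul, star_star, mul_assoc, k2, mul_smul_comm]
    have k3 : (maxwell g e A x * (s x * (star unitK * (unitJ * star (s x))))).re = -p := by
      have k4 : maxwell g e A x * (s x * (star unitK * (unitJ * star (s x)))) =
          (maxwell g e A x * s x * (star unitK * unitJ)) * star (s x) := by
        simp only [mul_assoc]
      rw [k4, re_mul_comm, ← mul_assoc, hf]
      simp [unitJ, unitK]
    rw [k1, mul_smul_comm, Quaternion.re_smul, smul_eq_mul]
    change _ * (maxwell g e A x * _).re = _
    rw [k3]
    ring
  rw [hl] at hext
  clear hl hN hT hext' dJ dK hev hvec hrig hz hf vJ vK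
  have hσ0 := Quaternion.normSq_ne_zero.2 hs
  have hτ0 := Quaternion.normSq_ne_zero.2 ht
  generalize Quaternion.normSq (s x) = σ at *
  generalize Quaternion.normSq (t x) = τ at *
  simp [unitJ, unitK] at hext
  -- The last relation of `rigidity` makes c₀ - c₃, and with it D, real. Consequently Im(c₂c₄) is
  -- nonzero.
  obtain ⟨r, hr, hrp⟩ : ∃ r : ℝ, D = r ∧ r * p = 2 * kap * σ * (c₂ * c₄).im := by
    have h4 : c₀ - c₃ = ((4 * σ * (c₂ * c₄).im / p : ℝ) : ℂ) := by
      push_cast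
      rw [eq_div_iff (Complex.ofReal_ne_zero.2 hp), h3]
    refine ⟨kap / 2 * (4 * σ * (c₂ * c₄).im / p), by rw [hD, h4]; push_cast; ring, ?_⟩
    field_simp
    ring
  rw [hr] at h1 h2 hD0
  have k1 := congrArg Complex.im h1
  have k2 := congrArg Complex.im (congrArg (fun w => z * w) h2)
  have hb : (c₂ * c₄).im ≠ 0 := by
    intro hb
    rw [hb, mul_zero] at hrp
    exact mul_ne_zero (Complex.ofReal_ne_zero.1 hD0) hp hrp
  generalize hβ : (c₂ * c₄).im = β at *
  have k3 : r * (z.re * c₄.im - z.im * c₄.re) = τ * β := by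
    rw [← hβ]
    simp at k1 ⊢
    linear_combination k1
  have k4 : τ * r * (σ * (z.re * c₂.im + z.im * c₂.re) - p * (z.re * c₁.re - z.im * c₁.im)) =
      σ ^ 2 * r * (z.im * c₄.re - z.re * c₄.im) := by
    simp [pow_two] at k2
    linear_combination k2
  have k5 : τ * p * σ = 2 * kap * (τ * p * (z.re * c₁.re - z.im * c₁.im)
      - τ * σ * (z.re * c₂.im + z.im * c₂.re) - σ ^ 2 * (z.im * c₄.re - z.re * c₄.im)) := by
    field_simp at hext
    linear_combination -hext
  -- `k5` is the value of F on the two fields; `k3` and `k4` are imaginary parts of the relations of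
  -- `rigidity`. Eliminating c₁, c₂ and z leaves a product of nonzero factors.
  have k6 : 2 * kap * σ ^ 2 * τ * β = 0 := by
    linear_combination (τ * σ) * hrp - r * k5 + 2 * kap * k4 - 4 * kap * σ ^ 2 * k3
  simp [hk, hσ0, hτ0, hb] at k6

end

/-! ### Unique continuation for linear first-order systems. -/

section

section UniqueContinuation

variable {F : Type*} [NormedAddCommGroup F] [NormedSpace ℝ F]

/-- A linear map that is small on a frame is small, locally uniformly in the frame. -/
theorem eventually_opNorm_le {V : Fin 4 → E4 → E4} {z₀ : E4} (hV : ∀ a, ContinuousAt (V a) z₀)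
    (hli : LinearIndependent ℝ fun a => V a z₀) :
    ∃ C : ℝ, 0 ≤ C ∧ ∀ᶠ z in 𝓝 z₀, ∀ (T : E4 →L[ℝ] F) (K : ℝ), (∀ a, ‖T (V a z)‖ ≤ K) →
      ‖T‖ ≤ C * K := by
  set b := basisOfLinearIndependentOfCardEqFinrank hli (by simp) with hb
  have hbV : ∀ a, b a = V a z₀ := fun a => by simp [hb]
  set L := b.equivFunL with hL
  set C₀ := ‖(L : E4 →L[ℝ] Fin 4 → ℝ)‖ + 1 with hC₀
  have hC₀' : 0 < C₀ := by positivity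
  have hcoord : ∀ w a, ‖L w a‖ ≤ C₀ * ‖w‖ := by
    intro w a
    calc ‖L w a‖ ≤ ‖L w‖ := norm_le_pi_norm _ a
      _ ≤ ‖(L : E4 →L[ℝ] Fin 4 → ℝ)‖ * ‖w‖ := (L : E4 →L[ℝ] Fin 4 → ℝ).le_opNorm w
      _ ≤ C₀ * ‖w‖ := by gcongr; simp [hC₀]
  -- Each of the four coordinates costs C₀, and a frame perturbation of size 1/(8C₀) costs ‖T‖/2 in
  -- all; absorbing that half doubles 4C₀.
  refine ⟨8 * C₀, by positivity, ?_⟩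
  have hev : ∀ᶠ z in 𝓝 z₀, ∀ a, ‖V a z - V a z₀‖ ≤ (8 * C₀)⁻¹ := by
    rw [Filter.eventually_all]
    intro a
    have h1 := Metric.continuousAt_iff'.1 (hV a) (8 * C₀)⁻¹ (by positivity)
    filter_upwards [h1] with z hz
    rw [← dist_eq_norm]
    exact hz.le
  filter_upwards [hev] with z hz T K hK
  have hK0 : 0 ≤ K := (norm_nonneg _).trans (hK 0)
  have h1 : ‖T‖ ≤ 4 * C₀ * K + ‖T‖ / 2 := by
    refine T.opNorm_le_bound (by positivity) fun w => ?_
    have h2 : T w = ∑ a, L w a • (T (V a z) - T (V a z - V a z₀)) := by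
      conv_lhs => rw [← b.sum_equivFun w, map_sum]
      refine Finset.sum_congr rfl fun a _ => ?_
      rw [map_smul, hbV, ← map_sub, sub_sub_cancel]
      rfl
    rw [h2]
    calc ‖∑ a, L w a • (T (V a z) - T (V a z - V a z₀))‖
        ≤ ∑ a : Fin 4, C₀ * ‖w‖ * (K + ‖T‖ * (8 * C₀)⁻¹) := by
          refine norm_sum_le_of_le _ fun a _ => ?_
          rw [norm_smul]
          refine mul_le_mul (hcoord w a) ?_ (norm_nonneg _) (by positivity)
          refine (norm_sub_le _ _).trans (add_le_add (hK a) ?_)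
          exact (T.le_opNorm _).trans (mul_le_mul_of_nonneg_left (hz a) (norm_nonneg _))
      _ = (4 * C₀ * K + ‖T‖ / 2) * ‖w‖ := by
          rw [Finset.sum_const, Finset.card_univ, Fintype.card_fin]
          field_simp
          ring
  linarith

/-- A function on a ball whose derivative is bounded by its values vanishes if it does at the
centre. -/
theorem eqOn_zero_of_norm_fderiv_le {u : E4 → F} {z₀ : E4} {r C : ℝ}
    (hu : ∀ z ∈ Metric.ball z₀ r, DifferentiableAt ℝ u z)
    (hC : ∀ z ∈ Metric.ball z₀ r, ‖fderiv ℝ u z‖ ≤ C * ‖u z‖) (h0 : u z₀ = 0) :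
    ∀ z ∈ Metric.ball z₀ r, u z = 0 := by
  intro z hz
  have hmem : ∀ τ ∈ Set.Icc (0 : ℝ) 1, z₀ + τ • (z - z₀) ∈ Metric.ball z₀ r := by
    intro τ hτ
    rw [mem_ball_iff_norm, add_sub_cancel_left, norm_smul, Real.norm_of_nonneg hτ.1]
    rw [mem_ball_iff_norm] at hz
    exact (mul_le_of_le_one_left (norm_nonneg _) hτ.2).trans_lt hz
  have hd : ∀ τ ∈ Set.Icc (0 : ℝ) 1, HasDerivAt (fun τ : ℝ => u (z₀ + τ • (z - z₀)))
      (fderiv ℝ u (z₀ + τ • (z - z₀)) (z - z₀)) τ := by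
    intro τ hτ
    have h1 : HasDerivAt (fun τ : ℝ => z₀ + τ • (z - z₀)) (z - z₀) τ := by
      simpa using ((hasDerivAt_id τ).smul_const (z - z₀)).const_add z₀
    exact (hu _ (hmem τ hτ)).hasFDerivAt.comp_hasDerivAt τ h1
  -- Grönwall's inequality along the segment from the centre to z.
  have h1 := eq_zero_of_abs_deriv_le_mul_abs_self_of_eq_zero_right (a := 0) (b := 1)
    (f := fun τ : ℝ => u (z₀ + τ • (z - z₀)))
    (f' := fun τ : ℝ => fderiv ℝ u (z₀ + τ • (z - z₀)) (z - z₀)) (K := C * ‖z - z₀‖)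
    (fun τ hτ => (hd τ hτ).continuousAt.continuousWithinAt)
    (fun τ hτ => (hd τ ⟨hτ.1, hτ.2.le⟩).hasDerivWithinAt) (by simpa using h0)
    (fun τ hτ => by
      refine ((fderiv ℝ u _).le_opNorm _).trans ?_
      have h2 := mul_le_mul_of_nonneg_right (hC _ (hmem τ ⟨hτ.1, hτ.2.le⟩)) (norm_nonneg (z - z₀))
      exact h2.trans (le_of_eq (by ring))) 1 (by simp)
  simpa using h1

variable {M : Type*} [TopologicalSpace M] [ChartedSpace E4 M] [IsManifold 𝓘(ℝ, E4) ∞ M]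
variable {g : Metric4 M} {U : Set M} {e : Fin 4 → VField M}

/-- In a chart the frame is continuous and independent at the centre, so bounds on the four frame
derivatives bound the full derivative, and Grönwall's inequality applies on a small ball. -/
theorem IsOrthonormalFrame.eventually_eq_zero (he : IsOrthonormalFrame g U e) (hU : IsOpen U)
    {f : M → F} (hf : ContMDiffOn 𝓘(ℝ, E4) 𝓘(ℝ, F) ∞ f U) {x : M} (hx : x ∈ U)
    (hC : ∀ a, ∃ C : ℝ, ∀ᶠ y in 𝓝 x, ‖dir (e a) f y‖ ≤ C * ‖f y‖) (h0 : f x = 0) :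
    ∀ᶠ y in 𝓝 x, f y = 0 := by
  have : IsManifold 𝓘(ℝ, E4) 1 M := IsManifold.of_le (n := ∞) (by simp)
  set φ := extChartAt 𝓘(ℝ, E4) x with hφ
  have hUx : U ∈ 𝓝 x := hU.mem_nhds hx
  have hsx : φ.symm (φ x) = x := extChartAt_to_inv x
  have hr : Set.range 𝓘(ℝ, E4) = Set.univ := 𝓘(ℝ, E4).range_eq_univ
  set V : Fin 4 → E4 → E4 := fun a =>
    VectorField.mpullbackWithin 𝓘(ℝ, E4) 𝓘(ℝ, E4) φ.symm (e a) (Set.range 𝓘(ℝ, E4)) with hV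
  have hVc : ∀ a, ContinuousAt (V a) (φ x) := by
    intro a
    have h1 : MDifferentiableWithinAt 𝓘(ℝ, E4) 𝓘(ℝ, E4).tangent
        (fun x => (e a x : TangentBundle 𝓘(ℝ, E4) M)) Set.univ x :=
      (((he.1 a x hx).contMDiffAt hUx).mdifferentiableAt (by simp)).mdifferentiableWithinAt
    have h2 := h1.differentiableWithinAt_mpullbackWithin_vectorField
    have hs : (extChartAt 𝓘(ℝ, E4) x).symm ⁻¹' Set.univ ∩ Set.range 𝓘(ℝ, E4) ∈
        𝓝 (extChartAt 𝓘(ℝ, E4) x x) := by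
      rw [hr, Set.preimage_univ, Set.univ_inter]; exact Filter.univ_mem
    exact (h2.differentiableAt hs).continuousAt
  have hVli : LinearIndependent ℝ fun a => V a (φ x) := by
    rw [Fintype.linearIndependent_iff]
    intro c hc
    have hinv := isInvertible_mfderivWithin_extChartAt_symm (I := 𝓘(ℝ, E4))
      (mem_extChartAt_target (I := 𝓘(ℝ, E4)) x)
    have h1 := congrArg (mfderivWithin 𝓘(ℝ, E4) 𝓘(ℝ, E4) φ.symm (Set.range 𝓘(ℝ, E4)) (φ x)) hc
    have h2 : ∑ a, c a • e a (φ.symm (φ x)) = 0 := by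
      refine Eq.trans ?_ (h1.trans (map_zero _))
      refine Eq.trans ?_ (map_sum _ _ _).symm
      refine Finset.sum_congr rfl fun a _ => ?_
      refine Eq.trans ?_ (map_smul _ _ _).symm
      congr 1
      exact (hinv.self_apply_inverse _).symm
    exact he.linearIndependent (by rw [hsx]; exact hx) h2
  obtain ⟨C, hC0, hop⟩ := eventually_opNorm_le (F := F) hVc hVli
  choose K hK using hC
  have hsc : ContinuousAt φ.symm (φ x) := continuousAt_extChartAt_symm x
  have hfx : ∀ᶠ z in 𝓝 (φ x), z ∈ φ.target ∧ φ.symm z ∈ U ∧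
      (∀ a, ‖dir (e a) f (φ.symm z)‖ ≤ K a * ‖f (φ.symm z)‖) ∧
      ∀ (T : E4 →L[ℝ] F) (K : ℝ), (∀ a, ‖T (V a z)‖ ≤ K) → ‖T‖ ≤ C * K := by
    have h1 : ∀ᶠ y in 𝓝 x, y ∈ U ∧ ∀ a, ‖dir (e a) f y‖ ≤ K a * ‖f y‖ :=
      (Filter.eventually_of_mem hUx fun _ h => h).and (Filter.eventually_all.2 hK)
    rw [← hsx] at h1
    have h2 := hsc.eventually h1
    filter_upwards [extChartAt_target_mem_nhds (I := 𝓘(ℝ, E4)) x, h2, hop] with z h3 h4 h5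
    exact ⟨h3, h4.1, h4.2, h5⟩
  obtain ⟨r, hr0, hball⟩ := Metric.eventually_nhds_iff_ball.1 hfx
  have hzero := eqOn_zero_of_norm_fderiv_le (u := f ∘ φ.symm) (z₀ := φ x) (r := r)
    (C := C * ∑ a, |K a|) (fun z hz => ?_) (fun z hz => ?_) (by simp [hsx, h0])
  · have h1 : ∀ᶠ y in 𝓝 x, φ y ∈ Metric.ball (φ x) r :=
      (continuousAt_extChartAt x).eventually (Metric.ball_mem_nhds _ hr0)
    filter_upwards [h1, extChartAt_source_mem_nhds (I := 𝓘(ℝ, E4)) x] with y hy hy'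
    have h2 := hzero _ hy
    rwa [Function.comp, φ.left_inv hy'] at h2
  · obtain ⟨h1, h2, -, -⟩ := hball z hz
    have hd := mdifferentiableWithinAt_extChartAt_symm (I := 𝓘(ℝ, E4)) h1
    rw [hr, mdifferentiableWithinAt_univ] at hd
    exact ((mdifferentiableAt_of_contMDiffOn hU hf h2).comp z hd).differentiableAt
  · obtain ⟨h1, h2, h3, h4⟩ := hball z hz
    refine (h4 (fderiv ℝ (f ∘ φ.symm) z) ((∑ a, |K a|) * ‖f (φ.symm z)‖) fun a => ?_).trans
      (le_of_eq (by simp only [Function.comp]; ring))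
    have h5 := dir_symm_extChartAt (e a) x h1 (mdifferentiableAt_of_contMDiffOn hU hf h2)
    rw [← hφ] at h5
    change ‖fderiv ℝ (f ∘ φ.symm) z (VectorField.mpullbackWithin _ _ _ _ _ _)‖ ≤ _
    rw [← h5]
    refine (h3 a).trans (mul_le_mul_of_nonneg_right ?_ (norm_nonneg _))
    exact (le_abs_self _).trans
      (Finset.single_le_sum (f := fun a => |K a|) (fun a _ => abs_nonneg _) (Finset.mem_univ a))

/-- Local solutions of a linear system of first order that agree up to automorphisms on overlaps
vanish identically if they vanish somewhere. -/
theorem SpinStructure.eq_zero_of_eq_zero [ConnectedSpace M] (S : SpinStructure g)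
    {ψ : S.ι → M → F} (hψ : ∀ i, ContMDiffOn 𝓘(ℝ, E4) 𝓘(ℝ, F) ∞ (ψ i) (S.U i))
    (hch : ∀ i j, ∀ x ∈ S.U i ∩ S.U j, ψ j x = 0 → ψ i x = 0)
    (hC : ∀ i, ∀ x ∈ S.U i, ∀ a, ∃ C : ℝ, ∀ᶠ y in 𝓝 x, ‖dir (S.e i a) (ψ i) y‖ ≤ C * ‖ψ i y‖)
    {i₀ : S.ι} {x₀ : M} (hx₀ : x₀ ∈ S.U i₀) (h0 : ψ i₀ x₀ = 0) :
    ∀ i, ∀ x ∈ S.U i, ψ i x = 0 := by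
  -- The zero set does not depend on the frame; it is closed by continuity and open by local
  -- uniqueness.
  set Z : Set M := {x | ∀ i, x ∈ S.U i → ψ i x = 0} with hZ
  have hZi : ∀ i, ∀ x ∈ S.U i, ψ i x = 0 → x ∈ Z := fun i x hx h j hj => hch j i x ⟨hj, hx⟩ h
  have hopen : IsOpen Z := by
    rw [isOpen_iff_mem_nhds]
    intro x hx
    obtain ⟨i, hi⟩ := S.covers x
    filter_upwards [(S.frame i).eventually_eq_zero (S.isOpen_U i) (hψ i) hi (hC i x hi) (hx i hi),
      (S.isOpen_U i).mem_nhds hi] with y hy hyi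
    exact hZi i y hyi hy
  have hclosed : IsClosed Z := by
    rw [← isOpen_compl_iff, isOpen_iff_mem_nhds]
    intro x hx
    obtain ⟨i, hi⟩ := S.covers x
    have h1 : ψ i x ≠ 0 := fun h => hx (hZi i x hi h)
    filter_upwards [(mdifferentiableAt_of_contMDiffOn (S.isOpen_U i) (hψ i)
      hi).continuousAt.eventually_ne h1, (S.isOpen_U i).mem_nhds hi] with y hy hyi h
    exact hy (h i hyi)
  have huniv : Z = Set.univ :=
    IsClopen.eq_univ ⟨hclosed, hopen⟩ ⟨x₀, hZi i₀ x₀ hx₀ h0⟩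
  intro i x hx
  have h2 : x ∈ Z := huniv ▸ Set.mem_univ x
  exact h2 i hx

end UniqueContinuation

end

/-! ### Local bounds, local non-vanishing, and extension from dense sets. -/

section

/-- The case a = 0 gives tc₂ = -Φtc₁. If c₁ ≠ 0, the other cases then make Φ commute with every
unit, so Φ is real as well as imaginary. -/
theorem eq_zero_of_killing_terms {Φ t : ℍ[ℝ]} {c₁ c₂ : ℂ} (hΦ : Φ.re = 0) (hΦ0 : Φ ≠ 0) (ht : t ≠ 0)
    (h : ∀ a, Φ * (qu a * (t * c₁)) + qu a * (t * c₂) = 0) : c₁ = 0 ∧ c₂ = 0 := by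
  have h0 : ∀ q : ℍ[ℝ], qu 0 * q = q := fun q => by
    have h1 : qu 0 = 1 := rfl
    rw [h1, one_mul]
  have hc₁ : c₁ = 0 := by
    by_contra hc
    have hy : t * (c₁ : ℍ[ℝ]) ≠ 0 := mul_ne_zero ht (by rwa [Ne, coeComplex_eq_zero])
    have h1 := h 0
    rw [h0, h0] at h1
    have h2 : ∀ a, Φ * qu a = qu a * Φ := by
      intro a
      refine mul_right_cancel₀ hy ?_
      have h3 := h a
      rw [eq_neg_of_add_eq_zero_right h1] at h3
      rw [mul_assoc, mul_assoc, ← sub_eq_zero, ← h3]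
      noncomm_ring
    refine hΦ0 ?_
    have h3 := congrArg (fun q : ℍ[ℝ] => q.imI) (h2 2)
    have h4 := congrArg (fun q : ℍ[ℝ] => q.imJ) (h2 3)
    have h5 := congrArg (fun q : ℍ[ℝ] => q.imK) (h2 2)
    simp [qu_two, qu_three] at h3 h4 h5
    refine Quaternion.ext _ _ hΦ ?_ ?_ ?_
    · change Φ.imI = 0
      linarith
    · have h6 := congrArg (fun q : ℍ[ℝ] => q.imK) (h2 3)
      simp [qu_three] at h6
      change Φ.imJ = 0
      linarith
    · change Φ.imK = 0
      linarith
  refine ⟨hc₁, ?_⟩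
  have h1 := h 0
  rw [hc₁, h0, h0, Quaternion.coeComplex_zero, mul_zero, mul_zero, zero_add] at h1
  exact coeComplex_eq_zero.1 ((mul_eq_zero.1 h1).resolve_left ht)

section

variable {M : Type*} [TopologicalSpace M] {U : Set M}

theorem eventually_norm_le {F : Type*} [NormedAddCommGroup F] {f : M → F} {x : M}
    (hf : ContinuousAt f x) : ∀ᶠ y in 𝓝 x, ‖f y‖ ≤ ‖f x‖ + 1 :=
  (hf.norm.eventually_lt continuousAt_const (lt_add_one _)).mono fun _ h => h.le

theorem continuousOn_sdPart {T : Fin 4 → Fin 4 → M → ℝ} (hT : ∀ a b, ContinuousOn (T a b) U)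
    (i : Fin 3) : ContinuousOn (fun y => sdPart i fun a b => T a b y) U := by
  fin_cases i
  · exact (hT 0 1).add (hT 2 3)
  · exact (hT 0 2).sub (hT 1 3)
  · exact (hT 0 3).add (hT 1 2)

theorem continuousOn_asdPart {T : Fin 4 → Fin 4 → M → ℝ} (hT : ∀ a b, ContinuousOn (T a b) U)
    (i : Fin 3) : ContinuousOn (fun y => asdPart i fun a b => T a b y) U := by
  fin_cases i
  · exact (hT 0 1).sub (hT 2 3)
  · exact (hT 0 2).add (hT 1 3)
  · exact (hT 0 3).sub (hT 1 2)

theorem isOpen_ne_zero {F : Type*} [NormedAddCommGroup F] {f : M → F} (hU : IsOpen U)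
    (hf : ∀ x ∈ U, ContinuousAt f x) : IsOpen (U ∩ f ⁻¹' {0}ᶜ) :=
  ContinuousOn.isOpen_inter_preimage (fun x hx => (hf x hx).continuousWithinAt) hU
    isOpen_compl_singleton

theorem eq_of_eq_on_dense {f : M → ℝ} (hU : IsOpen U) (hf : ContinuousOn f U) {c : ℝ}
    (h : ∀ V ⊆ U, IsOpen V → V.Nonempty → ∃ y ∈ V, f y = c) {x : M} (hx : x ∈ U) : f x = c := by
  by_contra hne
  obtain ⟨y, hy, hyc⟩ := h (U ∩ f ⁻¹' {c}ᶜ) Set.inter_subset_left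
    (hf.isOpen_inter_preimage hU isOpen_compl_singleton) ⟨x, hx, hne⟩
  exact hy.2 hyc

end

section

variable {M : Type*} [TopologicalSpace M] [ChartedSpace E4 M] [IsManifold 𝓘(ℝ, E4) ∞ M]
variable {g : Metric4 M} {U : Set M} {e : Fin 4 → VField M}
variable {A : Fin 4 → M → ℝ} {c₀ c₁ c₂ c₃ c₄ : ℂ} {s t : M → ℍ[ℝ]}

namespace IsKillingPair

/-- The constants are kept explicit in the cross terms, so that the s-equation decouples when c₁ =
c₂ = 0 and the t-equation when c₄ = 0. -/
theorem exists_bounds (h : IsKillingPair g U e A c₀ c₁ c₂ c₃ c₄ s t) {x : M} (hx : x ∈ U)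
    (a : Fin 4) : ∃ C : ℝ, 0 ≤ C ∧ ∀ᶠ y in 𝓝 x,
      ‖dir (e a) s y‖ ≤ C * ‖s y‖ + C * (‖(c₁ : ℍ[ℝ])‖ + ‖(c₂ : ℍ[ℝ])‖) * ‖t y‖ ∧
      ‖dir (e a) t y‖ ≤ C * ‖t y‖ + C * ‖(c₄ : ℍ[ℝ])‖ * ‖s y‖ := by
  have k1 := eventually_norm_le (h.frame.mdifferentiableAt_gam h.isOpen hx a).continuousAt
  have k2 := eventually_norm_le (h.frame.mdifferentiableAt_gam' h.isOpen hx a).continuousAt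
  have k3 := eventually_norm_le
    (mdifferentiableAt_of_contMDiffOn h.isOpen (h.smooth_A a) hx).continuousAt
  have k4 := eventually_norm_le (h.mdifferentiableAt_maxwell hx).continuousAt
  set G₁ := ‖gam g e a x‖ + 1
  set G₂ := ‖gam' g e a x‖ + 1
  set G₃ := ‖A a x‖ + 1
  set G₄ := ‖maxwell g e A x‖ + 1
  have p1 : 0 ≤ G₁ := by positivity
  have p2 : 0 ≤ G₂ := by positivity
  have p3 : 0 ≤ G₃ := by positivity
  have p4 : 0 ≤ G₄ := by positivity
  have hk : 0 ≤ kap := by unfold kap; positivity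
  set Q := kap * ‖qu a‖ with hQ
  have hQ0 : 0 ≤ Q := by positivity
  set m₀ := ‖(c₀ : ℍ[ℝ])‖
  set m₁ := ‖(c₁ : ℍ[ℝ])‖
  set m₂ := ‖(c₂ : ℍ[ℝ])‖
  set m₃ := ‖(c₃ : ℍ[ℝ])‖
  set m₄ := ‖(c₄ : ℍ[ℝ])‖
  have q0 : 0 ≤ m₀ := norm_nonneg _
  have q1 : 0 ≤ m₁ := norm_nonneg _
  have q2 : 0 ≤ m₂ := norm_nonneg _
  have q3 : 0 ≤ m₃ := norm_nonneg _
  have q4 : 0 ≤ m₄ := norm_nonneg _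
  refine ⟨G₁ + G₂ + G₃ * (m₀ + m₃) + Q * (G₄ + 1), by positivity, ?_⟩
  filter_upwards [k1, k2, k3, k4, h.isOpen.mem_nhds hx] with y l1 l2 l3 l4 hy
  constructor
  · have e1 : dir (e a) s y = -(A a y • (s y * c₀))
        + kap • (maxwell g e A y * (qu a * (t y * c₁)) + qu a * (t y * c₂))
        - gam g e a y * s y := eq_sub_of_add_eq (h.eq_s y hy a)
    rw [e1]
    have b1 : ‖A a y • (s y * (c₀ : ℍ[ℝ]))‖ ≤ G₃ * m₀ * ‖s y‖ := by
      rw [norm_smul, norm_mul]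
      calc ‖A a y‖ * (‖s y‖ * m₀) ≤ G₃ * (‖s y‖ * m₀) := by gcongr
        _ = _ := by ring
    have b2 : ‖gam g e a y * s y‖ ≤ G₁ * ‖s y‖ := by
      rw [norm_mul]; gcongr
    have b3 : ‖kap • (maxwell g e A y * (qu a * (t y * (c₁ : ℍ[ℝ]))) + qu a * (t y * (c₂ : ℍ[ℝ])))‖ ≤
        Q * (G₄ * m₁ + m₂) * ‖t y‖ := by
      rw [norm_smul, Real.norm_of_nonneg hk]
      calc kap * ‖maxwell g e A y * (qu a * (t y * (c₁ : ℍ[ℝ]))) + qu a * (t y * (c₂ : ℍ[ℝ]))‖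
          ≤ kap * (G₄ * (‖qu a‖ * (‖t y‖ * m₁)) + ‖qu a‖ * (‖t y‖ * m₂)) := by
            gcongr
            refine (norm_add_le _ _).trans ?_
            simp only [norm_mul]
            gcongr
        _ = _ := by rw [hQ]; ring
    refine (norm_sub_le _ _).trans ?_
    refine (add_le_add (norm_add_le _ _) le_rfl).trans ?_
    rw [norm_neg]
    have b4 : Q * (G₄ * m₁ + m₂) ≤
        (G₁ + G₂ + G₃ * (m₀ + m₃) + Q * (G₄ + 1)) * (m₁ + m₂) := by
      have : 0 ≤ (G₁ + G₂ + G₃ * (m₀ + m₃)) * (m₁ + m₂) + Q * (m₁ + G₄ * m₂) := by positivity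
      linarith
    have b5 : G₃ * m₀ + G₁ ≤ G₁ + G₂ + G₃ * (m₀ + m₃) + Q * (G₄ + 1) := by
      have : 0 ≤ G₂ + G₃ * m₃ + Q * (G₄ + 1) := by positivity
      linarith
    have b6 := mul_le_mul_of_nonneg_right b4 (norm_nonneg (t y))
    have b7 := mul_le_mul_of_nonneg_right b5 (norm_nonneg (s y))
    linarith
  · have e1 : dir (e a) t y = -(A a y • (t y * c₃)) - kap • (star (qu a) * (s y * c₄))
        - gam' g e a y * t y := eq_sub_of_add_eq (h.eq_t y hy a)
    rw [e1]
    have b1 : ‖A a y • (t y * (c₃ : ℍ[ℝ]))‖ ≤ G₃ * m₃ * ‖t y‖ := by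
      rw [norm_smul, norm_mul]
      calc ‖A a y‖ * (‖t y‖ * m₃) ≤ G₃ * (‖t y‖ * m₃) := by gcongr
        _ = _ := by ring
    have b2 : ‖gam' g e a y * t y‖ ≤ G₂ * ‖t y‖ := by
      rw [norm_mul]; gcongr
    have b3 : ‖kap • (star (qu a) * (s y * (c₄ : ℍ[ℝ])))‖ = Q * m₄ * ‖s y‖ := by
      rw [norm_smul, Real.norm_of_nonneg hk, norm_mul, norm_mul, norm_star, hQ]
      ring
    refine (norm_sub_le _ _).trans ?_
    refine (add_le_add (norm_sub_le _ _) le_rfl).trans ?_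
    rw [norm_neg, b3]
    have b4 : Q * m₄ ≤ (G₁ + G₂ + G₃ * (m₀ + m₃) + Q * (G₄ + 1)) * m₄ := by
      have : 0 ≤ (G₁ + G₂ + G₃ * (m₀ + m₃) + Q * G₄) * m₄ := by positivity
      linarith
    have b5 : G₃ * m₃ + G₂ ≤ G₁ + G₂ + G₃ * (m₀ + m₃) + Q * (G₄ + 1) := by
      have : 0 ≤ G₁ + G₃ * m₀ + Q * (G₄ + 1) := by positivity
      linarith
    have b6 := mul_le_mul_of_nonneg_right b4 (norm_nonneg (s y))
    have b7 := mul_le_mul_of_nonneg_right b5 (norm_nonneg (t y))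
    linarith

theorem bound_prod (h : IsKillingPair g U e A c₀ c₁ c₂ c₃ c₄ s t) {x : M} (hx : x ∈ U)
    (a : Fin 4) : ∃ C : ℝ, ∀ᶠ y in 𝓝 x,
      ‖dir (e a) (fun y => (s y, t y)) y‖ ≤ C * ‖(s y, t y)‖ := by
  obtain ⟨C, hC, hev⟩ := h.exists_bounds hx a
  refine ⟨C + C * (‖(c₁ : ℍ[ℝ])‖ + ‖(c₂ : ℍ[ℝ])‖) + C * ‖(c₄ : ℍ[ℝ])‖, ?_⟩
  filter_upwards [hev, h.isOpen.mem_nhds hx] with y hy hyU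
  have hs := mdifferentiableAt_of_contMDiffOn h.isOpen h.smooth_s hyU
  have ht := mdifferentiableAt_of_contMDiffOn h.isOpen h.smooth_t hyU
  have hd : HasDir (e a) (fun y => (s y, t y)) y (dir (e a) s y, dir (e a) t y) := by
    have h1 := ((HasDir.of_mdifferentiableAt (X := e a) hs).clm
      (ContinuousLinearMap.inl ℝ ℍ[ℝ] ℍ[ℝ])).add
      ((HasDir.of_mdifferentiableAt (X := e a) ht).clm (ContinuousLinearMap.inr ℝ ℍ[ℝ] ℍ[ℝ]))
    simpa using h1
  rw [hd.2]
  have n1 : ‖s y‖ ≤ ‖(s y, t y)‖ := norm_fst_le (s y, t y)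
  have n2 : ‖t y‖ ≤ ‖(s y, t y)‖ := norm_snd_le (s y, t y)
  have n0 : 0 ≤ ‖(s y, t y)‖ := norm_nonneg _
  have m1 : 0 ≤ C * (‖(c₁ : ℍ[ℝ])‖ + ‖(c₂ : ℍ[ℝ])‖) := by positivity
  have m2 : 0 ≤ C * ‖(c₄ : ℍ[ℝ])‖ := by positivity
  rw [Prod.norm_mk]
  refine max_le ?_ ?_
  · have := mul_le_mul_of_nonneg_left n1 hC
    have := mul_le_mul_of_nonneg_left n2 m1
    have := mul_nonneg m2 n0
    linarith [hy.1]
  · have := mul_le_mul_of_nonneg_left n2 hC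
    have := mul_le_mul_of_nonneg_left n1 m2
    have := mul_nonneg m1 n0
    linarith [hy.2]

theorem bound_s (h : IsKillingPair g U e A c₀ 0 0 c₃ c₄ s t) {x : M} (hx : x ∈ U)
    (a : Fin 4) : ∃ C : ℝ, ∀ᶠ y in 𝓝 x, ‖dir (e a) s y‖ ≤ C * ‖s y‖ := by
  obtain ⟨C, -, hev⟩ := h.exists_bounds hx a
  exact ⟨C, hev.mono fun y hy => by simpa using hy.1⟩

theorem bound_t (h : IsKillingPair g U e A c₀ c₁ c₂ c₃ 0 s t) {x : M} (hx : x ∈ U)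
    (a : Fin 4) : ∃ C : ℝ, ∀ᶠ y in 𝓝 x, ‖dir (e a) t y‖ ≤ C * ‖t y‖ := by
  obtain ⟨C, -, hev⟩ := h.exists_bounds hx a
  exact ⟨C, hev.mono fun y hy => by simpa using hy.2⟩

theorem eq_zero_of_t_eventually_zero (h : IsKillingPair g U e A c₀ c₁ c₂ c₃ c₄ s t) {x : M}
    (hx : x ∈ U) (ht : ∀ᶠ y in 𝓝 x, t y = 0) (hc₄ : c₄ ≠ 0) : s x = 0 := by
  have h1 := h.eq_t x hx 0
  have h2 : dir (e 0) t x = 0 := (dir_congr (f' := fun _ => (0 : ℍ[ℝ])) ht).trans (dir_const _ _ _)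
  have h3 : star (qu 0) = 1 := by
    change star (1 : ℍ[ℝ]) = 1
    exact star_one _
  rw [h2, ht.self_of_nhds, h3] at h1
  simp only [mul_zero, zero_mul, smul_zero, neg_zero, zero_sub, add_zero, one_mul] at h1
  have hk : kap ≠ 0 := fun h0 => by simpa [h0] using kap_mul_kap
  have h4 := (smul_eq_zero.1 (neg_eq_zero.1 h1.symm)).resolve_left hk
  exact (mul_eq_zero.1 h4).resolve_right (by rwa [coeComplex_eq_zero])

theorem eq_zero_of_s_eventually_zero (h : IsKillingPair g U e A c₀ c₁ c₂ c₃ c₄ s t) {x : M}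
    (hx : x ∈ U) (hs : ∀ᶠ y in 𝓝 x, s y = 0) (ht : t x ≠ 0) (hF : maxwell g e A x ≠ 0) :
    c₁ = 0 ∧ c₂ = 0 := by
  refine eq_zero_of_killing_terms rfl hF ht fun a => ?_
  have h1 := h.eq_s x hx a
  have h2 : dir (e a) s x = 0 := (dir_congr (f' := fun _ => (0 : ℍ[ℝ])) hs).trans (dir_const _ _ _)
  rw [h2, hs.self_of_nhds] at h1
  simp only [mul_zero, zero_mul, smul_zero, neg_zero, zero_add] at h1
  have hk : kap ≠ 0 := fun h0 => by simpa [h0] using kap_mul_kap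
  exact (smul_eq_zero.1 h1.symm).resolve_left hk

end IsKillingPair

theorem IsOrthonormalFrame.continuousOn_riemann (he : IsOrthonormalFrame g U e) (hU : IsOpen U)
    (a b c d : Fin 4) : ContinuousOn (riemann g e a b c d) U := by
  have hω := he.contMDiffOn_leviCivita hU
  unfold riemann
  refine (((he.contMDiffOn_dR hU (hω b c d) a).sub (he.contMDiffOn_dR hU (hω a c d) b)).add
    (contMDiffOn_finsetSum fun f _ => (((hω b c f).mul (hω a f d)).sub
      ((hω a c f).mul (hω b f d))).sub
        ((he.contMDiffOn_structFun hU a b f).mul (hω f c d)))).continuousOn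

/-- An isotropic curvature tensor on a dense subset is isotropic. -/
theorem IsOrthonormalFrame.isIsotropic_of_dense (he : IsOrthonormalFrame g U e) (hU : IsOpen U)
    {S : ℝ} (h : ∀ V ⊆ U, IsOpen V → V.Nonempty → ∃ y ∈ V,
      IsIsotropic (fun a b c d => riemann g e a b c d y) S) {x : M} (hx : x ∈ U) :
    IsIsotropic (fun a b c d => riemann g e a b c d x) S := by
  have hR := he.continuousOn_riemann hU
  constructor
  · intro i j
    refine eq_of_eq_on_dense (f := fun y => pp (fun a b c d => riemann g e a b c d y) i j) hU
      (continuousOn_const.mul (continuousOn_sdPart (fun a b => continuousOn_sdPart (hR a b) j) i))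
      (fun V hV hVo hVn => ?_) hx
    obtain ⟨y, hy, hyS⟩ := h V hV hVo hVn
    exact ⟨y, hy, hyS.pp i j⟩
  · intro i j
    refine eq_of_eq_on_dense (f := fun y => pm (fun a b c d => riemann g e a b c d y) i j) hU
      (continuousOn_const.mul (continuousOn_sdPart (fun a b => continuousOn_asdPart (hR a b) j) i))
      (fun V hV hVo hVn => ?_) hx
    obtain ⟨y, hy, hyS⟩ := h V hV hVo hVn
    exact ⟨y, hy, hyS.pm i j⟩

end

end

/-! ### Density of the points where the spinors do not vanish. -/

section

variable {M : Type*} [TopologicalSpace M] [ChartedSpace E4 M] [IsManifold 𝓘(ℝ, E4) ∞ M]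
variable {g : Metric4 M} {S : SpinStructure g}

theorem eps_mulVec_eq_zero {v : Fin 2 → ℂ} : eps.mulVec v = 0 ↔ v = 0 := by
  constructor
  · intro h
    have h0 := congrFun h 0
    have h1 := congrFun h 1
    simp [eps, Matrix.mulVec, dotProduct, Fin.sum_univ_two] at h0 h1
    funext i
    fin_cases i <;> simpa
  · rintro rfl
    simp

theorem Spinor.toH_eq_zero {α : Spinor S} {i : S.ι} {x : M} : α.toH i x = 0 ↔ α.comp i x = 0 :=
  KillingSpinor.toH_eq_zero

theorem Spinor'.toH_eq_zero {β : Spinor' S} {i : S.ι} {x : M} : β.toH i x = 0 ↔ β.comp i x = 0 :=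
  KillingSpinor.toH_eq_zero.trans eps_mulVec_eq_zero

theorem Spinor.toH_change {α : Spinor S} {i j : S.ι} {x : M} (hx : x ∈ S.U i ∩ S.U j)
    (h : α.toH j x = 0) : α.toH i x = 0 := by
  rw [Spinor.toH_eq_zero] at h ⊢
  rw [α.change i j x hx, h, Matrix.mulVec_zero]

theorem Spinor'.toH_change {β : Spinor' S} {i j : S.ι} {x : M} (hx : x ∈ S.U i ∩ S.U j)
    (h : β.toH j x = 0) : β.toH i x = 0 := by
  rw [Spinor'.toH_eq_zero] at h ⊢
  rw [β.change i j x hx, h, Matrix.mulVec_zero]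

theorem IsKillingPair.integrabilityConditions_of_eq
    {c₀ c₁ c₂ c₄ : ℂ} {U : Set M} {e : Fin 4 → VField M} {a : Fin 4 → M → ℝ} {s t : M → ℍ[ℝ]}
    (h : IsKillingPair g U e a c₀ c₁ c₂ c₀ c₄ s t) {x : M} (hx : x ∈ U) :
    IntegrabilityConditions (fun a b c d => riemann g e a b c d x)
      (fun b c => extDer g e a b c x) (vecQuat fun b => a b x) (s x) (t x) c₀ c₁ c₂ c₀ c₄ 0 := by
  simpa using h.integrabilityConditions hx

section Density

variable [ConnectedSpace M] {A : Π x : M, TangentSpace 𝓘(ℝ, E4) x →L[ℝ] ℝ}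
variable {c₀ c₁ c₂ c₃ c₄ : ℂ} {α : Spinor S} {β : Spinor' S}

/-- Suppose t vanishes on V. If c₄ = 0, its equation is homogeneous in t alone; if c₄ ≠ 0, the
equation forces s = 0 on V, and the pair (s, t) solves a homogeneous system. Either way t vanishes
everywhere. -/
theorem exists_primed_ne_zero
    (hP : ∀ i, IsKillingPair g (S.U i) (S.e i) (S.pot A i) c₀ c₁ c₂ c₃ c₄ (α.toH i) (β.toH i))
    (hβ : β.IsNonzero) {i : S.ι} {V : Set M} (hV : V ⊆ S.U i) (hVo : IsOpen V) (hVn : V.Nonempty) :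
    ∃ x ∈ V, β.toH i x ≠ 0 := by
  by_contra! hcon
  obtain ⟨x, hx⟩ := hVn
  obtain ⟨j, y, hy, hβ⟩ := hβ
  rw [Ne, ← Spinor'.toH_eq_zero] at hβ
  refine hβ ?_
  by_cases hc : c₄ = 0
  · subst hc
    exact S.eq_zero_of_eq_zero (fun i => (hP i).smooth_t) (fun i j x hx => Spinor'.toH_change hx)
      (fun i x hx a => (hP i).bound_t hx a) (hV hx) (hcon x hx) j y hy
  · have hs : α.toH i x = 0 := (hP i).eq_zero_of_t_eventually_zero (hV hx)
      (Filter.eventually_of_mem (hVo.mem_nhds hx) hcon) hc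
    have h1 := S.eq_zero_of_eq_zero (ψ := fun i x => (α.toH i x, β.toH i x))
      (fun i => (hP i).smooth_s.prodMk_space (hP i).smooth_t)
      (fun i j x hx h => Prod.ext (Spinor.toH_change hx (congrArg Prod.fst h))
        (Spinor'.toH_change hx (congrArg Prod.snd h)))
      (fun i x hx a => (hP i).bound_prod hx a) (hV hx) (Prod.ext hs (hcon x hx)) j y hy
    exact congrArg Prod.snd h1

/-- The field must be nonzero somewhere on V together with t: only then does local vanishing of s
give c₁ = c₂ = 0 and hence a homogeneous equation for s. -/
theorem exists_unprimed_ne_zero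
    (hP : ∀ i, IsKillingPair g (S.U i) (S.e i) (S.pot A i) c₀ c₁ c₂ c₃ c₄ (α.toH i) (β.toH i))
    (hα : α.IsNonzero) {i : S.ι} {V : Set M} (hV : V ⊆ S.U i) (hVo : IsOpen V) {x : M} (hx : x ∈ V)
    (ht : β.toH i x ≠ 0) (hF : maxwell g (S.e i) (S.pot A i) x ≠ 0) :
    ∃ y ∈ V, α.toH i y ≠ 0 := by
  by_contra! hcon
  obtain ⟨j, y, hy, hα⟩ := hα
  rw [Ne, ← Spinor.toH_eq_zero] at hα
  refine hα ?_
  obtain ⟨rfl, rfl⟩ := (hP i).eq_zero_of_s_eventually_zero (hV hx)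
    (Filter.eventually_of_mem (hVo.mem_nhds hx) hcon) ht hF
  exact S.eq_zero_of_eq_zero (fun i => (hP i).smooth_s) (fun i j x hx => Spinor.toH_change hx)
    (fun i x hx a => (hP i).bound_s hx a) (hV hx) (hcon x hx) j y hy

theorem IsKillingPair.exists_maxwell_ne_zero
    (hP : ∀ i, IsKillingPair g (S.U i) (S.e i) (S.pot A i) c₀ c₁ c₂ c₃ c₄ (α.toH i) (β.toH i))
    (hF : ¬ S.IsFieldZero A) (hβ : β.IsNonzero) :
    ∃ i, ∃ x ∈ S.U i, β.toH i x ≠ 0 ∧ maxwell g (S.e i) (S.pot A i) x ≠ 0 := by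
  obtain ⟨i, x, hx, hFx⟩ : ∃ i, ∃ x ∈ S.U i, maxwell g (S.e i) (S.pot A i) x ≠ 0 := by
    by_contra! hcon
    refine hF fun i x hx => ?_
    have h0 : ∀ j : Fin 3, extDer g (S.e i) (S.pot A i) 0 j.succ x = 0 :=
      IntegrabilityConditions.asdQuat_eq_zero.1 (hcon i x hx)
    have h1 := h0 0
    have h2 := h0 1
    have h3 := h0 2
    obtain ⟨k1, k2, k3⟩ := (hP i).asd x hx
    have hsw := fun a b => extDer_swap g (S.e i) (S.pot A i) a b x
    have hd : ∀ a, extDer g (S.e i) (S.pot A i) a a x = 0 := fun a => by linarith [hsw a a]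
    change ∀ a b, extDer g (S.e i) (S.pot A i) a b x = 0
    simp only [Fin.isValue, Fin.succ_zero_eq_one, Fin.succ_one_eq_two, Fin.reduceSucc] at h1 h2 h3
    intro a b
    fin_cases a <;> fin_cases b <;> simp only [Fin.isValue, Fin.zero_eta, Fin.mk_one,
      Fin.reduceFinMk, hd] <;>
      linarith [hsw 1 0, hsw 2 0, hsw 3 0, hsw 2 1, hsw 3 1, hsw 3 2]
  obtain ⟨y, hy, hty⟩ := exists_primed_ne_zero hP hβ Set.inter_subset_left
    (isOpen_ne_zero (S.isOpen_U i) fun x hx => ((hP i).mdifferentiableAt_maxwell hx).continuousAt) ⟨x, hx, hFx⟩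
  exact ⟨i, y, hy.1, hty, hy.2⟩

theorem c₀_eq_c₃_of_field
    (hP : ∀ i, IsKillingPair g (S.U i) (S.e i) (S.pot A i) c₀ c₁ c₂ c₃ c₄ (α.toH i) (β.toH i))
    (hF : ¬ S.IsFieldZero A) (hα : α.IsNonzero) (hβ : β.IsNonzero) : c₀ = c₃ := by
  obtain ⟨i, x, hx, ht, hFx⟩ := IsKillingPair.exists_maxwell_ne_zero hP hF hβ
  have h1 := isOpen_ne_zero (S.isOpen_U i) fun x hx => ((hP i).mdifferentiableAt_maxwell hx).continuousAt
  have h2 := isOpen_ne_zero h1 fun x hx =>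
    (mdifferentiableAt_of_contMDiffOn (S.isOpen_U i) (hP i).smooth_t hx.1).continuousAt
  obtain ⟨y, hy, hs⟩ := exists_unprimed_ne_zero hP hα
    (Set.inter_subset_left.trans Set.inter_subset_left) h2 ⟨⟨hx, hFx⟩, ht⟩ ht hFx
  exact (hP i).c₀_eq_c₃ hy.1.1 hs hy.2 hy.1.2

/-- On the part W of V where t ≠ 0, `pp` is already isotropic. For `pm`, either s is nonzero
somewhere on W, or s vanishes on W and then the field vanishes at the chosen point; each case has
its own reason for `pm` to vanish. -/
theorem exists_isIsotropic
    (hP : ∀ i, IsKillingPair g (S.U i) (S.e i) (S.pot A i) c₀ c₁ c₂ c₀ c₄ (α.toH i) (β.toH i))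
    (hα : α.IsNonzero) (hβ : β.IsNonzero) {i : S.ι} {V : Set M} (hV : V ⊆ S.U i) (hVo : IsOpen V)
    (hVn : V.Nonempty) : ∃ x ∈ V, c₂ * c₄ = ((-(-(c₂ * c₄).re) : ℝ) : ℂ) ∧
      IsIsotropic (fun a b c d => riemann g (S.e i) a b c d x) (-(c₂ * c₄).re) := by
  obtain ⟨x, hx, ht⟩ := exists_primed_ne_zero hP hβ hV hVo hVn
  set W := V ∩ β.toH i ⁻¹' {0}ᶜ with hW
  have hWo : IsOpen W := isOpen_ne_zero hVo fun x hx =>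
    (mdifferentiableAt_of_contMDiffOn (S.isOpen_U i) (hP i).smooth_t (hV hx)).continuousAt
  have hgood : ∀ y ∈ W, (∀ k l, pm (fun a b c d => riemann g (S.e i) a b c d y) k l = 0) →
      c₂ * c₄ = ((-(-(c₂ * c₄).re) : ℝ) : ℂ) ∧
      IsIsotropic (fun a b c d => riemann g (S.e i) a b c d y) (-(c₂ * c₄).re) := by
    intro y hy hpm
    obtain ⟨T, hpp, hT⟩ := ((hP i).integrabilityConditions_of_eq (hV hy.1)).pp_eq_of_eq hy.2
    have h1 : (c₂ * c₄).re = -T := by rw [hT]; simp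
    have h2 : -(c₂ * c₄).re = T := by rw [h1, neg_neg]
    rw [h2]
    exact ⟨by rw [hT]; push_cast; rfl, hpp, hpm⟩
  by_cases hs : ∃ y ∈ W, α.toH i y ≠ 0
  · obtain ⟨y, hy, hsy⟩ := hs
    exact ⟨y, hy.1, hgood y hy
      (((hP i).integrabilityConditions_of_eq (hV hy.1)).pm_eq_zero hsy)⟩
  · have hFx : maxwell g (S.e i) (S.pot A i) x = 0 := by
      by_contra hFx
      exact hs (exists_unprimed_ne_zero hP hα (Set.inter_subset_left.trans hV) hWo ⟨hx, ht⟩ ht hFx)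
    exact ⟨x, hx, hgood x ⟨hx, ht⟩
      (((hP i).integrabilityConditions_of_eq (hV hx)).pm_eq_zero_of_field ht hFx)⟩

end Density

end

end KillingSpinor

end

theorem proposition1 {M : Type*} [TopologicalSpace M] [ConnectedSpace M]
    [ChartedSpace KillingSpinor.E4 M] [IsManifold 𝓘(ℝ, KillingSpinor.E4) ∞ M]
    (g : KillingSpinor.Metric4 M) (S : KillingSpinor.SpinStructure g)
    (A : Π x : M, TangentSpace 𝓘(ℝ, KillingSpinor.E4) x →L[ℝ] ℝ)
    (hA : KillingSpinor.IsSmoothOneForm A)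
    (hASD : S.IsFieldASD A)
    (c₀ c₁ c₂ c₃ c₄ : ℂ)
    (α : KillingSpinor.Spinor S) (β : KillingSpinor.Spinor' S)
    (hαβ : S.KillingSpinorEquations A c₀ c₁ c₂ c₃ c₄ α β)
    (hα : α.IsNonzero) (hβ : β.IsNonzero)
    (hF : S.IsFieldZero A → c₀ = c₃) :
    S.IsAntiSelfDual ∧ S.IsEinstein ∧
      c₀ = c₃ ∧
      (¬ S.IsFieldZero A → c₃ = - (c₁ * c₄)) ∧
      (∀ i, ∀ x ∈ S.U i,
        c₂ * c₄ = - ((KillingSpinor.scalar g (S.e i) x / 24 : ℝ) : ℂ)) := by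
  have hP := KillingSpinor.isKillingPair hA hASD hαβ
  have hc : c₀ = c₃ := by
    by_cases h : S.IsFieldZero A
    · exact hF h
    · exact KillingSpinor.c₀_eq_c₃_of_field hP h hα hβ
  subst hc
  -- The factor -Re(c₂c₄) is the same at all points, so isotropy on a dense set passes to every
  -- point by continuity of the curvature.
  have hiso : ∀ i, ∀ x ∈ S.U i, KillingSpinor.IsIsotropic
      (fun a b c d => KillingSpinor.riemann g (S.e i) a b c d x) (-(c₂ * c₄).re) := by
    intro i x hx
    refine (S.frame i).isIsotropic_of_dense (S.isOpen_U i) (fun V hV hVo hVn => ?_) hx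
    obtain ⟨y, hy, -, h⟩ := KillingSpinor.exists_isIsotropic hP hα hβ hV hVo hVn
    exact ⟨y, hy, h⟩
  have hR : ∀ i, ∀ x ∈ S.U i, KillingSpinor.IsCurvature
      fun a b c d => KillingSpinor.riemann g (S.e i) a b c d x := fun i x hx =>
    (S.frame i).isCurvature (S.isOpen_U i) hx
  refine ⟨fun i x hx a b c d => (hiso i x hx).antiSelfDual (hR i x hx) a b c d,
    fun i x hx a b => (hiso i x hx).einstein (hR i x hx) a b, rfl, fun h => ?_, fun i x hx => ?_⟩
  · obtain ⟨i, x, hx, ht, hFx⟩ := KillingSpinor.IsKillingPair.exists_maxwell_ne_zero hP h hβ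
    exact ((hP i).integrabilityConditions_of_eq hx).coupling ht hFx (hiso i x hx).pm
  · obtain ⟨y, -, h, -⟩ := KillingSpinor.exists_isIsotropic hP hα hβ subset_rfl (S.isOpen_U i)
      ⟨x, hx⟩
    rw [(hiso i x hx).scalar_eq (hR i x hx), h]
    push_cast
    simp
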